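/- Let $\gamma,\sigma,\mathcal L>0$ and $j=\sqrt{-1}$. Let $I_m$ be the modified Bessel function of the first kind, and for $m\ge 1$ and $r,r_0\ge 0$ let $$a_m=\frac{\sqrt{jm\gamma}}{\sigma}\coth\!\left(\sqrt{jm\gamma\sigma^2}\,\mathcal L\right),\qquad b_m=\frac{\sqrt{jm\gamma}}{\sigma}\,\frac{1}{\sinh\!\left(\sqrt{jm\gamma\sigma^2}\,\mathcal L\right)},\qquad C_m(r,r_0)=r\,b_m\,e^{-a_m(r^2+r_0^2)}I_m(2b_mr_0r).$$ The per-sample zero-dispersion channel maps an input $X$ with polar coordinates $(R_0,\Phi_0)\in[0,\infty)\times[0,2\pi)$ to an output $Y$ with polar coordinates $(R,\Phi)\in[0,\infty)\times[0,2\pi)$, with conditional density with respect to $dr\,d\phi$ $$p(r,\phi\mid r_0,\phi_0)=\frac1{2\pi}\,p_{R|R_0}(r|r_0)+\frac{w}{\pi}\sum_{m\ge1}\Re\!\left(C_m(r,r_0)\,e^{jm(\phi-\phi_0-\tau r_0^2)}\right),\qquad p_{R|R_0}(r|r_0)=\frac{2r}{\sigma^2\mathcal L}\,e^{-\frac{r^2+r_0^2}{\sigma^2\mathcal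 L}}I_0\!\left(\frac{2rr_0}{\sigma^2\mathcal L}\right),$$ where either $(w,\tau)=(1,\gamma\mathcal L)$ or $(w,\tau)=(2,0)$. (The second choice gives the law of $Y=[X+W(\mathcal L)]\,e^{j\gamma\int_0^{\mathcal L}|X+W(\ell)|^2d\ell}$, where $W$ is a complex Wiener process with variance $\ell\sigma^2$.) Let $\mathcal F$ be one of the following sets of probability distributions $F_{R_0}$ on $[0,\infty)$: 1. (peak amplitude) all $F_{R_0}$ with $\int_0^\rho dF_{R_0}=1$, for some $0<\rho<\infty$; 2. (average cost) all $F_{R_0}$ with $\int_0^\infty\mathcal C(r_0)\,dF_{R_0}(r_0)\le A$, for some $0<A<\infty$ and some $\mathcal C:[0,\infty)\to[0,\infty)$ that is lower semicontinuous and nondecreasing, with $\mathcal C(0)=0$ and $\mathcal C(r_0)\to\infty$ as $r_0\to\infty$, that extends analytically to a strip $\{z\in\mathbb C:|\Im z|<\delta\}$ for some $\delta>0$, and that satisfies $r_0^2=o(\mathcal C(r_0))$ as $r_0\to\infty$; 3. (joint) the intersection of a set as in 1 and a set as in 2, where in 2 the condition $r_0^2=o(\mathcal C(r_0))$ is weakened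 to $\ln r_0=o(\mathcal C(r_0))$. Let $C=\sup I(X;Y)$, where the supremum is over all laws of the input $(R_0,\Phi_0)$ whose amplitude law $F_{R_0}$ is in $\mathcal F$. For $F_{R_0}\in\mathcal F$ let $I(F_{R_0})=I(R_0,\Phi_0^*;R,\Phi)$ be the mutual information when $\Phi_0^*$ is uniform on $[0,2\pi)$ and independent of $R_0$. Then $$C=\max_{F_{R_0}\in\mathcal F}I(F_{R_0}),$$ and the maximum is attained. Moreover, for every $F_{R_0}\in\mathcal F$ the mutual information $I(F_{R_0})$ and the entropies $h(R)$ and $h(R,\Phi\mid R_0,\Phi_0^*)$ are well defined and finite, and $$I(F_{R_0})=h(R)+\ln(2\pi)-h(R,\Phi\mid R_0,\Phi_0^*).$$ -/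

import Mathlib

open MeasureTheory Set Filter Topology
open scoped ENNReal

namespace PZD

noncomputable section

/-! ### The per-sample zero-dispersion channel -/

/-- The modified Bessel function of the first kind `I_m`, of integer order `m ≥ 0`, by its
everywhere convergent power series. -/
def besselI (m : ℕ) (z : ℂ) : ℂ :=
  ∑' k : ℕ, (z / 2) ^ (2 * k + m) / ((k.factorial : ℂ) * ((k + m).factorial : ℂ))

/-- The principal square root of `j m γ`. -/
def rootJ (γ : ℝ) (m : ℕ) : ℂ := (Complex.I * (m : ℂ) * (γ : ℂ)) ^ (1 / 2 : ℂ)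

/-- `a_m = (√(j m γ) / σ) coth (√(j m γ σ²) L)`, for `σ > 0`. -/
def coeffA (γ σ L : ℝ) (m : ℕ) : ℂ :=
  rootJ γ m / σ * (Complex.cosh (rootJ γ m * σ * L) / Complex.sinh (rootJ γ m * σ * L))

/-- `b_m = (√(j m γ) / σ) / sinh (√(j m γ σ²) L)`, for `σ > 0`. -/
def coeffB (γ σ L : ℝ) (m : ℕ) : ℂ :=
  rootJ γ m / σ * (1 / Complex.sinh (rootJ γ m * σ * L))

/-- `C_m(r, r₀) = r b_m exp (-a_m (r² + r₀²)) I_m (2 b_m r₀ r)`. -/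
def coeffC (γ σ L : ℝ) (m : ℕ) (r r₀ : ℝ) : ℂ :=
  r * coeffB γ σ L m * Complex.exp (-coeffA γ σ L m * ((r : ℂ) ^ 2 + (r₀ : ℂ) ^ 2)) *
    besselI m (2 * coeffB γ σ L m * r₀ * r)

/-- The conditional density `p(r | r₀)` of the output amplitude. -/
def amplitudePdf (σ L : ℝ) (r r₀ : ℝ) : ℝ :=
  2 * r / (σ ^ 2 * L) * Real.exp (-(r ^ 2 + r₀ ^ 2) / (σ ^ 2 * L)) *
    (besselI 0 ((2 * r * r₀ / (σ ^ 2 * L) : ℝ) : ℂ)).re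

/-- The conditional density of the output `y = (r, φ)` given the input `x = (r₀, φ₀)`, in polar
coordinates and with respect to `dr dφ`. The harmonics carry the weight `w`, and the phase
reference is `φ₀ + τ r₀²`. -/
def condPdf (γ σ L w τ : ℝ) (y x : ℝ × ℝ) : ℝ :=
  1 / (2 * Real.pi) * amplitudePdf σ L y.1 x.1 +
    w / Real.pi * ∑' k : ℕ, (coeffC γ σ L (k + 1) y.1 x.1 *
      Complex.exp (Complex.I * ((k + 1 : ℕ) : ℂ) *
        ((y.2 - x.2 - τ * x.1 ^ 2 : ℝ) : ℂ))).re

/-- The range `[0, ∞) × [0, 2π)` of the polar coordinates. -/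
def polarDomain : Set (ℝ × ℝ) := Ici 0 ×ˢ Ico 0 (2 * Real.pi)

/-- Lebesgue measure `dr dφ` on the range of the polar coordinates. -/
def polarMeasure : Measure (ℝ × ℝ) := volume.restrict polarDomain

/-- The law of the output `(R, Φ)` given the input `x = (r₀, φ₀)`. -/
def channelLaw (γ σ L w τ : ℝ) (x : ℝ × ℝ) : Measure (ℝ × ℝ) :=
  polarMeasure.withDensity fun y => ENNReal.ofReal (condPdf γ σ L w τ y x)

/-- The joint law `p(y | x) dy dμ(x)` of input and output for the input law `μ`. -/
def jointLaw (γ σ L w τ : ℝ) (μ : Measure (ℝ × ℝ)) : Measure ((ℝ × ℝ) × (ℝ × ℝ)) :=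
  (μ.prod polarMeasure).withDensity fun z => ENNReal.ofReal (condPdf γ σ L w τ z.2 z.1)

/-- The law of the output `(R, Φ)` for the input law `μ`. -/
def outputLaw (γ σ L w τ : ℝ) (μ : Measure (ℝ × ℝ)) : Measure (ℝ × ℝ) :=
  (jointLaw γ σ L w τ μ).snd

/-! ### Information measures (in nats) -/

/-- The mutual information of the two components of a joint law `P`: the Kullback-Leibler
divergence of `P` from the product of its marginals. -/
def mutualInfo {α β : Type*} [MeasurableSpace α] [MeasurableSpace β]
    (P : Measure (α × β)) : ℝ≥0∞ :=
  InformationTheory.klDiv P (P.fst.prod P.snd)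

/-- The law `P` has a density `f` for which `f log f` is integrable. -/
def HasFiniteEntropy {α : Type*} [MeasureSpace α] (P : Measure α) : Prop :=
  P ≪ volume ∧ Integrable (fun x => Real.negMulLog (P.rnDeriv volume x).toReal) volume

/-- The differential entropy `- ∫ f log f` of a law with density `f`. -/
def diffEntropy {α : Type*} [MeasureSpace α] (P : Measure α) : ℝ :=
  ∫ x, Real.negMulLog (P.rnDeriv volume x).toReal

/-- The conditional entropy `h(R, Φ | R₀, Φ₀)` is well defined and finite for the input
law `μ`. -/
def HasFiniteCondEntropy (γ σ L w τ : ℝ) (μ : Measure (ℝ × ℝ)) : Prop :=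
  (∀ᵐ x ∂μ, HasFiniteEntropy (channelLaw γ σ L w τ x)) ∧
    Integrable (fun x => diffEntropy (channelLaw γ σ L w τ x)) μ

/-- The conditional entropy `h(R, Φ | R₀, Φ₀)` for the input law `μ`. -/
def condEntropy (γ σ L w τ : ℝ) (μ : Measure (ℝ × ℝ)) : ℝ :=
  ∫ x, diffEntropy (channelLaw γ σ L w τ x) ∂μ

/-! ### Input constraints -/

/-- A probability law on `[0, ∞)`. -/
def IsAmplitudeLaw (ν : Measure ℝ) : Prop :=
  IsProbabilityMeasure ν ∧ ν (Iio 0) = 0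

/-- A cost function on `[0, ∞)`; only the values of `c` there matter. It grows faster than
`g`, it is lower semicontinuous, nondecreasing, zero at `0` and unbounded, and it extends
analytically to a horizontal strip. -/
structure IsCost (g c : ℝ → ℝ) : Prop where
  lsc : LowerSemicontinuousOn c (Ici 0)
  mono : MonotoneOn c (Ici 0)
  zero : c 0 = 0
  tendsto : Tendsto c atTop atTop
  analytic : ∃ δ : ℝ, 0 < δ ∧ ∃ f : ℂ → ℂ,
    AnalyticOnNhd ℂ f {z : ℂ | |z.im| < δ} ∧ ∀ r : ℝ, 0 ≤ r → f (r : ℂ) = (c r : ℂ)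
  growth : g =o[atTop] c

/-- Peak amplitude constraint: the amplitude is at most `ρ`. -/
def peakSet (ρ : ℝ) : Set (Measure ℝ) :=
  {ν | IsAmplitudeLaw ν ∧ ν (Icc 0 ρ) = 1}

/-- Average cost constraint: the mean of `c` is at most `A`. -/
def costSet (c : ℝ → ℝ) (A : ℝ) : Set (Measure ℝ) :=
  {ν | IsAmplitudeLaw ν ∧ ∫⁻ r, ENNReal.ofReal (c r) ∂ν ≤ ENNReal.ofReal A}

/-- The three kinds of constraint sets: peak amplitude, average cost with a cost function that
grows faster than `r²`, and both jointly with a cost function that grows faster than `log r`. -/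
inductive IsConstraintSet : Set (Measure ℝ) → Prop
  | peak (ρ : ℝ) (hρ : 0 < ρ) : IsConstraintSet (peakSet ρ)
  | cost (c : ℝ → ℝ) (A : ℝ) (hc : IsCost (fun r => r ^ 2) c) (hA : 0 < A) :
      IsConstraintSet (costSet c A)
  | joint (ρ : ℝ) (c : ℝ → ℝ) (A : ℝ) (hρ : 0 < ρ) (hc : IsCost Real.log c) (hA : 0 < A) :
      IsConstraintSet (peakSet ρ ∩ costSet c A)

/-! ### Capacity -/

/-- The input laws, in polar coordinates `(R₀, Φ₀)`, whose amplitude law belongs to `ℱ`. -/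
def admissible (ℱ : Set (Measure ℝ)) : Set (Measure (ℝ × ℝ)) :=
  {μ | IsProbabilityMeasure μ ∧ μ polarDomainᶜ = 0 ∧ μ.fst ∈ ℱ}

/-- The capacity: the supremum of the mutual information over all admissible input laws. -/
def capacity (γ σ L w τ : ℝ) (ℱ : Set (Measure ℝ)) : ℝ≥0∞ :=
  ⨆ μ ∈ admissible ℱ, mutualInfo (jointLaw γ σ L w τ μ)

/-- The uniform law on `[0, 2π)`. -/
def uniformPhase : Measure ℝ :=
  (ENNReal.ofReal (2 * Real.pi))⁻¹ • volume.restrict (Ico 0 (2 * Real.pi))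

/-- The input law with amplitude law `ν` and an independent uniform phase. -/
def uniformPhaseInput (ν : Measure ℝ) : Measure (ℝ × ℝ) := ν.prod uniformPhase

/-- `I(F_{R₀})`, the mutual information `I(R₀, Φ₀*; R, Φ)` for the amplitude law `ν` and an
independent uniform phase `Φ₀*`. -/
def amplitudeInfo (γ σ L w τ : ℝ) (ν : Measure ℝ) : ℝ≥0∞ :=
  mutualInfo (jointLaw γ σ L w τ (uniformPhaseInput ν))

end

end PZD

namespace PZD

noncomputable section

section

/-! ### Positive definite sequences -/

/-! Two things need proof: the given series is a genuine transition density with good tails, and the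
resulting optimization problem is solved by a uniform phase and a compactness argument.

The hard point in the first is nonnegativity. Put `v = σ² L`, `T = γ σ² L²`. Up to the factor `r /
v`, the harmonic `C_k` is the `k`-th angular Fourier coefficient of a Mehler kernel at the imaginary
argument `x² = j k T`, with `α = |x + y|² / 2` and `β = |x - y|² / 2` as weights of `x tanh (x/2)`
and `x coth (x/2)` in the exponent. The product of Euler for `x / sinh x` and the partial fractions
of these two functions write the kernel as a limit of products of factors `l / (l + j k T)` and `exp
(-c j k T / (l + j k T))`. As functions of `k` these are characteristic functions of exponential and
compound Poisson laws, so the kernel is positive definite in `k` (`isPosDefSeq_mehler`). The Fejér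
argument (`IsPosDefSeq.nonneg_of_hasSum`) then gives a nonnegative Fourier series for `w = 2`, and
`w = 1` is a mixture of that case with the phase-averaged density. The same expansions bound the
`k`-th harmonic by a multiple of `|r| k⁻² exp (-κ (r² + r₀²))`, so that the Rician term alone
decides the tails. The outcome is summarized in `isPolarKernel_harmonicKernel`; the rest uses
nothing else about Bessel functions.

For the second, every entropy integral is finite once the input has a second moment, and mutual
information is output entropy minus conditional entropy (`mutualInfo_jointLaw`). The conditional
entropy depends on the input amplitude only, because the phases enter through a difference. So does
the output amplitude law. For a fixed amplitude law it remains to maximize the output entropy, and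
relative entropy with respect to the density `p_R(r) / (2π)` bounds it by `h(R) + log (2π)`
(`integral_negMulLog_outDensity_le`), with equality for a uniform phase.

The maximum over amplitude laws exists because the constraint sets are weakly compact, by Prokhorov,
and the functional is upper semicontinuous (`eventually_phaseInfo_lt`). Continuity of the
conditional entropy uses a moment of higher order than two, and upper semicontinuity of `h(R)` is
Fatou's lemma. -/

/-- A two-sided sequence whose Toeplitz forms have nonnegative real part. -/
def IsPosDefSeq (f : ℤ → ℂ) : Prop :=
  ∀ (M : ℕ) (z : ℕ → ℂ), 0 ≤ (∑ m ∈ Finset.range M, ∑ n ∈ Finset.range M,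
    z m * (starRingEnd ℂ) (z n) * f ((m : ℤ) - n)).re

namespace IsPosDefSeq

lemma one : IsPosDefSeq fun _ => 1 := by
  intro M z
  have : (∑ m ∈ Finset.range M, ∑ n ∈ Finset.range M, z m * (starRingEnd ℂ) (z n) * 1)
      = (∑ m ∈ Finset.range M, z m) * (starRingEnd ℂ) (∑ m ∈ Finset.range M, z m) := by
    rw [map_sum, Finset.sum_mul_sum]
    simp
  rw [this, Complex.mul_conj]
  exact_mod_cast Complex.normSq_nonneg _

lemma add {f g : ℤ → ℂ} (hf : IsPosDefSeq f) (hg : IsPosDefSeq g) :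
    IsPosDefSeq fun k => f k + g k := by
  intro M z
  have := add_nonneg (hf M z) (hg M z)
  rw [← Complex.add_re, ← Finset.sum_add_distrib] at this
  simp_rw [← Finset.sum_add_distrib, ← mul_add] at this
  exact this

lemma const_mul {f : ℤ → ℂ} (hf : IsPosDefSeq f) {c : ℝ} (hc : 0 ≤ c) :
    IsPosDefSeq fun k => (c : ℂ) * f k := by
  intro M z
  have := mul_nonneg hc (hf M z)
  rw [← Complex.re_ofReal_mul, Finset.mul_sum] at this
  simp_rw [Finset.mul_sum] at this
  refine this.trans_eq (congrArg _ (Finset.sum_congr rfl fun m _ => Finset.sum_congr rfl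
    fun n _ => ?_))
  ring

lemma of_tendsto {F : ℕ → ℤ → ℂ} {f : ℤ → ℂ} (hF : ∀ n, IsPosDefSeq (F n))
    (h : ∀ k, Tendsto (fun n => F n k) atTop (𝓝 (f k))) : IsPosDefSeq f := by
  intro M z
  refine ge_of_tendsto' (x := atTop) ((Complex.continuous_re.tendsto _).comp
    (tendsto_finsetSum _ fun m _ => tendsto_finsetSum _ fun n _ =>
      (h ((m : ℤ) - n)).const_mul (z m * (starRingEnd ℂ) (z n)))) fun N => hF N M z

/-- The character is absorbed into the test vector, `z m ↦ z m e^{j m t}`. -/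
lemma twist {f : ℤ → ℂ} (hf : IsPosDefSeq f) (t : ℝ) :
    IsPosDefSeq fun k => Complex.exp (Complex.I * k * t) * f k := by
  intro M z
  refine (hf M fun m => z m * Complex.exp (Complex.I * m * t)).trans_eq
    (congrArg _ (Finset.sum_congr rfl fun m _ => Finset.sum_congr rfl fun n _ => ?_))
  rw [map_mul, ← Complex.exp_conj]
  simp only [map_mul, Complex.conj_I, Complex.conj_ofReal, map_natCast]
  rw [show Complex.I * (((m : ℤ) - (n : ℤ) : ℤ) : ℂ) * t
    = Complex.I * m * t + -Complex.I * n * t by push_cast; ring, Complex.exp_add]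
  ring

lemma integral {α : Type*} [MeasurableSpace α] {μ : Measure α} {F : α → ℤ → ℂ}
    (hF : ∀ t, IsPosDefSeq (F t)) (hi : ∀ k, Integrable (fun t => F t k) μ) :
    IsPosDefSeq fun k => ∫ t, F t k ∂μ := by
  intro M z
  have h1 : ∀ m n : ℕ, Integrable
      (fun t => z m * (starRingEnd ℂ) (z n) * F t ((m : ℤ) - n)) μ :=
    fun m n => (hi _).const_mul _
  have h2 : (∑ m ∈ Finset.range M, ∑ n ∈ Finset.range M,
      z m * (starRingEnd ℂ) (z n) * ∫ t, F t ((m : ℤ) - n) ∂μ)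
      = ∫ t, ∑ m ∈ Finset.range M, ∑ n ∈ Finset.range M,
        z m * (starRingEnd ℂ) (z n) * F t ((m : ℤ) - n) ∂μ := by
    rw [integral_finsetSum _ fun m _ => integrable_finsetSum _ fun n _ => h1 m n]
    refine Finset.sum_congr rfl fun m _ => ?_
    rw [integral_finsetSum _ fun n _ => h1 m n]
    exact Finset.sum_congr rfl fun n _ => (integral_const_mul _ _).symm
  rw [h2]
  have h3 := integral_re (𝕜 := ℂ) (integrable_finsetSum (Finset.range M)
    fun m _ => integrable_finsetSum (Finset.range M) fun n _ => h1 m n)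
  simp only [RCLike.re_eq_complex_re] at h3
  rw [← h3]
  exact integral_nonneg fun t => hF t M z

/-- `1 / (l + j k T)` is the integral of `e^{-l t} e^{-j k T t}` over `t > 0`, a mixture of twists
with positive weights. -/
lemma mul_resolvent {f : ℤ → ℂ} (hf : IsPosDefSeq f) {l : ℝ} (hl : 0 < l) (T : ℝ) :
    IsPosDefSeq fun k => f k * (1 / (l + Complex.I * k * T)) := by
  have hre : ∀ k : ℤ, (-(l + Complex.I * k * T) : ℂ).re < 0 := by
    intro k
    simpa using hl
  have h1 : ∀ k : ℤ, f k * (1 / (l + Complex.I * k * T)) =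
      ∫ t in Ioi (0 : ℝ), Complex.exp (-(l + Complex.I * k * T) * t) * f k := by
    intro k
    rw [integral_mul_const, integral_exp_mul_complex_Ioi (hre k)]
    simp only [Complex.ofReal_zero, mul_zero, Complex.exp_zero]
    rw [neg_div_neg_eq, mul_comm]
  simp_rw [h1]
  refine integral (fun t => ?_) fun k => ?_
  · have := ((hf.twist (-T * t)).const_mul (Real.exp_nonneg (-l * t)))
    convert this using 2 with k
    rw [← mul_assoc, Complex.ofReal_exp, ← Complex.exp_add]
    congr 2
    push_cast
    ring
  · exact (integrableOn_exp_mul_complex_Ioi (hre k) 0).mul_const _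

/-- Expand the exponential: every power of the resolvent preserves positive definiteness, and the
Taylor coefficients are nonnegative. -/
lemma mul_exp_resolvent {f : ℤ → ℂ} (hf : IsPosDefSeq f) {l : ℝ} (hl : 0 < l) (T : ℝ)
    {c : ℝ} (hc : 0 ≤ c) :
    IsPosDefSeq fun k => f k * Complex.exp (c * (1 / (l + Complex.I * k * T))) := by
  have hpow : ∀ n : ℕ, IsPosDefSeq fun k => f k * (c * (1 / (l + Complex.I * k * T))) ^ n := by
    intro n
    induction n with
    | zero => simpa using hf
    | succ n ih =>
      convert (ih.mul_resolvent hl T).const_mul hc using 2 with k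
      ring
  have hsum : ∀ N : ℕ, IsPosDefSeq fun k => ∑ n ∈ Finset.range N,
      f k * ((c * (1 / (l + Complex.I * k * T))) ^ n / (n.factorial : ℂ)) := by
    intro N
    induction N with
    | zero => simpa using hf.const_mul le_rfl
    | succ N ih =>
      simp_rw [Finset.sum_range_succ]
      refine ih.add ?_
      convert (hpow N).const_mul (c := ((N.factorial : ℝ))⁻¹) (by positivity) using 2 with k
      push_cast
      ring
  refine of_tendsto hsum fun k => ?_
  rw [Complex.exp_eq_exp_ℂ]
  simp_rw [← Finset.mul_sum]
  exact ((NormedSpace.expSeries_div_hasSum_exp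
    ((c : ℂ) * (1 / (l + Complex.I * k * T)))).tendsto_sum_nat).const_mul _

/-- With `s = j k T` one has `-c s / (s + l) = -c + c l / (l + s)`, so this is the previous factor
with constant `c l`, times `e^{-c}`: a compound Poisson characteristic function with exponential
jumps. -/
lemma mul_exp_drift {f : ℤ → ℂ} (hf : IsPosDefSeq f) {l : ℝ} (hl : 0 < l) (T : ℝ)
    {c : ℝ} (hc : 0 ≤ c) :
    IsPosDefSeq fun k => f k *
      Complex.exp (-(c * ((Complex.I * k * T) / (Complex.I * k * T + l)))) := by
  convert (hf.mul_exp_resolvent hl T (mul_nonneg hc hl.le)).const_mul (Real.exp_nonneg (-c))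
    using 2 with k
  have h0 : (Complex.I * k * T + l : ℂ) ≠ 0 := by
    intro h
    have := congrArg Complex.re h
    simp at this
    exact hl.ne' this
  rw [show -((c : ℂ) * ((Complex.I * k * T) / (Complex.I * k * T + l)))
    = (-c : ℝ) + ((c * l : ℝ) : ℂ) * (1 / (l + Complex.I * k * T)) by
      rw [add_comm (l : ℂ)]; field_simp; push_cast; ring, Complex.exp_add, Complex.ofReal_exp]
  ring

/-- The Cesàro sums of the Fourier series of a positive definite sequence are nonnegative, so the
series is nonnegative where it converges. -/
lemma nonneg_of_hasSum {f : ℤ → ℂ} (hf : IsPosDefSeq f)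
    (hconj : ∀ k : ℕ, f (-(k : ℤ) - 1) = (starRingEnd ℂ) (f (k + 1))) {S : ℝ}
    (hS : HasSum (fun k : ℕ => (f (k + 1)).re) S) : 0 ≤ (f 0).re + 2 * S := by
  set D : ℕ → ℝ := fun M => (∑ m ∈ Finset.range M, ∑ n ∈ Finset.range M,
    f ((m : ℤ) - n)).re with hD
  have hDnn : ∀ M, 0 ≤ D M := by
    intro M
    simpa [hD] using hf M (fun _ => 1)
  set F : ℕ → ℝ := fun M => (f 0).re + 2 * ∑ k ∈ Finset.range M, (f (k + 1)).re with hF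
  -- Enlarging the all-ones Toeplitz form by one row and one column adds exactly the symmetric
  -- partial sum of the Fourier series. Hence `D M / M` is the Cesàro mean of these partial sums.
  have hstep : ∀ M, D (M + 1) = D M + F M := by
    intro M
    have e1 : ∑ m ∈ Finset.range (M + 1), ∑ n ∈ Finset.range (M + 1), f ((m : ℤ) - n)
        = (∑ m ∈ Finset.range M, ∑ n ∈ Finset.range M, f ((m : ℤ) - n))
          + (∑ m ∈ Finset.range M, f ((m : ℤ) - M)) + (∑ n ∈ Finset.range M, f ((M : ℤ) - n))
          + f 0 := by
      rw [Finset.sum_range_succ]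
      simp_rw [Finset.sum_range_succ _ M]
      rw [Finset.sum_add_distrib]
      simp only [sub_self]
      ring
    have e2 : ∑ n ∈ Finset.range M, f ((M : ℤ) - n) = ∑ k ∈ Finset.range M, f (k + 1) := by
      rw [← Finset.sum_range_reflect]
      refine Finset.sum_congr rfl fun k hk => ?_
      have := Finset.mem_range.1 hk
      congr 1
      omega
    have e3 : ∑ n ∈ Finset.range M, f ((n : ℤ) - M)
        = ∑ k ∈ Finset.range M, (starRingEnd ℂ) (f (k + 1)) := by
      rw [← Finset.sum_range_reflect]
      refine Finset.sum_congr rfl fun k hk => ?_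
      have := Finset.mem_range.1 hk
      rw [← hconj]
      congr 1
      omega
    simp only [hD, hF]
    rw [e1, e2, e3]
    simp only [Complex.add_re, Complex.re_sum, Complex.conj_re]
    ring
  have hDF : ∀ M, D M = ∑ k ∈ Finset.range M, F k := by
    intro M
    induction M with
    | zero => simp [hD]
    | succ M ih => rw [hstep, ih, Finset.sum_range_succ]
  have hlim : Tendsto F atTop (𝓝 ((f 0).re + 2 * S)) :=
    (hS.tendsto_sum_nat.const_mul 2).const_add _
  refine ge_of_tendsto' hlim.cesaro fun M => ?_
  rw [← hDF]
  exact mul_nonneg (by positivity) (hDnn M)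

end IsPosDefSeq

/-! ### Product and partial fraction expansions of hyperbolic functions -/

/-- The partial products of `x / sinh x` in terms of `s = x ^ 2`. -/
def cschProd (N : ℕ) (s : ℂ) : ℂ :=
  ∏ n ∈ Finset.range N, (1 + s / (((n + 1 : ℝ) ^ 2 * Real.pi ^ 2 : ℝ) : ℂ))⁻¹

/-- The partial sums of `x coth (x / 2)` in terms of `s = x ^ 2`. -/
def cothSum (N : ℕ) (s : ℂ) : ℂ :=
  2 + ∑ n ∈ Finset.range N, 4 * (s / (s + ((4 * (n + 1 : ℝ) ^ 2 * Real.pi ^ 2 : ℝ) : ℂ)))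

/-- The partial sums of `x tanh (x / 2)` in terms of `s = x ^ 2`. -/
def tanhSum (N : ℕ) (s : ℂ) : ℂ :=
  ∑ n ∈ Finset.range N, 4 * (s / (s + (((2 * n + 1 : ℝ) ^ 2 * Real.pi ^ 2 : ℝ) : ℂ)))

/-- If `j y / π` were an integer `n`, then `y² = -(n π)²` would be real, and a vanishing real part
would force `y = 0`. This keeps the arguments in use away from the poles of the trigonometric
expansions. -/
lemma mem_integerComplement_of_sq_re {y : ℂ} (hy : y ≠ 0) (hre : (y ^ 2).re = 0) :
    Complex.I * y / Real.pi ∈ Complex.integerComplement := by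
  rw [Complex.mem_integerComplement_iff]
  rintro ⟨n, hn⟩
  have hpi : (Real.pi : ℂ) ≠ 0 := by exact_mod_cast Real.pi_ne_zero
  have h1 : Complex.I * y = n * Real.pi := by
    rw [hn]; field_simp
  have h2 : y ^ 2 = ((-((n : ℝ) * Real.pi) ^ 2 : ℝ) : ℂ) := by
    have : (Complex.I * y) ^ 2 = (n * Real.pi) ^ 2 := by rw [h1]
    rw [mul_pow, Complex.I_sq] at this
    push_cast
    linear_combination -this
  rw [h2, Complex.ofReal_re] at hre
  have h3 : (n : ℝ) * Real.pi = 0 := by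
    have := neg_eq_zero.1 hre
    exact pow_eq_zero_iff (two_ne_zero) |>.1 this
  have h4 : (n : ℂ) * Real.pi = 0 := by exact_mod_cast h3
  rw [h4] at h1
  simp [Complex.I_ne_zero] at h1
  exact hy h1

lemma sinh_ne_zero_of_sq_re {y : ℂ} (hy : y ≠ 0) (hre : (y ^ 2).re = 0) :
    Complex.sinh y ≠ 0 := by
  have h := sin_pi_mul_ne_zero (mem_integerComplement_of_sq_re hy hre)
  have hpi : (Real.pi : ℂ) ≠ 0 := by exact_mod_cast Real.pi_ne_zero
  rw [show (Real.pi : ℂ) * (Complex.I * y / Real.pi) = y * Complex.I by field_simp,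
    Complex.sin_mul_I] at h
  intro h0
  simp [h0] at h

lemma add_ne_zero_of_re {s : ℂ} (hre : s.re = 0) {l : ℝ} (hl : 0 < l) : s + (l : ℂ) ≠ 0 := by
  intro h
  have := congrArg Complex.re h
  simp [hre] at this
  exact hl.ne' this

/-- The Mittag-Leffler expansion of the cotangent at `j y / π`. -/
lemma tendsto_coth_partial {y : ℂ} (hy : y ≠ 0) (hre : (y ^ 2).re = 0) :
    Tendsto (fun N => ∑ n ∈ Finset.range N,
      2 * (y ^ 2 / (y ^ 2 + (((n + 1 : ℝ) ^ 2 * Real.pi ^ 2 : ℝ) : ℂ)))) atTop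
      (𝓝 (y * Complex.cosh y / Complex.sinh y - 1)) := by
  have hz := mem_integerComplement_of_sq_re hy hre
  have hpi : (Real.pi : ℂ) ≠ 0 := by exact_mod_cast Real.pi_ne_zero
  have hs := sinh_ne_zero_of_sq_re hy hre
  have h := (tendsto_logDeriv_euler_cot_sub hz).mul_const (Complex.I * y / Real.pi)
  have hI := Complex.I_ne_zero
  convert h using 2 with N
  · rw [Finset.sum_mul]
    refine Finset.sum_congr rfl fun n _ => ?_
    rw [cotTerm_identity hz]
    have h0 := add_ne_zero_of_re hre (l := (n + 1 : ℝ) ^ 2 * Real.pi ^ 2) (by positivity)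
    have e : (Complex.I * y / Real.pi + (n + 1)) * (Complex.I * y / Real.pi - (n + 1))
        = -(y ^ 2 + (((n + 1 : ℝ) ^ 2 * Real.pi ^ 2 : ℝ) : ℂ)) / Real.pi ^ 2 := by
      field_simp
      push_cast
      linear_combination y ^ 2 * Complex.I_sq
    rw [e]
    field_simp
    linear_combination Complex.I_sq
  · rw [show (Real.pi : ℂ) * (Complex.I * y / Real.pi) = y * Complex.I by field_simp,
      Complex.cot_eq_cos_div_sin, Complex.cos_mul_I, Complex.sin_mul_I]
    field_simp

/-- Since `(cosh x + 1) / sinh x = coth (x / 2)`, this is the expansion of `coth` at `x / 2`. -/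
lemma tendsto_cothSum {x : ℂ} (hx : x ≠ 0) (hre : (x ^ 2).re = 0) :
    Tendsto (fun N => cothSum N (x ^ 2)) atTop
      (𝓝 (x * (Complex.cosh x + 1) / Complex.sinh x)) := by
  have hre2 : ((x / 2) ^ 2).re = 0 := by
    rw [div_pow, show (2 : ℂ) ^ 2 = ((4 : ℝ) : ℂ) by norm_num, Complex.div_ofReal_re, hre, zero_div]
  have hx2 : x / 2 ≠ 0 := by simpa using hx
  have h := ((tendsto_coth_partial hx2 hre2).const_mul 2).const_add 2
  have hs := sinh_ne_zero_of_sq_re hx2 hre2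
  have hsx := sinh_ne_zero_of_sq_re hx hre
  convert h using 2 with N
  · rw [cothSum, Finset.mul_sum]
    congr 1
    refine Finset.sum_congr rfl fun n _ => ?_
    have h0 := add_ne_zero_of_re hre (l := 4 * (n + 1 : ℝ) ^ 2 * Real.pi ^ 2) (by positivity)
    have h1 := add_ne_zero_of_re hre2 (l := (n + 1 : ℝ) ^ 2 * Real.pi ^ 2) (by positivity)
    have h2 : x ^ 2 + ((4 * (n + 1 : ℝ) ^ 2 * Real.pi ^ 2 : ℝ) : ℂ)
        = 4 * ((x / 2) ^ 2 + (((n + 1 : ℝ) ^ 2 * Real.pi ^ 2 : ℝ) : ℂ)) := by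
      push_cast; ring
    rw [h2]
    field_simp
  · have e1 : Complex.sinh x = 2 * Complex.sinh (x / 2) * Complex.cosh (x / 2) := by
      rw [← Complex.sinh_two_mul]; congr 1; ring
    have e2 : Complex.cosh x = Complex.cosh (x / 2) ^ 2 + Complex.sinh (x / 2) ^ 2 := by
      rw [← Complex.cosh_two_mul]; congr 1; ring
    have e3 := Complex.cosh_sq_sub_sinh_sq (x / 2)
    have hc : Complex.cosh (x / 2) ≠ 0 := by
      intro h0; rw [h0] at e1; simp at e1; exact hsx e1
    rw [e1, e2]
    field_simp
    linear_combination -x * e3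

/-- `tanh (x / 2) = 2 coth x - coth (x / 2)`. Subtracting removes the even poles; `2 N` terms of the
first series are taken so that exactly `N` odd poles remain. -/
lemma tendsto_tanhSum {x : ℂ} (hx : x ≠ 0) (hre : (x ^ 2).re = 0) :
    Tendsto (fun N => tanhSum N (x ^ 2)) atTop
      (𝓝 (x * (Complex.cosh x - 1) / Complex.sinh x)) := by
  have hsx := sinh_ne_zero_of_sq_re hx hre
  have h1 := ((tendsto_coth_partial hx hre).comp
    (tendsto_id.const_mul_atTop' (two_pos : (0 : ℕ) < 2))).const_mul 2
  have h2 := (h1.const_add 2).sub (tendsto_cothSum hx hre)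
  convert h2 using 2 with N
  · simp only [Function.comp_apply, id]
    induction N with
    | zero => simp [tanhSum, cothSum]
    | succ N ih =>
      have e1 : tanhSum (N + 1) (x ^ 2) = tanhSum N (x ^ 2)
          + 4 * (x ^ 2 / (x ^ 2 + (((2 * N + 1 : ℝ) ^ 2 * Real.pi ^ 2 : ℝ) : ℂ))) := by
        rw [tanhSum, Finset.sum_range_succ, tanhSum]
      have e2 : cothSum (N + 1) (x ^ 2) = cothSum N (x ^ 2)
          + 4 * (x ^ 2 / (x ^ 2 + ((4 * (N + 1 : ℝ) ^ 2 * Real.pi ^ 2 : ℝ) : ℂ))) := by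
        rw [cothSum, Finset.sum_range_succ, cothSum, add_assoc]
      rw [e1, e2, ih, show 2 * (N + 1) = 2 * N + 1 + 1 by ring, Finset.sum_range_succ,
        Finset.sum_range_succ]
      have e3 : (((2 * N + 1 : ℕ) : ℝ) + 1) ^ 2 * Real.pi ^ 2
          = 4 * (N + 1 : ℝ) ^ 2 * Real.pi ^ 2 := by push_cast; ring
      rw [e3]
      push_cast
      ring
  · field_simp
    ring

lemma tendsto_cschProd {x : ℂ} (hx : x ≠ 0) (hre : (x ^ 2).re = 0) :
    Tendsto (fun N => cschProd N (x ^ 2)) atTop (𝓝 (x / Complex.sinh x)) := by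
  have hpi : (Real.pi : ℂ) ≠ 0 := by exact_mod_cast Real.pi_ne_zero
  have hsx := sinh_ne_zero_of_sq_re hx hre
  have hI := Complex.I_ne_zero
  have h := tendsto_euler_sin_prod' (x := Complex.I * x / Real.pi)
    (by simp [hx, Real.pi_ne_zero])
  rw [show (Real.pi : ℂ) * (Complex.I * x / Real.pi) = x * Complex.I by field_simp,
    Complex.sin_mul_I, mul_div_mul_right _ _ hI] at h
  have h' := h.inv₀ (div_ne_zero hsx hx)
  rw [inv_div] at h'
  convert h' using 2 with N
  rw [cschProd, Finset.prod_inv_distrib]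
  congr 1
  refine Finset.prod_congr rfl fun n _ => ?_
  rw [sineTerm]
  have : ((n : ℂ) + 1) ≠ 0 := by exact_mod_cast (Nat.succ_ne_zero n)
  push_cast
  field_simp
  linear_combination x ^ 2 * Complex.I_sq

end

section

/-! ### The integral representation of the Bessel functions -/

lemma integral_exp_int_mul (n : ℤ) :
    ∫ t in (0 : ℝ)..2 * Real.pi, Complex.exp (Complex.I * n * t)
      = if n = 0 then 2 * Real.pi else 0 := by
  split_ifs with h
  · simp [h]
  · have hc : Complex.I * (n : ℂ) ≠ 0 := mul_ne_zero Complex.I_ne_zero (by exact_mod_cast h)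
    rw [integral_exp_mul_complex hc]
    have : Complex.exp (Complex.I * n * ((2 * Real.pi : ℝ) : ℂ)) = 1 := by
      rw [Complex.exp_eq_one_iff]
      exact ⟨n, by push_cast; ring⟩
    rw [this]
    simp

/-- Write `z cos t = (z / 2) e^{j t} + (z / 2) e^{-j t}` and multiply the two exponential series;
integration over a period keeps only the pairs whose exponents differ by `m`. -/
lemma besselI_eq_integral (m : ℕ) (z : ℂ) :
    besselI m z = 1 / (2 * Real.pi) * ∫ t in (0 : ℝ)..2 * Real.pi,
      Complex.exp (z * Real.cos t) * Complex.exp (-(Complex.I * m * t)) := by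
  have hpi : (Real.pi : ℂ) ≠ 0 := by exact_mod_cast Real.pi_ne_zero
  have h2pi : (0 : ℝ) ≤ 2 * Real.pi := by positivity
  set F : ℕ × ℕ → ℝ → ℂ := fun p t =>
    ((z / 2) ^ p.1 / p.1.factorial) * ((z / 2) ^ p.2 / p.2.factorial) *
      Complex.exp (Complex.I * ((p.1 : ℤ) - p.2 - m : ℤ) * t) with hF
  have hexp : ∀ w : ℂ, HasSum (fun n : ℕ => w ^ n / n.factorial) (Complex.exp w) := by
    intro w
    rw [Complex.exp_eq_exp_ℂ]
    exact NormedSpace.expSeries_div_hasSum_exp w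
  have hnorm : ∀ w : ℂ, Summable fun n : ℕ => ‖w ^ n / (n.factorial : ℂ)‖ :=
    fun w => NormedSpace.norm_expSeries_div_summable w
  have hsum : ∀ t : ℝ, HasSum (fun p => F p t)
      (Complex.exp (z * Real.cos t) * Complex.exp (-(Complex.I * m * t))) := by
    intro t
    have hs := summable_mul_of_summable_norm (hnorm (z / 2 * Complex.exp (t * Complex.I)))
      (hnorm (z / 2 * Complex.exp (-t * Complex.I)))
    have h := ((hexp (z / 2 * Complex.exp (t * Complex.I))).mul
      (hexp (z / 2 * Complex.exp (-t * Complex.I))) hs).mul_right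
        (Complex.exp (-(Complex.I * m * t)))
    have e1 : ∀ k l : ℕ, Complex.exp (Complex.I * ((k : ℤ) - l - m : ℤ) * t)
        = Complex.exp (t * Complex.I) ^ k * Complex.exp (-t * Complex.I) ^ l
          * Complex.exp (-(Complex.I * m * t)) := by
      intro k l
      rw [← Complex.exp_nat_mul, ← Complex.exp_nat_mul, ← Complex.exp_add, ← Complex.exp_add]
      congr 1
      push_cast
      ring
    have e2 : Complex.exp (z * Real.cos t) = Complex.exp (z / 2 * Complex.exp (t * Complex.I)) *
        Complex.exp (z / 2 * Complex.exp (-t * Complex.I)) := by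
      rw [← Complex.exp_add (z / 2 * _), Complex.ofReal_cos, Complex.cos]
      congr 1
      ring
    rw [e2]
    refine h.congr_fun fun p => ?_
    simp only [hF]
    rw [e1]
    ring
  have hnF : ∀ p t, ‖F p t‖ = ‖(z / 2) ^ p.1 / (p.1.factorial : ℂ)‖
      * ‖(z / 2) ^ p.2 / (p.2.factorial : ℂ)‖ := by
    intro p t
    simp only [hF]
    rw [norm_mul, norm_mul, show Complex.I * ((p.1 : ℤ) - p.2 - m : ℤ) * t
      = ((((p.1 : ℤ) - p.2 - m : ℤ) * t : ℝ) : ℂ) * Complex.I by push_cast; ring,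
      Complex.norm_exp_ofReal_mul_I, mul_one]
  have hint := hasSum_integral_of_summable_integral_norm
    (μ := volume.restrict (Ioc 0 (2 * Real.pi))) (F := F)
    (fun p => by
      refine Continuous.integrableOn_Ioc ?_
      simp only [hF]
      fun_prop) (by
      simp_rw [hnF]
      simp only [integral_const, smul_eq_mul]
      exact ((hnorm (z / 2)).mul_of_nonneg (hnorm (z / 2)) (fun _ => norm_nonneg _)
        (fun _ => norm_nonneg _)).mul_left _)
  simp_rw [(hsum _).tsum_eq, ← intervalIntegral.integral_of_le h2pi] at hint
  have hval : ∀ p : ℕ × ℕ, ∫ t in (0 : ℝ)..2 * Real.pi, F p t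
      = ((z / 2) ^ p.1 / p.1.factorial) * ((z / 2) ^ p.2 / p.2.factorial) *
        if ((p.1 : ℤ) - p.2 - m : ℤ) = 0 then (2 * Real.pi : ℂ) else 0 := by
    intro p
    simp only [hF]
    rw [intervalIntegral.integral_const_mul, integral_exp_int_mul]
    split_ifs <;> simp
  simp_rw [hval] at hint
  have hinj : Function.Injective (fun l : ℕ => ((l + m, l) : ℕ × ℕ)) := by
    intro a b h
    simpa using congrArg Prod.snd h
  rw [← hinj.hasSum_iff] at hint
  · rw [← hint.tsum_eq, besselI, ← tsum_mul_left]
    refine tsum_congr fun k => ?_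
    simp only [Function.comp_apply]
    rw [if_pos (by push_cast; ring)]
    field_simp
    rw [← pow_add]
    congr 1
    ring
  · rintro ⟨k, l⟩ hp
    rw [if_neg, mul_zero]
    intro h
    exact hp ⟨l, by ext <;> simp; omega⟩

lemma continuous_besselI (m : ℕ) : Continuous (besselI m) := by
  rw [funext (besselI_eq_integral m)]
  refine continuous_const.mul
    (intervalIntegral.continuous_parametric_intervalIntegral_of_continuous' ?_ _ _)
  fun_prop

lemma norm_besselI_zero_le (y : ℝ) : ‖besselI 0 y‖ ≤ Real.exp |y| := by
  have hp : (0 : ℝ) < 2 * Real.pi := by positivity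
  have h : ‖∫ t in (0 : ℝ)..2 * Real.pi,
      Complex.exp ((y : ℂ) * Real.cos t) * Complex.exp (-(Complex.I * (0 : ℕ) * t))‖
      ≤ Real.exp |y| * |2 * Real.pi - 0| := by
    refine intervalIntegral.norm_integral_le_of_norm_le_const fun t _ => ?_
    simp only [Nat.cast_zero, mul_zero, zero_mul, neg_zero, Complex.exp_zero, mul_one]
    rw [Complex.norm_exp, ← Complex.ofReal_mul, Complex.ofReal_re]
    refine Real.exp_le_exp.2 ((le_abs_self _).trans ?_)
    rw [abs_mul]
    exact mul_le_of_le_one_right (abs_nonneg _) (Real.abs_cos_le_one t)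
  rw [besselI_eq_integral, norm_mul]
  rw [sub_zero, abs_of_pos hp] at h
  have h1 : ‖(1 / (2 * Real.pi) : ℂ)‖ = 1 / (2 * Real.pi) := by
    rw [show (1 / (2 * Real.pi) : ℂ) = ((1 / (2 * Real.pi) : ℝ) : ℂ) by push_cast; ring,
      Complex.norm_real, Real.norm_of_nonneg (by positivity)]
  rw [h1, one_div, inv_mul_le_iff₀ hp]
  exact h.trans_eq (mul_comm _ _)

/-! ### The Mehler kernel at imaginary arguments -/

/-- The argument `√(j k γ σ²) L` of the hyperbolic functions. -/
def hypArg (γ σ L : ℝ) (k : ℤ) : ℂ := (Complex.I * k * γ) ^ (1 / 2 : ℂ) * σ * L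

/-- The Mehler kernel at frequency `k`, normalized to be `exp (-2 β / v)` at `k = 0`. -/
def mehler (γ σ L : ℝ) (α β : ℝ) (k : ℤ) : ℂ :=
  if k = 0 then Complex.exp (-(2 * β / (σ ^ 2 * L))) else
    hypArg γ σ L k / Complex.sinh (hypArg γ σ L k) *
      Complex.exp (-(α * (hypArg γ σ L k * (Complex.cosh (hypArg γ σ L k) - 1) /
          Complex.sinh (hypArg γ σ L k)) +
        β * (hypArg γ σ L k * (Complex.cosh (hypArg γ σ L k) + 1) /
          Complex.sinh (hypArg γ σ L k))) / (σ ^ 2 * L))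

/-- Finite products approximating the Mehler kernel. -/
def mehlerApprox (γ σ L : ℝ) (α β : ℝ) (N : ℕ) (k : ℤ) : ℂ :=
  cschProd N (Complex.I * k * (γ * σ ^ 2 * L ^ 2 : ℝ)) *
    Complex.exp (-(α * tanhSum N (Complex.I * k * (γ * σ ^ 2 * L ^ 2 : ℝ)) +
      β * cothSum N (Complex.I * k * (γ * σ ^ 2 * L ^ 2 : ℝ))) / (σ ^ 2 * L))

variable {γ σ L : ℝ}

/-- The approximants depend on the root only through its square, which is linear in `k`; this is
where positive definiteness in `k` becomes accessible. -/
lemma hypArg_sq (k : ℤ) :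
    hypArg γ σ L k ^ 2 = Complex.I * k * (γ * σ ^ 2 * L ^ 2 : ℝ) := by
  have h : ((Complex.I * k * γ) ^ (1 / 2 : ℂ)) ^ 2 = Complex.I * k * γ := by
    rw [one_div]
    exact_mod_cast Complex.cpow_nat_inv_pow _ two_ne_zero
  rw [hypArg, mul_pow, mul_pow, h]
  push_cast
  ring

lemma hypArg_sq_re (k : ℤ) : (hypArg γ σ L k ^ 2).re = 0 := by
  rw [hypArg_sq, Complex.re_mul_ofReal]
  simp

lemma hypArg_ne_zero (hγ : 0 < γ) (hσ : 0 < σ) (hL : 0 < L) {k : ℤ} (hk : k ≠ 0) :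
    hypArg γ σ L k ≠ 0 := by
  intro h
  have h1 := hypArg_sq (γ := γ) (σ := σ) (L := L) k
  rw [h, zero_pow two_ne_zero, eq_comm] at h1
  have h2 : (γ * σ ^ 2 * L ^ 2 : ℝ) ≠ 0 := by positivity
  have h3 : ((γ * σ ^ 2 * L ^ 2 : ℝ) : ℂ) ≠ 0 := by exact_mod_cast h2
  have h4 : (k : ℂ) ≠ 0 := by exact_mod_cast hk
  exact mul_ne_zero (mul_ne_zero Complex.I_ne_zero h4) h3 h1

lemma tendsto_mehlerApprox (hγ : 0 < γ) (hσ : 0 < σ) (hL : 0 < L) (α β : ℝ) (k : ℤ) :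
    Tendsto (fun N => mehlerApprox γ σ L α β N k) atTop (𝓝 (mehler γ σ L α β k)) := by
  rw [mehler]
  split_ifs with hk
  -- At frequency zero the product is `1`, the `tanh` sum `0` and the `coth` sum its constant term
  -- `2`, which explains the value assigned to the kernel there.
  · have : ∀ N, mehlerApprox γ σ L α β N k = Complex.exp (-(2 * β / (σ ^ 2 * L))) := by
      intro N
      simp only [mehlerApprox, hk, cschProd, tanhSum, cothSum]
      simp
      ring_nf
    simp_rw [this]
    exact tendsto_const_nhds
  · have hx := hypArg_ne_zero hγ hσ hL hk
    have hre := hypArg_sq_re (γ := γ) (σ := σ) (L := L) k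
    simp_rw [mehlerApprox, ← hypArg_sq]
    exact (tendsto_cschProd hx hre).mul (((((tendsto_tanhSum hx hre).const_mul _).add
      ((tendsto_cothSum hx hre).const_mul _)).neg.div_const _).cexp)

lemma IsPosDefSeq.mul_cschProd {f : ℤ → ℂ} (hf : IsPosDefSeq f) (T : ℝ) (N : ℕ) :
    IsPosDefSeq fun k => f k * cschProd N (Complex.I * k * T) := by
  induction N with
  | zero => simpa [cschProd] using hf
  | succ N ih =>
    have hl : 0 < (N + 1 : ℝ) ^ 2 * Real.pi ^ 2 := by positivity
    convert (ih.mul_resolvent hl T).const_mul hl.le using 2 with k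
    have h0 := add_ne_zero_of_re (s := Complex.I * k * T)
      (by rw [Complex.re_mul_ofReal]; simp) hl
    have hl' : (((N + 1 : ℝ) ^ 2 * Real.pi ^ 2 : ℝ) : ℂ) ≠ 0 := by exact_mod_cast hl.ne'
    rw [cschProd, Finset.prod_range_succ, ← cschProd, add_comm (((N + 1 : ℝ) ^ 2 * _ : ℝ) : ℂ)]
    rw [one_add_div hl', inv_div, add_comm (((N + 1 : ℝ) ^ 2 * _ : ℝ) : ℂ)]
    ring

lemma IsPosDefSeq.mul_exp_tanhSum {f : ℤ → ℂ} (hf : IsPosDefSeq f) (T : ℝ) {c : ℝ} (hc : 0 ≤ c)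
    (N : ℕ) : IsPosDefSeq fun k => f k * Complex.exp (-(c * tanhSum N (Complex.I * k * T))) := by
  induction N with
  | zero => simpa [tanhSum] using hf
  | succ N ih =>
    have hl : 0 < (2 * N + 1 : ℝ) ^ 2 * Real.pi ^ 2 := by positivity
    convert ih.mul_exp_drift hl T (mul_nonneg hc (by norm_num : (0 : ℝ) ≤ 4)) using 2 with k
    rw [tanhSum, Finset.sum_range_succ, ← tanhSum, mul_assoc (f k), ← Complex.exp_add]
    congr 2
    push_cast
    ring

lemma IsPosDefSeq.mul_exp_cothSum {f : ℤ → ℂ} (hf : IsPosDefSeq f) (T : ℝ) {c : ℝ} (hc : 0 ≤ c)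
    (N : ℕ) : IsPosDefSeq fun k => f k * Complex.exp (-(c * cothSum N (Complex.I * k * T))) := by
  induction N with
  | zero =>
    convert hf.const_mul (Real.exp_nonneg (-(c * 2))) using 2 with k
    simp [cothSum, mul_comm]
  | succ N ih =>
    have hl : 0 < 4 * (N + 1 : ℝ) ^ 2 * Real.pi ^ 2 := by positivity
    convert ih.mul_exp_drift hl T (mul_nonneg hc (by norm_num : (0 : ℝ) ≤ 4)) using 2 with k
    rw [cothSum, Finset.sum_range_succ, ← add_assoc, ← cothSum, mul_assoc (f k), ← Complex.exp_add]
    congr 2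
    push_cast
    ring

/-- All poles of the expansions lie at `s = -l` with `l > 0`, so each approximant is a product of
resolvents and drift factors; nonnegative `α`, `β` keep the drift coefficients nonnegative, and the
limit inherits the property. -/
lemma isPosDefSeq_mehler (hγ : 0 < γ) (hσ : 0 < σ) (hL : 0 < L) {α β : ℝ} (hα : 0 ≤ α)
    (hβ : 0 ≤ β) : IsPosDefSeq (mehler γ σ L α β) := by
  refine .of_tendsto (fun N => ?_) (tendsto_mehlerApprox hγ hσ hL α β)
  have hv : 0 < σ ^ 2 * L := by positivity
  have h := ((IsPosDefSeq.one.mul_cschProd (γ * σ ^ 2 * L ^ 2) N).mul_exp_tanhSum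
    (γ * σ ^ 2 * L ^ 2) (div_nonneg hα hv.le) N).mul_exp_cothSum
    (γ * σ ^ 2 * L ^ 2) (div_nonneg hβ hv.le) N
  convert h using 2 with k
  rw [mehlerApprox, one_mul, mul_assoc (cschProd _ _), ← Complex.exp_add]
  congr 2
  push_cast
  ring

/-- Conjugation is checked on the approximants, which have real coefficients in `j k T`; no branch
of the square root has to be compared. -/
lemma mehler_neg (hγ : 0 < γ) (hσ : 0 < σ) (hL : 0 < L) (α β : ℝ) (k : ℤ) :
    mehler γ σ L α β (-k) = (starRingEnd ℂ) (mehler γ σ L α β k) := by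
  refine tendsto_nhds_unique (tendsto_mehlerApprox hγ hσ hL α β (-k)) ?_
  convert (Complex.continuous_conj.tendsto _).comp (tendsto_mehlerApprox hγ hσ hL α β k) using 2
    with N
  simp only [Function.comp_apply, mehlerApprox, cschProd, tanhSum, cothSum, map_mul, map_div₀,
    ← Complex.exp_conj, map_prod, map_sum, map_add, map_neg, map_inv₀, map_one, map_pow,
    Complex.conj_ofReal, Complex.conj_I, map_intCast, map_ofNat, Int.cast_neg, mul_neg, neg_mul]

/-! ### Bounds on the Mehler kernel, uniform over nonzero frequencies -/

lemma re_div_add_nonneg {s : ℂ} (hs : s.re = 0) (l : ℝ) :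
    0 ≤ (s / (s + (l : ℂ))).re := by
  rw [Complex.div_re]
  have := Complex.normSq_nonneg (s + (l : ℂ))
  simp only [hs, Complex.add_re, Complex.add_im, Complex.ofReal_re, Complex.ofReal_im, add_zero]
  rw [zero_mul, zero_div, zero_add]
  exact div_nonneg (mul_self_nonneg _) this

lemma two_le_re_cothSum {s : ℂ} (hs : s.re = 0) (N : ℕ) : 2 ≤ (cothSum N s).re := by
  rw [cothSum, Complex.add_re, Complex.re_sum]
  have : 0 ≤ ∑ n ∈ Finset.range N,
      (4 * (s / (s + ((4 * (n + 1 : ℝ) ^ 2 * Real.pi ^ 2 : ℝ) : ℂ)))).re := by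
    refine Finset.sum_nonneg fun n _ => ?_
    rw [show (4 : ℂ) = ((4 : ℝ) : ℂ) by norm_num, Complex.re_ofReal_mul]
    exact mul_nonneg (by norm_num) (re_div_add_nonneg hs _)
  simpa using this

/-- All terms have nonnegative real part. The one at the pole `-π²` contributes `4 (k T)² / ((k T)²
+ π⁴)`, which is smallest at `|k| = 1`. -/
lemma le_re_tanhSum {T : ℝ} (hT : 0 < T) {k : ℤ} (hk : k ≠ 0) (N : ℕ) :
    4 * (T ^ 2 / (T ^ 2 + Real.pi ^ 4)) ≤ (tanhSum (N + 1) (Complex.I * k * T)).re := by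
  have hs : (Complex.I * k * T : ℂ).re = 0 := by rw [Complex.re_mul_ofReal]; simp
  rw [tanhSum, Complex.re_sum, Finset.sum_range_succ']
  have h1 : 0 ≤ ∑ n ∈ Finset.range N, (4 * ((Complex.I * k * T) / ((Complex.I * k * T) +
      (((2 * ((n + 1 : ℕ) : ℝ) + 1) ^ 2 * Real.pi ^ 2 : ℝ) : ℂ)))).re := by
    refine Finset.sum_nonneg fun n _ => ?_
    rw [show (4 : ℂ) = ((4 : ℝ) : ℂ) by norm_num, Complex.re_ofReal_mul]
    exact mul_nonneg (by norm_num) (re_div_add_nonneg hs _)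
  refine le_add_of_nonneg_of_le h1 ?_
  rw [show (4 : ℂ) = ((4 : ℝ) : ℂ) by norm_num, Complex.re_ofReal_mul]
  refine mul_le_mul_of_nonneg_left ?_ (by norm_num)
  have hk1 : (1 : ℝ) ≤ (k : ℝ) ^ 2 := by
    have : (1 : ℤ) ≤ k ^ 2 := by have := sq_pos_of_ne_zero hk; omega
    exact_mod_cast this
  have e : ∀ l : ℝ, (Complex.I * k * T / (Complex.I * k * T + (l : ℂ))).re
      = (k * T) ^ 2 / ((k * T) ^ 2 + l ^ 2) := by
    intro l
    have hz : Complex.I * k * T = ⟨0, k * T⟩ := by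
      apply Complex.ext <;> simp
    rw [hz, Complex.div_re]
    simp [Complex.normSq_apply]
    ring
  rw [e, show ((2 * ((0 : ℕ) : ℝ) + 1) ^ 2 * Real.pi ^ 2) ^ 2 = Real.pi ^ 4 by push_cast; ring]
  have hpi : 0 < Real.pi ^ 4 := by positivity
  rw [div_le_div_iff₀ (by positivity) (by positivity)]
  nlinarith [mul_le_mul_of_nonneg_right hk1 (by positivity : (0 : ℝ) ≤ T ^ 2 * Real.pi ^ 4)]

/-- Every factor has modulus at most one, because `1 + j k T / l` has real part one. Bounding the
two with `l = π²` and `l = 4 π²` by the imaginary part instead yields the summable decay `k⁻²`. -/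
lemma norm_cschProd_le {T : ℝ} (hT : 0 < T) {k : ℤ} (hk : k ≠ 0) (N : ℕ) :
    ‖cschProd (N + 2) (Complex.I * k * T)‖ ≤ 4 * Real.pi ^ 4 / T ^ 2 / (k : ℝ) ^ 2 := by
  have hre : ∀ n : ℕ, (1 + Complex.I * k * T / (((n + 1 : ℝ) ^ 2 * Real.pi ^ 2 : ℝ) : ℂ)).re
      = 1 := by
    intro n
    rw [Complex.add_re, Complex.div_ofReal_re, Complex.re_mul_ofReal]
    simp
  have him : ∀ n : ℕ, (1 + Complex.I * k * T / (((n + 1 : ℝ) ^ 2 * Real.pi ^ 2 : ℝ) : ℂ)).im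
      = k * T / ((n + 1 : ℝ) ^ 2 * Real.pi ^ 2) := by
    intro n
    rw [Complex.add_im, Complex.div_ofReal_im, Complex.im_mul_ofReal]
    simp
  have h1 : ∀ n : ℕ, ‖(1 + Complex.I * k * T /
      (((n + 1 : ℝ) ^ 2 * Real.pi ^ 2 : ℝ) : ℂ))⁻¹‖ ≤ 1 := by
    intro n
    rw [norm_inv]
    refine inv_le_one_of_one_le₀ ?_
    have := Complex.abs_re_le_norm
      (1 + Complex.I * k * T / (((n + 1 : ℝ) ^ 2 * Real.pi ^ 2 : ℝ) : ℂ))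
    rwa [hre, abs_one] at this
  have hk0 : 0 < |(k : ℝ)| := abs_pos.2 (by exact_mod_cast hk)
  have h2 : ∀ n : ℕ, ‖(1 + Complex.I * k * T /
      (((n + 1 : ℝ) ^ 2 * Real.pi ^ 2 : ℝ) : ℂ))⁻¹‖
        ≤ (n + 1 : ℝ) ^ 2 * Real.pi ^ 2 / (|(k : ℝ)| * T) := by
    intro n
    rw [norm_inv]
    have := Complex.abs_im_le_norm
      (1 + Complex.I * k * T / (((n + 1 : ℝ) ^ 2 * Real.pi ^ 2 : ℝ) : ℂ))
    rw [him, abs_div, abs_mul, abs_of_pos hT,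
      abs_of_pos (by positivity : (0 : ℝ) < (n + 1 : ℝ) ^ 2 * Real.pi ^ 2)] at this
    exact (inv_anti₀ (by positivity) this).trans_eq (inv_div _ _)
  rw [cschProd, norm_prod, Finset.prod_range_succ', Finset.prod_range_succ', mul_assoc]
  have h3 : ∏ n ∈ Finset.range N, ‖(1 + Complex.I * k * T /
      (((((n + 1 + 1 : ℕ) : ℝ) + 1) ^ 2 * Real.pi ^ 2 : ℝ) : ℂ))⁻¹‖ ≤ 1 :=
    Finset.prod_le_one (fun _ _ => norm_nonneg _) fun n _ => h1 _
  have h4 := mul_le_mul (h2 (0 + 1)) (h2 0) (norm_nonneg _) (by positivity)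
  refine (mul_le_of_le_one_left (by positivity) h3).trans (h4.trans_eq ?_)
  rw [← sq_abs (k : ℝ)]
  field_simp
  push_cast
  ring

lemma norm_mehler_le (hγ : 0 < γ) (hσ : 0 < σ) (hL : 0 < L) :
    ∃ C κ : ℝ, 0 < C ∧ 0 < κ ∧ ∀ α β : ℝ, 0 ≤ α → 0 ≤ β → ∀ k : ℤ, k ≠ 0 →
      ‖mehler γ σ L α β k‖ ≤ C / (k : ℝ) ^ 2 * Real.exp (-(κ * (α + β))) := by
  set T := γ * σ ^ 2 * L ^ 2 with hT
  have hT0 : 0 < T := by positivity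
  have hv : 0 < σ ^ 2 * L := by positivity
  set δ := 4 * (T ^ 2 / (T ^ 2 + Real.pi ^ 4)) with hδ
  have hδ0 : 0 < δ := by positivity
  -- The decay in `α` comes at rate `δ` from the `tanh` sum, that in `β` at rate `2` from the
  -- constant term of the `coth` sum.
  refine ⟨4 * Real.pi ^ 4 / T ^ 2, min δ 2 / (σ ^ 2 * L), by positivity, by positivity,
    fun α β hα hβ k hk => ?_⟩
  refine le_of_tendsto ((tendsto_mehlerApprox hγ hσ hL α β k).norm)
    (eventually_atTop.2 ⟨2, fun N hN => ?_⟩)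
  obtain ⟨N, rfl⟩ := Nat.exists_eq_add_of_le' hN
  rw [mehlerApprox, norm_mul]
  refine mul_le_mul (norm_cschProd_le hT0 hk N) ?_ (norm_nonneg _) (by positivity)
  rw [Complex.norm_exp]
  refine Real.exp_le_exp.2 ?_
  rw [show (σ ^ 2 * L : ℂ) = ((σ ^ 2 * L : ℝ) : ℂ) by push_cast; ring, Complex.div_ofReal_re,
    Complex.neg_re, Complex.add_re, Complex.re_ofReal_mul, Complex.re_ofReal_mul, ← hT]
  rw [div_le_iff₀ hv]
  have e : -(min δ 2 / (σ ^ 2 * L) * (α + β)) * (σ ^ 2 * L) = -(min δ 2 * (α + β)) := by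
    field_simp
  rw [e]
  have h1 := le_re_tanhSum hT0 hk (N + 1)
  have h2 := two_le_re_cothSum (s := Complex.I * k * T)
    (by rw [Complex.re_mul_ofReal]; simp) (N + 2)
  rw [← hδ] at h1
  have h3 := mul_le_mul_of_nonneg_left ((min_le_left δ 2).trans h1) hα
  have h4 := mul_le_mul_of_nonneg_left ((min_le_right δ 2).trans h2) hβ
  nlinarith [h3, h4]

end

section

/-! ### The angular harmonics of the channel -/

/-- The `k`-th Fourier coefficient, in the angle between `x` and `y`, of the Mehler kernel at
frequency `k`, for `|x| = r₀` and `|y| = r`. -/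
def mehlerCoeff (γ σ L r r₀ : ℝ) (k : ℤ) : ℂ :=
  1 / (2 * Real.pi) * ∫ t in (0 : ℝ)..2 * Real.pi,
    mehler γ σ L ((r ^ 2 + r₀ ^ 2 + 2 * r * r₀ * Real.cos t) / 2)
      ((r ^ 2 + r₀ ^ 2 - 2 * r * r₀ * Real.cos t) / 2) k * Complex.exp (-(Complex.I * k * t))

/-- The conditional density as a function of the output amplitude, the input amplitude and the
phase difference. -/
def harmonicKernel (γ σ L w r r₀ θ : ℝ) : ℝ :=
  1 / (2 * Real.pi) * amplitudePdf σ L r r₀ +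
    w / Real.pi * ∑' k : ℕ, (coeffC γ σ L (k + 1) r r₀ *
      Complex.exp (Complex.I * ((k + 1 : ℕ) : ℂ) * (θ : ℂ))).re

variable {γ σ L : ℝ}

lemma continuous_mehler (k : ℤ) :
    Continuous fun p : ℝ × ℝ => mehler γ σ L p.1 p.2 k := by
  unfold mehler
  split_ifs <;> fun_prop

lemma continuous_mehlerCoeff_integrand (r r₀ : ℝ) (k : ℤ) : Continuous fun t : ℝ =>
    mehler γ σ L ((r ^ 2 + r₀ ^ 2 + 2 * r * r₀ * Real.cos t) / 2)
      ((r ^ 2 + r₀ ^ 2 - 2 * r * r₀ * Real.cos t) / 2) k * Complex.exp (-(Complex.I * k * t)) := by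
  refine ((continuous_mehler k).comp (f := fun t : ℝ =>
    ((r ^ 2 + r₀ ^ 2 + 2 * r * r₀ * Real.cos t) / 2,
      (r ^ 2 + r₀ ^ 2 - 2 * r * r₀ * Real.cos t) / 2)) ?_).mul ?_ <;> fun_prop

/-- This is `|x + y|² / 2` for plane vectors of lengths `r` and `r₀` at angle `t`. -/
lemma half_add_cos_nonneg (r r₀ t : ℝ) : 0 ≤ (r ^ 2 + r₀ ^ 2 + 2 * r * r₀ * Real.cos t) / 2 := by
  have h1 := Real.neg_one_le_cos t
  have h2 := Real.cos_le_one t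
  have : 0 ≤ (r + r₀ * Real.cos t) ^ 2 := sq_nonneg _
  have h3 : Real.cos t ^ 2 ≤ 1 := by nlinarith
  nlinarith [mul_le_mul_of_nonneg_left h3 (sq_nonneg r₀)]

lemma half_sub_cos_nonneg (r r₀ t : ℝ) : 0 ≤ (r ^ 2 + r₀ ^ 2 - 2 * r * r₀ * Real.cos t) / 2 := by
  have h := half_add_cos_nonneg r (-r₀) t
  convert h using 2
  ring

/-- The angular order and the frequency of the kernel are the same `k`, so `e^{-j k t}` acts as a
twist, and the coefficient is an average of positive definite sequences over `t`. -/
lemma isPosDefSeq_mehlerCoeff (hγ : 0 < γ) (hσ : 0 < σ) (hL : 0 < L) (r r₀ : ℝ) :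
    IsPosDefSeq (mehlerCoeff γ σ L r r₀) := by
  have h2pi : (0 : ℝ) ≤ 2 * Real.pi := by positivity
  have h := (IsPosDefSeq.integral (μ := volume.restrict (Ioc 0 (2 * Real.pi)))
    (F := fun t k => mehler γ σ L ((r ^ 2 + r₀ ^ 2 + 2 * r * r₀ * Real.cos t) / 2)
      ((r ^ 2 + r₀ ^ 2 - 2 * r * r₀ * Real.cos t) / 2) k * Complex.exp (-(Complex.I * k * t)))
    (fun t => ?_) fun k =>
      (continuous_mehlerCoeff_integrand r r₀ k).integrableOn_Ioc).const_mul
      (c := 1 / (2 * Real.pi)) (by positivity)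
  · convert h using 2 with k
    rw [mehlerCoeff, intervalIntegral.integral_of_le h2pi]
    push_cast
    rfl
  · convert (isPosDefSeq_mehler hγ hσ hL (half_add_cos_nonneg r r₀ t)
      (half_sub_cos_nonneg r r₀ t)).twist (-t) using 2 with k
    rw [mul_comm]
    congr 2
    push_cast
    ring

lemma mehlerCoeff_neg (hγ : 0 < γ) (hσ : 0 < σ) (hL : 0 < L) (r r₀ : ℝ) (k : ℤ) :
    mehlerCoeff γ σ L r r₀ (-k) = (starRingEnd ℂ) (mehlerCoeff γ σ L r r₀ k) := by
  have h2pi : (0 : ℝ) ≤ 2 * Real.pi := by positivity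
  rw [mehlerCoeff, mehlerCoeff, map_mul, intervalIntegral.integral_of_le h2pi,
    intervalIntegral.integral_of_le h2pi, ← integral_conj]
  simp only [map_mul, mehler_neg hγ hσ hL, ← Complex.exp_conj, map_neg, Complex.conj_I, map_intCast,
    Complex.conj_ofReal, map_div₀, map_one, map_ofNat, Int.cast_neg, mul_neg, neg_mul]

lemma norm_mehlerCoeff_le (hγ : 0 < γ) (hσ : 0 < σ) (hL : 0 < L) :
    ∃ C κ : ℝ, 0 < C ∧ 0 < κ ∧ ∀ r r₀ : ℝ, ∀ k : ℤ, k ≠ 0 →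
      ‖mehlerCoeff γ σ L r r₀ k‖ ≤ C / (k : ℝ) ^ 2 * Real.exp (-(κ * (r ^ 2 + r₀ ^ 2))) := by
  obtain ⟨C, κ, hC, hκ, h⟩ := norm_mehler_le hγ hσ hL
  refine ⟨C, κ, hC, hκ, fun r r₀ k hk => ?_⟩
  have hp : (0 : ℝ) < 2 * Real.pi := by positivity
  have hb := intervalIntegral.norm_integral_le_of_norm_le_const (a := 0) (b := 2 * Real.pi)
    (C := C / (k : ℝ) ^ 2 * Real.exp (-(κ * (r ^ 2 + r₀ ^ 2))))
    (f := fun t : ℝ => mehler γ σ L ((r ^ 2 + r₀ ^ 2 + 2 * r * r₀ * Real.cos t) / 2)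
      ((r ^ 2 + r₀ ^ 2 - 2 * r * r₀ * Real.cos t) / 2) k * Complex.exp (-(Complex.I * k * t)))
    (fun t _ => by
      rw [norm_mul, show -(Complex.I * k * t) = ((-(k * t) : ℝ) : ℂ) * Complex.I by
        push_cast; ring, Complex.norm_exp_ofReal_mul_I, mul_one]
      convert h _ _ (half_add_cos_nonneg r r₀ t) (half_sub_cos_nonneg r r₀ t) k hk using 4
      ring)
  rw [sub_zero, abs_of_pos hp] at hb
  rw [mehlerCoeff, norm_mul, show (1 / (2 * Real.pi) : ℂ) = ((1 / (2 * Real.pi) : ℝ) : ℂ) by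
    push_cast; ring, Complex.norm_real, Real.norm_of_nonneg (by positivity), one_div,
    inv_mul_le_iff₀ hp]
  exact hb.trans_eq (mul_comm _ _)

/-- Here `α + β = r² + r₀²` and `α - β = 2 r r₀ cos t`, so the exponent splits into a `coth x` part
free of `t` and a multiple of `cos t / sinh x`, whose angular integral is the Bessel function. -/
lemma coeffC_eq_mehlerCoeff (hγ : 0 < γ) (hσ : 0 < σ) (hL : 0 < L) {m : ℕ} (hm : m ≠ 0)
    (r r₀ : ℝ) :
    coeffC γ σ L m r r₀ = (r / (σ ^ 2 * L) : ℝ) * mehlerCoeff γ σ L r r₀ m := by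
  have hσ' : (σ : ℂ) ≠ 0 := by exact_mod_cast hσ.ne'
  have hL' : (L : ℂ) ≠ 0 := by exact_mod_cast hL.ne'
  have hmz : (m : ℤ) ≠ 0 := by exact_mod_cast hm
  have hs := sinh_ne_zero_of_sq_re (hypArg_ne_zero hγ hσ hL hmz) (hypArg_sq_re _)
  have hx : rootJ γ m * σ * L = hypArg γ σ L m := by
    rw [hypArg, rootJ]; norm_cast
  have hr : rootJ γ m / σ = hypArg γ σ L m / (σ ^ 2 * L) := by
    rw [← hx]; field_simp
  rw [coeffC, besselI_eq_integral, coeffA, coeffB, mehlerCoeff, hx, hr]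
  set x := hypArg γ σ L m with hxd
  have key : ∫ t in (0 : ℝ)..2 * Real.pi,
      mehler γ σ L ((r ^ 2 + r₀ ^ 2 + 2 * r * r₀ * Real.cos t) / 2)
        ((r ^ 2 + r₀ ^ 2 - 2 * r * r₀ * Real.cos t) / 2) m * Complex.exp (-(Complex.I * (m : ℤ) * t))
      = x / Complex.sinh x * Complex.exp (-(x / (σ ^ 2 * L) * (Complex.cosh x / Complex.sinh x)) *
        ((r : ℂ) ^ 2 + (r₀ : ℂ) ^ 2)) * ∫ t in (0 : ℝ)..2 * Real.pi,
          Complex.exp (2 * (x / (σ ^ 2 * L) * (1 / Complex.sinh x)) * r₀ * r * Real.cos t) *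
            Complex.exp (-(Complex.I * m * t)) := by
    rw [← intervalIntegral.integral_const_mul]
    refine intervalIntegral.integral_congr fun t _ => ?_
    simp only [mehler, if_neg hmz, ← hxd, Int.cast_natCast]
    simp only [mul_assoc, ← Complex.exp_add]
    congr 2
    push_cast
    field_simp
    ring
  rw [key]
  push_cast
  ring

lemma amplitudePdf_eq_mehlerCoeff (hσ : 0 < σ) (hL : 0 < L) (r r₀ : ℝ) :
    amplitudePdf σ L r r₀ = 2 * r / (σ ^ 2 * L) * (mehlerCoeff γ σ L r r₀ 0).re := by
  have hσ' : (σ : ℂ) ≠ 0 := by exact_mod_cast hσ.ne'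
  have hL' : (L : ℂ) ≠ 0 := by exact_mod_cast hL.ne'
  rw [amplitudePdf, mul_assoc, ← Complex.re_ofReal_mul, besselI_eq_integral, mehlerCoeff]
  congr 2
  rw [mul_left_comm, ← intervalIntegral.integral_const_mul]
  congr 1
  refine intervalIntegral.integral_congr fun t _ => ?_
  simp only [mehler, if_true, Nat.cast_zero, Int.cast_zero]
  rw [← mul_assoc, Complex.ofReal_exp, ← Complex.exp_add]
  congr 2
  push_cast
  field_simp
  ring

lemma norm_coeffC_le (hγ : 0 < γ) (hσ : 0 < σ) (hL : 0 < L) :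
    ∃ C κ : ℝ, 0 < C ∧ 0 < κ ∧ ∀ r r₀ : ℝ, ∀ k : ℕ,
      ‖coeffC γ σ L (k + 1) r r₀‖
        ≤ |r| * Real.exp (-(κ * (r ^ 2 + r₀ ^ 2))) * (C / ((k + 1 : ℕ) : ℝ) ^ 2) := by
  obtain ⟨C, κ, hC, hκ, h⟩ := norm_mehlerCoeff_le hγ hσ hL
  have hv : 0 < σ ^ 2 * L := by positivity
  refine ⟨C / (σ ^ 2 * L), κ, by positivity, hκ, fun r r₀ k => ?_⟩
  have hk : ((k + 1 : ℕ) : ℤ) ≠ 0 := by exact_mod_cast Nat.succ_ne_zero k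
  rw [coeffC_eq_mehlerCoeff hγ hσ hL (Nat.succ_ne_zero k), norm_mul, Complex.norm_real,
    Real.norm_eq_abs, abs_div, abs_of_pos hv]
  refine (mul_le_mul_of_nonneg_left (h r r₀ _ hk) (by positivity)).trans_eq ?_
  rw [Int.cast_natCast]
  field_simp

lemma summable_div_succ_sq (C : ℝ) : Summable fun k : ℕ => C / ((k + 1 : ℕ) : ℝ) ^ 2 := by
  have h := (summable_nat_add_iff 1).2 (Real.summable_one_div_nat_pow.2 (by norm_num : 1 < 2))
  simpa [div_eq_mul_inv] using h.mul_left C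

lemma norm_harmonic_eq (m : ℕ) (θ : ℝ) (c : ℂ) :
    ‖c * Complex.exp (Complex.I * (m : ℂ) * (θ : ℂ))‖ = ‖c‖ := by
  rw [norm_mul, show Complex.I * (m : ℂ) * (θ : ℂ) = ((m * θ : ℝ) : ℂ) * Complex.I by
    push_cast; ring, Complex.norm_exp_ofReal_mul_I, mul_one]

lemma summable_harmonics (hγ : 0 < γ) (hσ : 0 < σ) (hL : 0 < L) (r r₀ θ : ℝ) :
    Summable fun k : ℕ => coeffC γ σ L (k + 1) r r₀ *
      Complex.exp (Complex.I * ((k + 1 : ℕ) : ℂ) * (θ : ℂ)) := by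
  obtain ⟨C, κ, -, -, h⟩ := norm_coeffC_le hγ hσ hL
  refine .of_norm_bounded (g := fun k : ℕ => |r| * Real.exp (-(κ * (r ^ 2 + r₀ ^ 2))) *
    (C / ((k + 1 : ℕ) : ℝ) ^ 2)) ((summable_div_succ_sq C).mul_left _) fun k => ?_
  rw [norm_harmonic_eq]
  exact h r r₀ k

/-- For `w = 2`, `π` times the density is exactly `Re f 0 + 2 ∑ Re f k` over `k ≥ 1`, with `f` the
twisted Mehler coefficients times `r / v`; the Rician density is `2 Re f 0`. -/
lemma harmonicKernel_two_nonneg (hγ : 0 < γ) (hσ : 0 < σ) (hL : 0 < L) {r : ℝ} (hr : 0 ≤ r)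
    (r₀ θ : ℝ) : 0 ≤ harmonicKernel γ σ L 2 r r₀ θ := by
  have hv : 0 < σ ^ 2 * L := by positivity
  have hpi := Real.pi_pos
  have hs := (summable_harmonics hγ hσ hL r r₀ θ).hasSum
  have hpd := ((isPosDefSeq_mehlerCoeff hγ hσ hL r r₀).twist θ).const_mul
    (div_nonneg hr hv.le)
  have h := hpd.nonneg_of_hasSum (S := ∑' k : ℕ, (coeffC γ σ L (k + 1) r r₀ *
      Complex.exp (Complex.I * ((k + 1 : ℕ) : ℂ) * (θ : ℂ))).re) (fun k => ?_) ?_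
  · have e : harmonicKernel γ σ L 2 r r₀ θ = 1 / Real.pi *
        ((((r / (σ ^ 2 * L) : ℝ) : ℂ) *
          (Complex.exp (Complex.I * ((0 : ℤ) : ℂ) * θ) * mehlerCoeff γ σ L r r₀ 0)).re
          + 2 * ∑' k : ℕ, (coeffC γ σ L (k + 1) r r₀ *
      Complex.exp (Complex.I * ((k + 1 : ℕ) : ℂ) * (θ : ℂ))).re) := by
      rw [harmonicKernel, amplitudePdf_eq_mehlerCoeff (γ := γ) hσ hL, Complex.re_ofReal_mul]
      generalize (∑' k : ℕ, (coeffC γ σ L (k + 1) r r₀ *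
        Complex.exp (Complex.I * ((k + 1 : ℕ) : ℂ) * (θ : ℂ))).re) = S
      simp only [Int.cast_zero, mul_zero, zero_mul, Complex.exp_zero, one_mul]
      field_simp
    rw [e]
    exact mul_nonneg (by positivity) h
  · rw [show -(k : ℤ) - 1 = -((k : ℤ) + 1) by ring, mehlerCoeff_neg hγ hσ hL, map_mul, map_mul,
      Complex.conj_ofReal, ← Complex.exp_conj]
    congr 3
    simp only [map_mul, Complex.conj_I, map_intCast, Complex.conj_ofReal]
    push_cast
    ring
  · have hh := Complex.hasSum_re hs
    rw [Complex.re_tsum hs.summable] at hh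
    refine hh.congr_fun fun k => ?_
    rw [coeffC_eq_mehlerCoeff hγ hσ hL (Nat.succ_ne_zero k)]
    congr 1
    push_cast
    ring

lemma amplitudePdf_nonneg (hγ : 0 < γ) (hσ : 0 < σ) (hL : 0 < L) {r : ℝ} (hr : 0 ≤ r) (r₀ : ℝ) :
    0 ≤ amplitudePdf σ L r r₀ := by
  rw [amplitudePdf_eq_mehlerCoeff (γ := γ) hσ hL]
  refine mul_nonneg (by positivity) ?_
  simpa using isPosDefSeq_mehlerCoeff hγ hσ hL r r₀ 1 fun _ => 1

/-- The density for `w = 1` is the equal mixture of the one for `w = 2` and the phase-uniform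
density `p(r | r₀) / (2π)`. -/
lemma harmonicKernel_nonneg (hγ : 0 < γ) (hσ : 0 < σ) (hL : 0 < L) {w : ℝ} (hw : w = 1 ∨ w = 2)
    {r : ℝ} (hr : 0 ≤ r) (r₀ θ : ℝ) : 0 ≤ harmonicKernel γ σ L w r r₀ θ := by
  have h2 := harmonicKernel_two_nonneg hγ hσ hL hr r₀ θ
  rcases hw with rfl | rfl
  · have h0 := amplitudePdf_nonneg hγ hσ hL hr r₀
    have e : harmonicKernel γ σ L 1 r r₀ θ = 1 / 2 * harmonicKernel γ σ L 2 r r₀ θ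
        + 1 / (4 * Real.pi) * amplitudePdf σ L r r₀ := by
      have := Real.pi_pos
      rw [harmonicKernel, harmonicKernel]
      generalize (∑' k : ℕ, (coeffC γ σ L (k + 1) r r₀ *
        Complex.exp (Complex.I * ((k + 1 : ℕ) : ℂ) * (θ : ℂ))).re) = S
      field_simp
      ring
    rw [e]
    positivity
  · exact h2

/-! ### Continuity, Gaussian bound and total mass of the transition density -/

lemma continuous_amplitudePdf : Continuous fun p : ℝ × ℝ => amplitudePdf σ L p.1 p.2 := by
  unfold amplitudePdf
  refine Continuous.mul (by fun_prop) (Complex.continuous_re.comp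
    ((continuous_besselI 0).comp (Complex.continuous_ofReal.comp ?_)))
  fun_prop

lemma continuous_coeffC (m : ℕ) : Continuous fun p : ℝ × ℝ => coeffC γ σ L m p.1 p.2 := by
  unfold coeffC
  refine Continuous.mul (by fun_prop) ((continuous_besselI m).comp ?_)
  fun_prop

lemma abs_mul_exp_neg_le {κ : ℝ} (hκ : 0 < κ) (r r₀ : ℝ) :
    |r| * Real.exp (-(κ * (r ^ 2 + r₀ ^ 2))) ≤ 1 + 1 / κ := by
  have h1 : |r| ≤ 1 + r ^ 2 := by
    rw [← sq_abs]; nlinarith [sq_nonneg (|r| - 1)]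
  have h2 : κ * r ^ 2 ≤ Real.exp (κ * (r ^ 2 + r₀ ^ 2)) := by
    have := Real.add_one_le_exp (κ * (r ^ 2 + r₀ ^ 2))
    nlinarith [mul_nonneg hκ.le (sq_nonneg r₀)]
  have h3 : 1 ≤ Real.exp (κ * (r ^ 2 + r₀ ^ 2)) := Real.one_le_exp (by positivity)
  rw [Real.exp_neg, ← div_eq_mul_inv, div_le_iff₀ (Real.exp_pos _)]
  have h4 : r ^ 2 ≤ 1 / κ * Real.exp (κ * (r ^ 2 + r₀ ^ 2)) := by
    rw [one_div, le_inv_mul_iff₀ hκ]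
    exact h2
  linarith

lemma continuous_harmonicKernel (hγ : 0 < γ) (hσ : 0 < σ) (hL : 0 < L) (w : ℝ) :
    Continuous fun p : ℝ × ℝ × ℝ => harmonicKernel γ σ L w p.1 p.2.1 p.2.2 := by
  obtain ⟨C, κ, hC, hκ, h⟩ := norm_coeffC_le hγ hσ hL
  unfold harmonicKernel
  refine (continuous_const.mul (continuous_amplitudePdf.comp (f := fun p : ℝ × ℝ × ℝ =>
    (p.1, p.2.1)) (by fun_prop))).add (continuous_const.mul
    (continuous_tsum (u := fun k : ℕ => (1 + 1 / κ) * (C / ((k + 1 : ℕ) : ℝ) ^ 2))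
      (fun k => Complex.continuous_re.comp (((continuous_coeffC (k + 1)).comp
        (f := fun p : ℝ × ℝ × ℝ => (p.1, p.2.1)) (by fun_prop)).mul (by fun_prop)))
      ((summable_div_succ_sq C).mul_left _) fun k p => ?_))
  refine (Complex.abs_re_le_norm _).trans ?_
  rw [norm_harmonic_eq]
  refine (h p.1 p.2.1 k).trans ?_
  exact mul_le_mul_of_nonneg_right (abs_mul_exp_neg_le hκ _ _) (by positivity)

lemma periodic_harmonicKernel (w r r₀ : ℝ) :
    Function.Periodic (harmonicKernel γ σ L w r r₀) (2 * Real.pi) := by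
  intro θ
  rw [harmonicKernel, harmonicKernel]
  congr 2
  refine tsum_congr fun k => ?_
  congr 2
  rw [show Complex.I * ((k + 1 : ℕ) : ℂ) * ((θ + 2 * Real.pi : ℝ) : ℂ)
    = Complex.I * ((k + 1 : ℕ) : ℂ) * (θ : ℂ) + ((k + 1 : ℕ) : ℂ) * (2 * Real.pi * Complex.I) by
      push_cast; ring, Complex.exp_add, Complex.exp_nat_mul_two_pi_mul_I, mul_one]

/-- In the Rician term `I₀(y) ≤ e^{|y|}` completes the square. The harmonics decay even faster, as
`r² + r₀² ≥ (r - |r₀|)²` for `r ≥ 0`. The factor `r` is kept: it later gives the linear bound under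
which `t log t` is estimated. -/
lemma harmonicKernel_le (hγ : 0 < γ) (hσ : 0 < σ) (hL : 0 < L) {w : ℝ} (hw : 0 ≤ w) :
    ∃ K κ : ℝ, 0 < K ∧ 0 < κ ∧ ∀ r r₀ θ : ℝ, 0 ≤ r →
      harmonicKernel γ σ L w r r₀ θ ≤ K * r * Real.exp (-(κ * (r - |r₀|) ^ 2)) := by
  obtain ⟨C, κ, hC, hκ, h⟩ := norm_coeffC_le hγ hσ hL
  have hv : 0 < σ ^ 2 * L := by positivity
  have hpi := Real.pi_pos
  set S := ∑' k : ℕ, C / ((k + 1 : ℕ) : ℝ) ^ 2 with hS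
  have hS0 : 0 ≤ S := tsum_nonneg fun k => by positivity
  refine ⟨1 / (2 * Real.pi) * (2 / (σ ^ 2 * L)) + w / Real.pi * S, min κ (1 / (σ ^ 2 * L)),
    by positivity, by positivity, fun r r₀ θ hr => ?_⟩
  have h1 : amplitudePdf σ L r r₀
      ≤ 2 / (σ ^ 2 * L) * (r * Real.exp (-(min κ (1 / (σ ^ 2 * L)) * (r - |r₀|) ^ 2))) := by
    have hb : (besselI 0 ((2 * r * r₀ / (σ ^ 2 * L) : ℝ) : ℂ)).re
        ≤ Real.exp (2 * r * |r₀| / (σ ^ 2 * L)) := by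
      refine ((le_abs_self _).trans (Complex.abs_re_le_norm _)).trans
        ((norm_besselI_zero_le _).trans_eq ?_)
      rw [abs_div, abs_mul, abs_of_pos hv, abs_of_nonneg (by positivity : 0 ≤ 2 * r)]
    calc amplitudePdf σ L r r₀
        ≤ 2 * r / (σ ^ 2 * L) * Real.exp (-(r ^ 2 + r₀ ^ 2) / (σ ^ 2 * L)) *
            Real.exp (2 * r * |r₀| / (σ ^ 2 * L)) :=
          mul_le_mul_of_nonneg_left hb (by positivity)
      _ = 2 / (σ ^ 2 * L) * (r * Real.exp (-(1 / (σ ^ 2 * L) * (r - |r₀|) ^ 2))) := by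
          rw [mul_assoc, ← Real.exp_add, ← sq_abs r₀]
          rw [show -(r ^ 2 + |r₀| ^ 2) / (σ ^ 2 * L) + 2 * r * |r₀| / (σ ^ 2 * L)
            = -(1 / (σ ^ 2 * L) * (r - |r₀|) ^ 2) by ring]
          ring
      _ ≤ _ := by
          gcongr
          exact min_le_right _ _
  have h2 : ∑' k : ℕ, (coeffC γ σ L (k + 1) r r₀ *
      Complex.exp (Complex.I * ((k + 1 : ℕ) : ℂ) * (θ : ℂ))).re
      ≤ S * (r * Real.exp (-(min κ (1 / (σ ^ 2 * L)) * (r - |r₀|) ^ 2))) := by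
    rw [hS, ← tsum_mul_right]
    refine Summable.tsum_le_tsum (fun k => ?_)
      (Complex.hasSum_re (summable_harmonics hγ hσ hL r r₀ θ).hasSum).summable
      ((summable_div_succ_sq C).mul_right _)
    refine ((le_abs_self _).trans (Complex.abs_re_le_norm _)).trans ?_
    rw [norm_harmonic_eq, mul_comm]
    rw [mul_comm]
    refine (h r r₀ k).trans ?_
    rw [abs_of_nonneg hr, mul_comm]
    gcongr
    · exact min_le_left _ _
    · rw [← sq_abs r₀]
      nlinarith [mul_nonneg hr (abs_nonneg r₀)]
  rw [harmonicKernel]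
  calc _ ≤ 1 / (2 * Real.pi) * (2 / (σ ^ 2 * L) *
        (r * Real.exp (-(min κ (1 / (σ ^ 2 * L)) * (r - |r₀|) ^ 2)))) +
      w / Real.pi * (S * (r * Real.exp (-(min κ (1 / (σ ^ 2 * L)) * (r - |r₀|) ^ 2)))) := by
        gcongr
    _ = _ := by ring

/-- The summable bounds allow termwise integration, and each harmonic of order at least one has mean
zero over a period. -/
lemma integral_harmonicKernel (hγ : 0 < γ) (hσ : 0 < σ) (hL : 0 < L) (w r r₀ : ℝ) :
    ∫ θ in (0 : ℝ)..2 * Real.pi, harmonicKernel γ σ L w r r₀ θ = amplitudePdf σ L r r₀ := by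
  obtain ⟨C, κ, hC, hκ, h⟩ := norm_coeffC_le hγ hσ hL
  have h2pi : (0 : ℝ) ≤ 2 * Real.pi := by positivity
  have hpi := Real.pi_pos
  have hc : ∀ k : ℕ, Continuous fun θ : ℝ => (coeffC γ σ L (k + 1) r r₀ *
      Complex.exp (Complex.I * ((k + 1 : ℕ) : ℂ) * (θ : ℂ))).re := fun k =>
    Complex.continuous_re.comp (by fun_prop)
  have hsum := hasSum_integral_of_summable_integral_norm
    (μ := volume.restrict (Ioc 0 (2 * Real.pi)))
    (F := fun (k : ℕ) (θ : ℝ) => (coeffC γ σ L (k + 1) r r₀ *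
      Complex.exp (Complex.I * ((k + 1 : ℕ) : ℂ) * (θ : ℂ))).re)
    (fun k => (hc k).integrableOn_Ioc) (by
      refine Summable.of_nonneg_of_le (fun k => integral_nonneg fun _ => norm_nonneg _)
        (fun k => ?_) (((summable_div_succ_sq C).mul_left
          (|r| * Real.exp (-(κ * (r ^ 2 + r₀ ^ 2))))).mul_left (2 * Real.pi))
      refine (integral_mono (hc k).norm.integrableOn_Ioc (integrable_const _) fun θ =>
        (Complex.abs_re_le_norm _).trans ((norm_harmonic_eq _ _ _).le.trans (h r r₀ k))).trans_eq ?_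
      rw [integral_const]
      simp [hpi.le])
  have hzero : ∀ k : ℕ, ∫ θ in Ioc 0 (2 * Real.pi), (coeffC γ σ L (k + 1) r r₀ *
      Complex.exp (Complex.I * ((k + 1 : ℕ) : ℂ) * (θ : ℂ))).re = 0 := by
    intro k
    have hi : Integrable (fun θ : ℝ => coeffC γ σ L (k + 1) r r₀ *
      Complex.exp (Complex.I * ((k + 1 : ℕ) : ℂ) * (θ : ℂ)))
      (volume.restrict (Ioc 0 (2 * Real.pi))) :=
      Continuous.integrableOn_Ioc (by fun_prop)
    have e := integral_re (𝕜 := ℂ) hi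
    simp only [RCLike.re_eq_complex_re] at e
    rw [e, integral_const_mul, ← intervalIntegral.integral_of_le h2pi]
    have := integral_exp_int_mul ((k + 1 : ℕ) : ℤ)
    rw [if_neg (by exact_mod_cast Nat.succ_ne_zero k)] at this
    simp only [Int.cast_natCast] at this
    rw [this]
    simp
  simp_rw [hzero] at hsum
  have hts := hsum.unique hasSum_zero
  have hcont : Continuous fun θ : ℝ => harmonicKernel γ σ L w r r₀ θ :=
    (continuous_harmonicKernel hγ hσ hL w).comp (f := fun θ : ℝ => (r, r₀, θ)) (by fun_prop)
  have htc : Continuous fun θ : ℝ => w / Real.pi * ∑' k : ℕ, (coeffC γ σ L (k + 1) r r₀ *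
      Complex.exp (Complex.I * ((k + 1 : ℕ) : ℂ) * (θ : ℂ))).re := by
    have := hcont.sub (continuous_const (y := 1 / (2 * Real.pi) * amplitudePdf σ L r r₀))
    refine this.congr fun θ => ?_
    simp only [harmonicKernel, Pi.sub_apply, add_sub_cancel_left]
  simp only [harmonicKernel]
  rw [intervalIntegral.integral_add (by simp) (htc.intervalIntegrable _ _),
    intervalIntegral.integral_const_mul, intervalIntegral.integral_of_le h2pi,
    intervalIntegral.integral_of_le h2pi, integral_const_mul (w / Real.pi), hts]
  simp [hpi.le]
  field_simp

/-- The Rician law has total mass one. -/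
lemma integral_amplitudePdf (hσ : 0 < σ) (hL : 0 < L) (r₀ : ℝ) :
    ∫ r in Ioi (0 : ℝ), amplitudePdf σ L r r₀ = 1 := by
  set v := σ ^ 2 * L with hvd
  have hv : 0 < v := by positivity
  -- Expand `I₀` in its power series. Each term is a Gamma integral in `r`, equal to the Poisson
  -- weight `e^{-λ} λ^k / k!` with `λ = r₀² / v`, and these sum to one.
  set F : ℕ → ℝ → ℝ := fun k r => (2 / v * Real.exp (-(r₀ ^ 2 / v)) *
    ((r₀ / v) ^ (2 * k) / (k.factorial : ℝ) ^ 2)) *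
      (r ^ ((2 * k + 1 : ℕ) : ℝ) * Real.exp (-(1 / v) * r ^ (2 : ℝ))) with hF
  have hFs : ∀ r ∈ Ioi (0 : ℝ), HasSum (fun k => F k r) (amplitudePdf σ L r r₀) := by
    intro r hr
    have hsm : Summable fun k : ℕ => ((2 * r * r₀ / v / 2) ^ 2) ^ k / (k.factorial : ℝ) ^ 2 := by
      refine Summable.of_nonneg_of_le (fun k => by positivity) (fun k => ?_)
        (Real.summable_pow_div_factorial ((2 * r * r₀ / v / 2) ^ 2))
      have : (1 : ℝ) ≤ k.factorial := by exact_mod_cast Nat.one_le_iff_ne_zero.2 k.factorial_ne_zero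
      gcongr
      exact le_self_pow₀ this two_ne_zero
    have hb : besselI 0 ((2 * r * r₀ / v : ℝ) : ℂ)
        = ((∑' k : ℕ, ((2 * r * r₀ / v / 2) ^ 2) ^ k / (k.factorial : ℝ) ^ 2 : ℝ) : ℂ) := by
      rw [besselI, Complex.ofReal_tsum]
      refine tsum_congr fun k => ?_
      push_cast
      rw [add_zero, add_zero, pow_mul, sq (k.factorial : ℂ)]
    rw [amplitudePdf, ← hvd, hb, Complex.ofReal_re]
    refine (hsm.hasSum.mul_left _).congr_fun fun k => ?_
    simp only [hF]
    rw [Real.rpow_natCast, Real.rpow_two, show -(r ^ 2 + r₀ ^ 2) / v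
      = -(r₀ ^ 2 / v) + -(1 / v) * r ^ 2 by ring, Real.exp_add]
    rw [show 2 * r * r₀ / v / 2 = r * (r₀ / v) by ring, pow_add, ← pow_mul, mul_pow]
    ring
  have hint : ∀ k, IntegrableOn (F k) (Ioi 0) := by
    intro k
    refine (integrableOn_rpow_mul_exp_neg_mul_rpow ?_ ?_ ?_).const_mul _
    · have : (0 : ℝ) ≤ ((2 * k + 1 : ℕ) : ℝ) := Nat.cast_nonneg _
      linarith
    · norm_num
    · positivity
  have hval : ∀ k, ∫ r in Ioi (0 : ℝ), F k r
      = Real.exp (-(r₀ ^ 2 / v)) * ((r₀ ^ 2 / v) ^ k / k.factorial) := by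
    intro k
    simp only [hF]
    rw [integral_const_mul, integral_rpow_mul_exp_neg_mul_rpow (by norm_num)
      (by have : (0 : ℝ) ≤ ((2 * k + 1 : ℕ) : ℝ) := Nat.cast_nonneg _
          linarith) (by positivity)]
    have e1 : (((2 * k + 1 : ℕ) : ℝ) + 1) / 2 = k + 1 := by push_cast; ring
    have e2 : -(((2 * k + 1 : ℕ) : ℝ) + 1) / 2 = -((k + 1 : ℕ) : ℝ) := by push_cast; ring
    rw [e1, e2, Real.Gamma_nat_eq_factorial, Real.rpow_neg (by positivity), Real.rpow_natCast]
    have : (k.factorial : ℝ) ≠ 0 := by exact_mod_cast k.factorial_ne_zero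
    have e3 : (r₀ / v) ^ (2 * k) = (r₀ ^ 2 / v) ^ k / v ^ k := by
      rw [pow_mul, ← div_pow]
      congr 1
      field_simp
    rw [e3, one_div_pow, one_div, inv_inv, pow_succ]
    field_simp
    rw [pow_succ]
    ring
  have hnn : ∀ k, ∀ r ∈ Ioi (0 : ℝ), 0 ≤ F k r := by
    intro k r hr
    have hr' : 0 < r := hr
    simp only [hF]
    rw [pow_mul]
    positivity
  have hexp : HasSum (fun k : ℕ => Real.exp (-(r₀ ^ 2 / v)) * ((r₀ ^ 2 / v) ^ k / k.factorial))
      1 := by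
    have h := NormedSpace.expSeries_div_hasSum_exp (𝔸 := ℝ) (r₀ ^ 2 / v)
    rw [← Real.exp_eq_exp_ℝ] at h
    have h' := h.mul_left (Real.exp (-(r₀ ^ 2 / v)))
    rwa [← Real.exp_add, neg_add_cancel, Real.exp_zero] at h'
  have hs := hasSum_integral_of_summable_integral_norm (μ := volume.restrict (Ioi (0 : ℝ)))
    (F := F) hint (by
      refine hexp.summable.congr fun k => ?_
      rw [← hval]
      exact setIntegral_congr_fun measurableSet_Ioi fun r hr =>
        (Real.norm_of_nonneg (hnn k r hr)).symm)
  simp_rw [hval] at hs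
  rw [← hs.unique hexp]
  exact setIntegral_congr_fun measurableSet_Ioi fun r hr => (hFs r hr).tsum_eq.symm

end

section

/-! ### Polar kernels -/

/-- A transition density in polar coordinates that depends on the phases through their difference
and has a Gaussian bound in the amplitudes. -/
structure IsPolarKernel (g : ℝ → ℝ → ℝ → ℝ) : Prop where
  cont : Continuous fun p : ℝ × ℝ × ℝ => g p.1 p.2.1 p.2.2
  nonneg : ∀ r r₀ θ : ℝ, 0 ≤ r → 0 ≤ g r r₀ θ
  bound : ∃ K κ : ℝ, 0 < K ∧ 0 < κ ∧ ∀ r r₀ θ : ℝ, 0 ≤ r →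
    g r r₀ θ ≤ K * r * Real.exp (-(κ * (r - |r₀|) ^ 2))
  periodic : ∀ r r₀ : ℝ, Function.Periodic (g r r₀) (2 * Real.pi)
  total : ∀ r₀ : ℝ, ∫ r in Ici (0 : ℝ), ∫ θ in (0 : ℝ)..2 * Real.pi, g r r₀ θ = 1

theorem isPolarKernel_harmonicKernel {γ σ L w : ℝ} (hγ : 0 < γ) (hσ : 0 < σ) (hL : 0 < L)
    (hw : w = 1 ∨ w = 2) : IsPolarKernel (harmonicKernel γ σ L w) where
  cont := continuous_harmonicKernel hγ hσ hL w
  nonneg := fun _ r₀ θ hr => harmonicKernel_nonneg hγ hσ hL hw hr r₀ θ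
  bound := harmonicKernel_le hγ hσ hL (by rcases hw with rfl | rfl <;> norm_num)
  periodic := periodic_harmonicKernel w
  total := fun r₀ => by
    simp_rw [integral_harmonicKernel hγ hσ hL w]
    rw [integral_Ici_eq_integral_Ioi]
    exact integral_amplitudePdf hσ hL r₀

lemma polarMeasure_eq_prod : polarMeasure =
    (volume.restrict (Ici (0 : ℝ))).prod (volume.restrict (Ico (0 : ℝ) (2 * Real.pi))) := by
  rw [polarMeasure, polarDomain, Measure.prod_restrict, Measure.volume_eq_prod]

instance : SFinite polarMeasure := by unfold polarMeasure; infer_instance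
instance : SigmaFinite polarMeasure := by unfold polarMeasure; infer_instance

lemma measurableSet_polarDomain : MeasurableSet polarDomain :=
  measurableSet_Ici.prod measurableSet_Ico

lemma ae_polarMeasure_nonneg : ∀ᵐ y ∂polarMeasure, 0 ≤ y.1 := by
  filter_upwards [ae_restrict_mem measurableSet_polarDomain] with y hy
  exact hy.1

/-- The bound used for dominated convergence. -/
def gaussBound (κ s r : ℝ) : ℝ := (1 + r ^ 2) * Real.exp (-(κ * (r - |s|) ^ 2)) + Real.exp (-r)

lemma gaussBound_nonneg (κ s r : ℝ) : 0 ≤ gaussBound κ s r := by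
  unfold gaussBound; positivity

lemma integrable_one_add_sq_mul_exp {κ : ℝ} (hκ : 0 < κ) (a b : ℝ) :
    Integrable fun r : ℝ => (a + b * r ^ 2) * Real.exp (-(κ * r ^ 2)) := by
  have h1 := (integrable_exp_neg_mul_sq hκ).const_mul a
  have h2 := (integrable_rpow_mul_exp_neg_mul_sq hκ (s := 2) (by norm_num)).const_mul b
  refine (h1.add h2).congr (ae_of_all _ fun r => ?_)
  simp only [Pi.add_apply, Real.rpow_two, neg_mul]
  ring

lemma integrableOn_exp_neg : IntegrableOn (fun r : ℝ => Real.exp (-r)) (Ici 0) := by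
  rw [integrableOn_Ici_iff_integrableOn_Ioi]
  exact integrableOn_exp_neg_Ioi 0

/-- `(r - |s|)² ≥ r² / 2 - s²`, equivalent to `(r - 2|s|)² ≥ 0`. -/
lemma exp_gauss_le {κ : ℝ} (hκ : 0 < κ) {M s : ℝ} (hs : |s| ≤ M) (r : ℝ) :
    Real.exp (-(κ * (r - |s|) ^ 2)) ≤ Real.exp (κ * M ^ 2) * Real.exp (-(κ / 2 * r ^ 2)) := by
  rw [← Real.exp_add]
  refine Real.exp_le_exp.2 ?_
  have h1 : |s| ^ 2 ≤ M ^ 2 := pow_le_pow_left₀ (abs_nonneg _) hs 2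
  have h2 : 0 ≤ (r - 2 * |s|) ^ 2 := sq_nonneg _
  nlinarith

/-- A dominating function that works for all amplitudes up to `M`. -/
lemma gaussBound_le {κ : ℝ} (hκ : 0 < κ) {M s : ℝ} (hs : |s| ≤ M) (r : ℝ) :
    gaussBound κ s r ≤ Real.exp (κ * M ^ 2) * ((1 + 1 * r ^ 2) * Real.exp (-(κ / 2 * r ^ 2)))
      + Real.exp (-r) := by
  unfold gaussBound
  have := mul_le_mul_of_nonneg_left (exp_gauss_le hκ hs r) (by positivity : 0 ≤ 1 + r ^ 2)
  linarith

lemma integrableOn_dominating {κ : ℝ} (hκ : 0 < κ) (M : ℝ) :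
    IntegrableOn (fun r : ℝ => Real.exp (κ * M ^ 2) *
      ((1 + 1 * r ^ 2) * Real.exp (-(κ / 2 * r ^ 2))) + Real.exp (-r)) (Ici 0) :=
  ((integrable_one_add_sq_mul_exp (half_pos hκ) 1 1).const_mul _).integrableOn.add
    integrableOn_exp_neg

lemma integrableOn_gaussBound {κ : ℝ} (hκ : 0 < κ) (s : ℝ) :
    IntegrableOn (gaussBound κ s) (Ici 0) := by
  refine (integrableOn_dominating hκ |s|).mono' ?_ (ae_of_all _ fun r => ?_)
  · refine Continuous.aestronglyMeasurable ?_
    unfold gaussBound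
    fun_prop
  · rw [Real.norm_of_nonneg (gaussBound_nonneg _ _ _)]
    exact gaussBound_le hκ le_rfl r

/-- Centring the Gaussian at `|s|` and using `r² ≤ 2 s² + 2 (r - |s|)²` gives quadratic growth in
the input amplitude, which is why a second moment of the input makes all later integrals finite. -/
lemma integral_gaussBound_le {κ : ℝ} (hκ : 0 < κ) :
    ∃ C : ℝ, 0 < C ∧ ∀ s, ∫ r in Ici (0 : ℝ), gaussBound κ s r ≤ C * (1 + s ^ 2) := by
  set a := ∫ r : ℝ, (1 + 0 * r ^ 2) * Real.exp (-(κ * r ^ 2)) with ha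
  set b := ∫ r : ℝ, (0 + 1 * r ^ 2) * Real.exp (-(κ * r ^ 2)) with hb
  have ha0 : 0 ≤ a := integral_nonneg fun r => by simp only [zero_mul]; positivity
  have hb0 : 0 ≤ b := integral_nonneg fun r => by simp only [zero_add]; positivity
  have he : ∫ r in Ici (0 : ℝ), Real.exp (-r) = 1 := by
    rw [integral_Ici_eq_integral_Ioi, integral_exp_neg_Ioi_zero]
  refine ⟨2 * a + 2 * b + 1, by positivity, fun s => ?_⟩
  have hi : Integrable fun t : ℝ => ((1 + 2 * s ^ 2) + 2 * t ^ 2) * Real.exp (-(κ * t ^ 2)) :=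
    integrable_one_add_sq_mul_exp hκ _ _
  have hle : ∫ r in Ici (0 : ℝ), gaussBound κ s r ≤ ∫ r in Ici (0 : ℝ),
      (((1 + 2 * s ^ 2) + 2 * (r - |s|) ^ 2) * Real.exp (-(κ * (r - |s|) ^ 2))
        + Real.exp (-r)) := by
    refine integral_mono (integrableOn_gaussBound hκ s)
      ((hi.comp_sub_right |s|).integrableOn.add integrableOn_exp_neg) fun r => ?_
    have h : 1 + r ^ 2 ≤ (1 + 2 * s ^ 2) + 2 * (r - |s|) ^ 2 := by
      nlinarith [sq_nonneg (r - 2 * |s|), sq_abs s]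
    exact add_le_add (mul_le_mul_of_nonneg_right h (Real.exp_nonneg _)) le_rfl
  refine hle.trans ?_
  rw [integral_add (hi.comp_sub_right |s|).integrableOn integrableOn_exp_neg, he]
  have h1 : ∫ r in Ici (0 : ℝ),
      ((1 + 2 * s ^ 2) + 2 * (r - |s|) ^ 2) * Real.exp (-(κ * (r - |s|) ^ 2))
      ≤ (1 + 2 * s ^ 2) * a + 2 * b := by
    refine (setIntegral_le_integral (hi.comp_sub_right |s|)
      (ae_of_all _ fun r => by simp only [Pi.zero_apply]; positivity)).trans_eq ?_
    rw [integral_sub_right_eq_self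
      (fun t => ((1 + 2 * s ^ 2) + 2 * t ^ 2) * Real.exp (-(κ * t ^ 2))), ha, hb,
      ← integral_const_mul, ← integral_const_mul, ← integral_add
        ((integrable_one_add_sq_mul_exp hκ 1 0).const_mul _)
        ((integrable_one_add_sq_mul_exp hκ 0 1).const_mul _)]
    congr 1
    ext t
    ring
  nlinarith [mul_nonneg ha0 (sq_nonneg s), mul_nonneg hb0 (sq_nonneg s)]

/-- Functions of a parameter and the output that are dominated by a multiple of `gaussBound`, for
an amplitude that depends continuously on the parameter. -/
structure IsDominated {X : Type*} [TopologicalSpace X] (ρ : X → ℝ) (F : X → ℝ × ℝ → ℝ) :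
    Prop where
  contAmp : Continuous ρ
  cont : Continuous (Function.uncurry F)
  bound : ∃ C κ : ℝ, 0 < C ∧ 0 < κ ∧ ∀ x y, 0 ≤ y.1 → |F x y| ≤ C * gaussBound κ (ρ x) y.1

lemma integrable_comp_fst_polarMeasure {f : ℝ → ℝ} (hf : IntegrableOn f (Ici 0)) :
    Integrable (fun y : ℝ × ℝ => f y.1) polarMeasure := by
  rw [polarMeasure_eq_prod]
  exact Integrable.comp_fst hf _

lemma integral_comp_fst_polarMeasure (f : ℝ → ℝ) :
    ∫ y, f y.1 ∂polarMeasure = 2 * Real.pi * ∫ r in Ici (0 : ℝ), f r := by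
  rw [polarMeasure_eq_prod, integral_fun_fst]
  simp [Real.pi_pos.le]

namespace IsDominated

variable {X : Type*} [TopologicalSpace X] {ρ : X → ℝ} {F : X → ℝ × ℝ → ℝ}

lemma abs (h : IsDominated ρ F) : IsDominated ρ fun x y => |F x y| where
  contAmp := h.contAmp
  cont := h.cont.abs
  bound := by simpa using h.bound

lemma integrable (h : IsDominated ρ F) (x : X) : Integrable (F x) polarMeasure := by
  obtain ⟨C, κ, hC, hκ, hb⟩ := h.bound
  refine ((integrable_comp_fst_polarMeasure (integrableOn_gaussBound hκ (ρ x))).const_mul C).mono'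
    (h.cont.comp (f := fun y => (x, y)) (by fun_prop)).aestronglyMeasurable ?_
  filter_upwards [ae_polarMeasure_nonneg] with y hy using hb x y hy

lemma continuous_integral [FirstCountableTopology X] (h : IsDominated ρ F) :
    Continuous fun x => ∫ y, F x y ∂polarMeasure := by
  obtain ⟨C, κ, hC, hκ, hb⟩ := h.bound
  refine continuous_iff_continuousAt.2 fun x₀ => ?_
  refine continuousAt_of_dominated (bound := fun y : ℝ × ℝ => C * (Real.exp (κ * (|ρ x₀| + 1) ^ 2) *
    ((1 + 1 * y.1 ^ 2) * Real.exp (-(κ / 2 * y.1 ^ 2))) + Real.exp (-y.1)))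
    (Eventually.of_forall fun x => (h.cont.comp (f := fun y => (x, y))
      (by fun_prop)).aestronglyMeasurable) ?_
    ((integrable_comp_fst_polarMeasure (integrableOn_dominating hκ (|ρ x₀| + 1))).const_mul C)
    (ae_of_all _ fun y => (h.cont.comp (f := fun x => (x, y)) (by fun_prop)).continuousAt)
  have hnear : ∀ᶠ x in 𝓝 x₀, |ρ x| < |ρ x₀| + 1 :=
    h.contAmp.abs.continuousAt.eventually (gt_mem_nhds (lt_add_one _))
  filter_upwards [hnear] with x hx
  filter_upwards [ae_polarMeasure_nonneg] with y hy
  exact (hb x y hy).trans (mul_le_mul_of_nonneg_left (gaussBound_le hκ hx.le y.1) hC.le)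

lemma integral_abs_le (h : IsDominated ρ F) :
    ∃ C : ℝ, 0 < C ∧ ∀ x, ∫ y, |F x y| ∂polarMeasure ≤ C * (1 + ρ x ^ 2) := by
  obtain ⟨C, κ, hC, hκ, hb⟩ := h.bound
  obtain ⟨D, hD, hDb⟩ := integral_gaussBound_le hκ
  have hpi := Real.pi_pos
  refine ⟨C * (2 * Real.pi * D), by positivity, fun x => ?_⟩
  calc ∫ y, |F x y| ∂polarMeasure ≤ ∫ y : ℝ × ℝ, C * gaussBound κ (ρ x) y.1 ∂polarMeasure := by
        refine integral_mono_ae (h.integrable x).abs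
          ((integrable_comp_fst_polarMeasure (integrableOn_gaussBound hκ (ρ x))).const_mul C) ?_
        filter_upwards [ae_polarMeasure_nonneg] with y hy using hb x y hy
    _ = C * (2 * Real.pi * ∫ r in Ici (0 : ℝ), gaussBound κ (ρ x) r) := by
        rw [integral_const_mul, integral_comp_fst_polarMeasure]
    _ ≤ C * (2 * Real.pi * (D * (1 + ρ x ^ 2))) := by
        gcongr
        exact hDb _
    _ = _ := by ring

lemma abs_integral_le (h : IsDominated ρ F) :
    ∃ C : ℝ, 0 < C ∧ ∀ x, |∫ y, F x y ∂polarMeasure| ≤ C * (1 + ρ x ^ 2) := by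
  obtain ⟨C, hC, hb⟩ := h.integral_abs_le
  exact ⟨C, hC, fun x => (abs_integral_le_integral_abs).trans (hb x)⟩

lemma integrable_prod [FirstCountableTopology X] [SecondCountableTopology X] [MeasurableSpace X]
    [OpensMeasurableSpace X]
    (h : IsDominated ρ F) (μ : Measure X) [IsFiniteMeasure μ]
    (hμ : Integrable (fun x => ρ x ^ 2) μ) :
    Integrable (fun z : X × (ℝ × ℝ) => F z.1 z.2) (μ.prod polarMeasure) := by
  have hm : AEStronglyMeasurable (fun z : X × (ℝ × ℝ) => F z.1 z.2) (μ.prod polarMeasure) :=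
    h.cont.aestronglyMeasurable
  rw [integrable_prod_iff hm]
  refine ⟨ae_of_all _ fun x => h.integrable x, ?_⟩
  obtain ⟨C, hC, hb⟩ := h.integral_abs_le
  refine (((integrable_const 1).add hμ).const_mul C).mono'
    h.abs.continuous_integral.aestronglyMeasurable (ae_of_all _ fun x => ?_)
  rw [Real.norm_of_nonneg (integral_nonneg fun _ => norm_nonneg _)]
  exact hb x

end IsDominated

/-! ### The logarithm bound and relative entropy -/

/-- `-t log t` is controlled by a linear function of `t` and an exponential. -/
lemma neg_mul_log_le (t : ℝ) (ht : 0 ≤ t) (s : ℝ) :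
    Real.negMulLog t ≤ t * s + Real.exp (-s) := by
  rcases ht.eq_or_lt with rfl | ht
  · simp [Real.exp_nonneg]
  have h := Real.add_one_le_exp (-s - Real.log t)
  rw [Real.exp_sub, Real.exp_log ht, le_div_iff₀ ht] at h
  rw [Real.negMulLog]
  nlinarith

/-- The lower bound is `log t ≤ t - 1 ≤ K s`, the upper one is `neg_mul_log_le`. Applied with `s =
r`, it controls an entropy integrand by the first moment of the output amplitude. -/
lemma abs_negMulLog_le {t s K : ℝ} (ht : 0 ≤ t) (hs : 0 ≤ s) (hK : 0 ≤ K) (htK : t ≤ K * s) :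
    |Real.negMulLog t| ≤ (1 + K) * (s * t) + Real.exp (-s) := by
  have h0 := Real.exp_nonneg (-s)
  have h1 : 0 ≤ K * (s * t) := by positivity
  have h2 : 0 ≤ s * t := by positivity
  rw [abs_le]
  constructor
  · rcases ht.eq_or_lt with rfl | htp
    · simp [h0]
    have h3 := Real.log_le_sub_one_of_pos htp
    have : t * Real.log t ≤ t * (K * s) := mul_le_mul_of_nonneg_left (by linarith) ht
    rw [Real.negMulLog]
    nlinarith
  · have := neg_mul_log_le t ht s
    nlinarith

/-- The log-likelihood ratio is `log f - log g`, and equal masses cancel the mass correction in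
`klDiv`. The inequality of Gibbs is stated separately because `ENNReal.ofReal` would hide the sign;
it is what yields the maximum entropy bound. -/
lemma klDiv_withDensity {α : Type*} [MeasurableSpace α] {M : Measure α} [SigmaFinite M]
    {f g : α → ℝ} (hf : Measurable f) (hg : Measurable g) (hf0 : ∀ᵐ x ∂M, 0 ≤ f x)
    (hg0 : ∀ᵐ x ∂M, 0 ≤ g x) (hfi : Integrable f M) (hgi : Integrable g M)
    (hfg : ∫ x, f x ∂M = ∫ x, g x ∂M) (hac : ∀ᵐ x ∂M, g x = 0 → f x = 0)
    (hlf : Integrable (fun x => f x * Real.log (f x)) M)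
    (hlg : Integrable (fun x => f x * Real.log (g x)) M) :
    InformationTheory.klDiv (M.withDensity fun x => ENNReal.ofReal (f x))
        (M.withDensity fun x => ENNReal.ofReal (g x))
      = ENNReal.ofReal (∫ x, f x * Real.log (f x) ∂M - ∫ x, f x * Real.log (g x) ∂M) ∧
    0 ≤ ∫ x, f x * Real.log (f x) ∂M - ∫ x, f x * Real.log (g x) ∂M := by
  set P := M.withDensity fun x => ENNReal.ofReal (f x) with hP
  set R := M.withDensity fun x => ENNReal.ofReal (g x) with hR
  have hfin : IsFiniteMeasure P := isFiniteMeasure_withDensity_ofReal hfi.2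
  have hfinR : IsFiniteMeasure R := isFiniteMeasure_withDensity_ofReal hgi.2
  have hPR : P = R.withDensity fun x => ENNReal.ofReal (f x / g x) := by
    rw [hR, ← withDensity_mul _ (by fun_prop) (by fun_prop), hP]
    refine withDensity_congr_ae ?_
    filter_upwards [hg0, hac] with x hx hacx
    simp only [Pi.mul_apply]
    rw [← ENNReal.ofReal_mul hx]
    rcases eq_or_ne (g x) 0 with h0 | h0
    · simp [h0, hacx h0]
    · rw [mul_div_cancel₀ _ h0]
  have hacPR : P ≪ R := by
    rw [hPR]; exact withDensity_absolutelyContinuous _ _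
  have hPM : P ≪ M := withDensity_absolutelyContinuous _ _
  have hrn : P.rnDeriv R =ᵐ[P] fun x => ENNReal.ofReal (f x / g x) := by
    refine hacPR.ae_eq ?_
    conv_lhs => rw [hPR]
    exact Measure.rnDeriv_withDensity R (by fun_prop)
  have hllr : llr P R =ᵐ[P] fun x => Real.log (f x / g x) := by
    filter_upwards [hrn, hPM.ae_le hf0, hPM.ae_le hg0] with x hx hfx hgx
    rw [llr, hx, ENNReal.toReal_ofReal (div_nonneg hfx hgx)]
  have hpt : (fun x => (ENNReal.ofReal (f x)).toReal • Real.log (f x / g x)) =ᵐ[M]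
      fun x => f x * Real.log (f x) - f x * Real.log (g x) := by
    filter_upwards [hf0, hac] with x hx hacx
    rw [ENNReal.toReal_ofReal hx, smul_eq_mul]
    rcases eq_or_ne (f x) 0 with h0 | h0
    · simp [h0]
    · rw [Real.log_div h0 fun h => h0 (hacx h), mul_sub]
  have hlt : ∀ᵐ x ∂M, ENNReal.ofReal (f x) < ∞ := ae_of_all _ fun _ => ENNReal.ofReal_lt_top
  have hint : Integrable (llr P R) P := by
    rw [integrable_congr hllr, hP, integrable_withDensity_iff_integrable_smul' (by fun_prop) hlt,
      integrable_congr hpt]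
    exact hlf.sub hlg
  have hval : ∫ x, llr P R x ∂P
      = ∫ x, f x * Real.log (f x) ∂M - ∫ x, f x * Real.log (g x) ∂M := by
    rw [integral_congr_ae hllr, hP, integral_withDensity_eq_integral_toReal_smul (by fun_prop) hlt,
      integral_congr_ae hpt, integral_sub hlf hlg]
  have hmass : P.real univ = R.real univ := by
    rw [Measure.real, Measure.real, hP, hR, withDensity_apply _ .univ, withDensity_apply _ .univ,
      Measure.restrict_univ, ← ofReal_integral_eq_lintegral_ofReal hfi hf0,
      ← ofReal_integral_eq_lintegral_ofReal hgi hg0, hfg]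
  have h0 := InformationTheory.integral_llr_add_sub_measure_univ_nonneg hacPR hint
  rw [hval, hmass, add_sub_cancel_right] at h0
  refine ⟨?_, h0⟩
  rw [InformationTheory.klDiv_of_ac_of_integrable hacPR hint, hval, hmass, add_sub_cancel_right]

end

section

/-! ### Polar kernels as transition densities -/

/-- Integrating over a full period removes the phase reference `c`. -/
lemma integral_polarMeasure_of_periodic {h : ℝ → ℝ → ℝ}
    (hh : ∀ r, Function.Periodic (h r) (2 * Real.pi)) (c : ℝ)
    (hi : Integrable (fun y : ℝ × ℝ => h y.1 (y.2 - c)) polarMeasure) :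
    ∫ y, h y.1 (y.2 - c) ∂polarMeasure
      = ∫ r in Ici (0 : ℝ), ∫ θ in (0 : ℝ)..2 * Real.pi, h r θ := by
  have h2pi : (0 : ℝ) ≤ 2 * Real.pi := by positivity
  rw [polarMeasure_eq_prod] at hi ⊢
  rw [integral_prod _ hi]
  congr 1
  ext r
  rw [integral_Ico_eq_integral_Ioc, ← intervalIntegral.integral_of_le h2pi,
    intervalIntegral.integral_comp_sub_right (fun θ => h r θ) c]
  have := (hh r).intervalIntegral_add_eq (0 - c) 0
  rwa [zero_add, show 0 - c + 2 * Real.pi = 2 * Real.pi - c by ring] at this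

namespace IsPolarKernel

variable {g : ℝ → ℝ → ℝ → ℝ} {X : Type*} [TopologicalSpace X] {ρ ψ : X → ℝ}

lemma continuous_comp (hg : IsPolarKernel g) (hρ : Continuous ρ) (hψ : Continuous ψ) :
    Continuous fun z : X × (ℝ × ℝ) => g z.2.1 (ρ z.1) (z.2.2 - ψ z.1) :=
  hg.cont.comp (f := fun z : X × (ℝ × ℝ) => (z.2.1, ρ z.1, z.2.2 - ψ z.1)) (by fun_prop)

lemma le_gaussBound (hg : IsPolarKernel g) : ∃ C κ : ℝ, 0 < C ∧ 0 < κ ∧ ∀ r r₀ θ : ℝ, 0 ≤ r →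
    g r r₀ θ ≤ C * r ∧ g r r₀ θ ≤ C * gaussBound κ r₀ r ∧ r * g r r₀ θ ≤ C * gaussBound κ r₀ r := by
  obtain ⟨K, κ, hK, hκ, hb⟩ := hg.bound
  refine ⟨K, κ, hK, hκ, fun r r₀ θ hr => ?_⟩
  have h := hb r r₀ θ hr
  have he := Real.exp_nonneg (-(κ * (r - |r₀|) ^ 2))
  have he1 : Real.exp (-(κ * (r - |r₀|) ^ 2)) ≤ 1 :=
    Real.exp_le_one_iff.2 (neg_nonpos.2 (by positivity))
  have hr1 : r ≤ 1 + r ^ 2 := by nlinarith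
  have hexp := Real.exp_nonneg (-r)
  refine ⟨h.trans (mul_le_of_le_one_right (by positivity) he1), h.trans ?_, ?_⟩
  · rw [mul_assoc, gaussBound]
    refine mul_le_mul_of_nonneg_left ?_ hK.le
    have := mul_le_mul_of_nonneg_right hr1 he
    linarith
  · refine (mul_le_mul_of_nonneg_left h hr).trans ?_
    rw [show r * (K * r * Real.exp (-(κ * (r - |r₀|) ^ 2)))
      = K * (r ^ 2 * Real.exp (-(κ * (r - |r₀|) ^ 2))) by ring, gaussBound]
    refine mul_le_mul_of_nonneg_left ?_ hK.le
    nlinarith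

lemma isDominated (hg : IsPolarKernel g) (hρ : Continuous ρ) (hψ : Continuous ψ) :
    IsDominated ρ fun x y => g y.1 (ρ x) (y.2 - ψ x) where
  contAmp := hρ
  cont := hg.continuous_comp hρ hψ
  bound := by
    obtain ⟨C, κ, hC, hκ, hb⟩ := hg.le_gaussBound
    refine ⟨C, κ, hC, hκ, fun x y hy => ?_⟩
    rw [abs_of_nonneg (hg.nonneg _ _ _ hy)]
    exact (hb _ _ _ hy).2.1

lemma isDominated_fst_mul (hg : IsPolarKernel g) (hρ : Continuous ρ) (hψ : Continuous ψ) :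
    IsDominated ρ fun x y => y.1 * g y.1 (ρ x) (y.2 - ψ x) where
  contAmp := hρ
  cont := Continuous.mul (by fun_prop) (hg.continuous_comp hρ hψ)
  bound := by
    obtain ⟨C, κ, hC, hκ, hb⟩ := hg.le_gaussBound
    refine ⟨C, κ, hC, hκ, fun x y hy => ?_⟩
    rw [abs_of_nonneg (mul_nonneg hy (hg.nonneg _ _ _ hy))]
    exact (hb _ _ _ hy).2.2

/-- The summand `e^{-r}` of `gaussBound` is present for this case: it is the remainder in
`abs_negMulLog_le`. -/
lemma isDominated_negMulLog (hg : IsPolarKernel g) (hρ : Continuous ρ) (hψ : Continuous ψ) :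
    IsDominated ρ fun x y => Real.negMulLog (g y.1 (ρ x) (y.2 - ψ x)) where
  contAmp := hρ
  cont := Real.continuous_negMulLog.comp (hg.continuous_comp hρ hψ)
  bound := by
    obtain ⟨C, κ, hC, hκ, hb⟩ := hg.le_gaussBound
    refine ⟨(1 + C) * C + 1, κ, by positivity, hκ, fun x y hy => ?_⟩
    refine (abs_negMulLog_le (hg.nonneg _ _ _ hy) hy hC.le (hb _ _ _ hy).1).trans ?_
    have h1 := mul_le_mul_of_nonneg_left (hb y.1 (ρ x) (y.2 - ψ x) hy).2.2
      (by positivity : 0 ≤ 1 + C)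
    have h2 : Real.exp (-y.1) ≤ gaussBound κ (ρ x) y.1 :=
      le_add_of_nonneg_left (by positivity)
    linarith

end IsPolarKernel

/-- The density of the output law with respect to `polarMeasure`. -/
def outDensity (γ σ L w τ : ℝ) (μ : Measure (ℝ × ℝ)) (y : ℝ × ℝ) : ℝ :=
  ∫ x, condPdf γ σ L w τ y x ∂μ

/-- The entropy of the output for a deterministic input of amplitude `r₀`. -/
def pointEntropy (γ σ L w r₀ : ℝ) : ℝ :=
  ∫ r in Ici (0 : ℝ), ∫ θ in (0 : ℝ)..2 * Real.pi,
    Real.negMulLog (harmonicKernel γ σ L w r r₀ θ)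

variable {γ σ L w τ : ℝ}

lemma condPdf_eq (y x : ℝ × ℝ) : condPdf γ σ L w τ y x
    = harmonicKernel γ σ L w y.1 x.1 (y.2 - (x.2 + τ * x.1 ^ 2)) := by
  rw [← sub_sub]; rfl

lemma isDominated_condPdf (hg : IsPolarKernel (harmonicKernel γ σ L w)) :
    IsDominated (fun x : ℝ × ℝ => x.1) fun x y => condPdf γ σ L w τ y x := by
  simp_rw [condPdf_eq]
  exact hg.isDominated (ψ := fun x : ℝ × ℝ => x.2 + τ * x.1 ^ 2) (by fun_prop) (by fun_prop)

lemma isDominated_fst_mul_condPdf (hg : IsPolarKernel (harmonicKernel γ σ L w)) :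
    IsDominated (fun x : ℝ × ℝ => x.1) fun x y => y.1 * condPdf γ σ L w τ y x := by
  simp_rw [condPdf_eq]
  exact hg.isDominated_fst_mul (ψ := fun x : ℝ × ℝ => x.2 + τ * x.1 ^ 2) (by fun_prop)
    (by fun_prop)

lemma isDominated_negMulLog_condPdf (hg : IsPolarKernel (harmonicKernel γ σ L w)) :
    IsDominated (fun x : ℝ × ℝ => x.1) fun x y => Real.negMulLog (condPdf γ σ L w τ y x) := by
  simp_rw [condPdf_eq]
  exact hg.isDominated_negMulLog (ψ := fun x : ℝ × ℝ => x.2 + τ * x.1 ^ 2) (by fun_prop)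
    (by fun_prop)

lemma condPdf_nonneg (hg : IsPolarKernel (harmonicKernel γ σ L w)) {y : ℝ × ℝ} (hy : 0 ≤ y.1)
    (x : ℝ × ℝ) : 0 ≤ condPdf γ σ L w τ y x := by
  rw [condPdf_eq]
  exact hg.nonneg _ _ _ hy

lemma measurable_condPdf (hg : IsPolarKernel (harmonicKernel γ σ L w)) :
    Measurable fun z : (ℝ × ℝ) × (ℝ × ℝ) => condPdf γ σ L w τ z.2 z.1 :=
  (isDominated_condPdf hg).cont.measurable

lemma integral_condPdf (hg : IsPolarKernel (harmonicKernel γ σ L w)) (x : ℝ × ℝ) :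
    ∫ y, condPdf γ σ L w τ y x ∂polarMeasure = 1 := by
  have hi := (isDominated_condPdf (τ := τ) hg).integrable x
  simp_rw [condPdf_eq] at hi ⊢
  rw [integral_polarMeasure_of_periodic (h := fun r θ => harmonicKernel γ σ L w r x.1 θ)
    (fun r => hg.periodic r x.1) _ hi]
  exact hg.total x.1

lemma lintegral_condPdf (hg : IsPolarKernel (harmonicKernel γ σ L w)) (x : ℝ × ℝ) :
    ∫⁻ y, ENNReal.ofReal (condPdf γ σ L w τ y x) ∂polarMeasure = 1 := by
  rw [← ofReal_integral_eq_lintegral_ofReal ((isDominated_condPdf hg).integrable x),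
    integral_condPdf hg, ENNReal.ofReal_one]
  filter_upwards [ae_polarMeasure_nonneg] with y hy using condPdf_nonneg hg hy x

/-- The input phase and the shift `τ r₀²` only rotate the conditional law. The conditional entropy
is therefore a function of the input amplitude, and the phase law can affect mutual information only
through the output entropy. -/
lemma integral_negMulLog_condPdf (hg : IsPolarKernel (harmonicKernel γ σ L w)) (x : ℝ × ℝ) :
    ∫ y, Real.negMulLog (condPdf γ σ L w τ y x) ∂polarMeasure = pointEntropy γ σ L w x.1 := by
  have hi := (isDominated_negMulLog_condPdf (τ := τ) hg).integrable x
  simp_rw [condPdf_eq] at hi ⊢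
  rw [integral_polarMeasure_of_periodic
    (h := fun r θ => Real.negMulLog (harmonicKernel γ σ L w r x.1 θ))
    (fun r θ => by simp only [hg.periodic r x.1 θ]) _ hi]
  rfl

lemma continuous_pointEntropy (hg : IsPolarKernel (harmonicKernel γ σ L w)) :
    Continuous (pointEntropy γ σ L w) := by
  have h := (isDominated_negMulLog_condPdf (τ := 0) hg).continuous_integral
  simp_rw [integral_negMulLog_condPdf hg] at h
  exact h.comp (f := fun r : ℝ => (r, (0 : ℝ))) (by fun_prop)

lemma abs_pointEntropy_le (hg : IsPolarKernel (harmonicKernel γ σ L w)) :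
    ∃ C : ℝ, 0 < C ∧ ∀ r₀, |pointEntropy γ σ L w r₀| ≤ C * (1 + r₀ ^ 2) := by
  obtain ⟨C, hC, h⟩ := (isDominated_negMulLog_condPdf (τ := 0) hg).abs_integral_le
  simp_rw [integral_negMulLog_condPdf hg] at h
  exact ⟨C, hC, fun r => h (r, 0)⟩

lemma integrable_condPdf_left (hg : IsPolarKernel (harmonicKernel γ σ L w))
    (μ : Measure (ℝ × ℝ)) [IsFiniteMeasure μ] {y : ℝ × ℝ} (hy : 0 ≤ y.1) :
    Integrable (fun x => condPdf γ σ L w τ y x) μ := by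
  obtain ⟨C, κ, hC, hκ, hb⟩ := hg.le_gaussBound
  refine (integrable_const (C * y.1)).mono' ((isDominated_condPdf hg).cont.comp
    (f := fun x : ℝ × ℝ => (x, y)) (by fun_prop)).aestronglyMeasurable (ae_of_all _ fun x => ?_)
  rw [Real.norm_of_nonneg (condPdf_nonneg hg hy x), condPdf_eq]
  exact (hb _ _ _ hy).1

/-! ### The output law -/

lemma measurable_outDensity (hg : IsPolarKernel (harmonicKernel γ σ L w))
    (μ : Measure (ℝ × ℝ)) [IsFiniteMeasure μ] : Measurable (outDensity γ σ L w τ μ) :=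
  ((measurable_condPdf hg).stronglyMeasurable.integral_prod_left').measurable

lemma outDensity_nonneg (hg : IsPolarKernel (harmonicKernel γ σ L w)) (μ : Measure (ℝ × ℝ))
    {y : ℝ × ℝ} (hy : 0 ≤ y.1) : 0 ≤ outDensity γ σ L w τ μ y :=
  integral_nonneg fun x => condPdf_nonneg hg hy x

lemma outDensity_le (hg : IsPolarKernel (harmonicKernel γ σ L w)) :
    ∃ C : ℝ, 0 < C ∧ ∀ (μ : Measure (ℝ × ℝ)) [IsProbabilityMeasure μ] (y : ℝ × ℝ), 0 ≤ y.1 →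
      outDensity γ σ L w τ μ y ≤ C * y.1 := by
  obtain ⟨C, κ, hC, hκ, hb⟩ := hg.le_gaussBound
  refine ⟨C, hC, fun μ _ y hy => ?_⟩
  refine (integral_mono (integrable_condPdf_left hg μ hy) (integrable_const (C * y.1)) fun x => ?_).trans ?_
  · simp only [condPdf_eq]
    exact (hb _ _ _ hy).1
  · simp

lemma lintegral_ofReal_condPdf_left (hg : IsPolarKernel (harmonicKernel γ σ L w))
    (μ : Measure (ℝ × ℝ)) [IsFiniteMeasure μ] {y : ℝ × ℝ} (hy : 0 ≤ y.1) :
    ∫⁻ x, ENNReal.ofReal (condPdf γ σ L w τ y x) ∂μ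
      = ENNReal.ofReal (outDensity γ σ L w τ μ y) := by
  rw [outDensity, ofReal_integral_eq_lintegral_ofReal (integrable_condPdf_left hg μ hy)]
  exact ae_of_all _ fun x => condPdf_nonneg hg hy x

lemma jointLaw_fst (hg : IsPolarKernel (harmonicKernel γ σ L w)) (μ : Measure (ℝ × ℝ))
    [IsFiniteMeasure μ] : (jointLaw γ σ L w τ μ).fst = μ := by
  have hm := (measurable_condPdf (τ := τ) hg).ennreal_ofReal
  ext s hs
  rw [Measure.fst_apply hs, jointLaw, withDensity_apply _ (measurable_fst hs), ← prod_univ,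
    ← Measure.prod_restrict, Measure.restrict_univ, lintegral_prod _ hm.aemeasurable]
  simp_rw [lintegral_condPdf hg]
  simp

lemma outputLaw_eq (hg : IsPolarKernel (harmonicKernel γ σ L w)) (μ : Measure (ℝ × ℝ))
    [IsFiniteMeasure μ] : outputLaw γ σ L w τ μ
      = polarMeasure.withDensity fun y => ENNReal.ofReal (outDensity γ σ L w τ μ y) := by
  have hm := (measurable_condPdf (τ := τ) hg).ennreal_ofReal
  ext s hs
  rw [outputLaw, Measure.snd_apply hs, jointLaw, withDensity_apply _ (measurable_snd hs),
    ← univ_prod, ← Measure.prod_restrict, Measure.restrict_univ, lintegral_prod_symm' _ hm,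
    withDensity_apply _ hs]
  refine lintegral_congr_ae (ae_restrict_of_ae ?_)
  filter_upwards [ae_polarMeasure_nonneg] with y hy
  exact lintegral_ofReal_condPdf_left hg μ hy

lemma integrable_outDensity (hg : IsPolarKernel (harmonicKernel γ σ L w)) (μ : Measure (ℝ × ℝ))
    [IsFiniteMeasure μ] (hμ : Integrable (fun x => x.1 ^ 2) μ) :
    Integrable (outDensity γ σ L w τ μ) polarMeasure :=
  ((isDominated_condPdf hg).integrable_prod μ hμ).integral_prod_right

lemma integral_outDensity (hg : IsPolarKernel (harmonicKernel γ σ L w)) (μ : Measure (ℝ × ℝ))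
    [IsProbabilityMeasure μ] (hμ : Integrable (fun x => x.1 ^ 2) μ) :
    ∫ y, outDensity γ σ L w τ μ y ∂polarMeasure = 1 := by
  have hi := (isDominated_condPdf (τ := τ) hg).integrable_prod μ hμ
  have h1 := integral_prod_symm _ hi
  have h2 := integral_prod _ hi
  simp_rw [integral_condPdf hg] at h2
  simp only [outDensity]
  rw [← h1, h2]
  simp

lemma integrable_fst_mul_outDensity (hg : IsPolarKernel (harmonicKernel γ σ L w))
    (μ : Measure (ℝ × ℝ)) [IsFiniteMeasure μ] (hμ : Integrable (fun x => x.1 ^ 2) μ) :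
    Integrable (fun y => y.1 * outDensity γ σ L w τ μ y) polarMeasure := by
  have h := ((isDominated_fst_mul_condPdf (τ := τ) hg).integrable_prod μ hμ).integral_prod_right
  simp only [integral_const_mul] at h
  exact h

lemma integrable_exp_neg_fst : Integrable (fun y : ℝ × ℝ => Real.exp (-y.1)) polarMeasure :=
  integrable_comp_fst_polarMeasure integrableOn_exp_neg

lemma integrable_negMulLog_outDensity (hg : IsPolarKernel (harmonicKernel γ σ L w))
    (μ : Measure (ℝ × ℝ)) [IsProbabilityMeasure μ] (hμ : Integrable (fun x => x.1 ^ 2) μ) :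
    Integrable (fun y => Real.negMulLog (outDensity γ σ L w τ μ y)) polarMeasure := by
  obtain ⟨C, hC, hb⟩ := outDensity_le (τ := τ) hg
  refine (((integrable_fst_mul_outDensity (τ := τ) hg μ hμ).const_mul (1 + C)).add
    integrable_exp_neg_fst).mono' (Real.continuous_negMulLog.measurable.comp
      (measurable_outDensity hg μ)).aestronglyMeasurable ?_
  filter_upwards [ae_polarMeasure_nonneg] with y hy
  exact abs_negMulLog_le (outDensity_nonneg hg μ hy) hy hC.le (hb μ y hy)

/-- For fixed output, a nonnegative function of the input with zero mean vanishes almost everywhere;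
Fubini gives the joint statement, the absolute continuity needed for the divergence. -/
lemma ae_outDensity_eq_zero (hg : IsPolarKernel (harmonicKernel γ σ L w))
    (μ : Measure (ℝ × ℝ)) [IsFiniteMeasure μ] :
    ∀ᵐ z ∂μ.prod polarMeasure, outDensity γ σ L w τ μ z.2 = 0 → condPdf γ σ L w τ z.2 z.1 = 0 := by
  have hm := measurable_condPdf (τ := τ) hg
  have hq := measurable_outDensity (τ := τ) hg μ
  have hs : MeasurableSet {z : (ℝ × ℝ) × (ℝ × ℝ) |
      ¬ (outDensity γ σ L w τ μ z.2 = 0 → condPdf γ σ L w τ z.2 z.1 = 0)} := by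
    have : {z : (ℝ × ℝ) × (ℝ × ℝ) |
        ¬ (outDensity γ σ L w τ μ z.2 = 0 → condPdf γ σ L w τ z.2 z.1 = 0)}
        = {z | outDensity γ σ L w τ μ z.2 = 0} ∩ {z | condPdf γ σ L w τ z.2 z.1 = 0}ᶜ := by
      ext z; simp
    rw [this]
    exact (measurableSet_eq_fun (hq.comp measurable_snd) measurable_const).inter
      (measurableSet_eq_fun hm measurable_const).compl
  rw [ae_iff, Measure.prod_apply_symm hs, lintegral_eq_zero_iff (measurable_measure_prodMk_right hs)]
  filter_upwards [ae_polarMeasure_nonneg] with y hy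
  by_cases h0 : outDensity γ σ L w τ μ y = 0
  · have := (integral_eq_zero_iff_of_nonneg (fun x => condPdf_nonneg hg hy x)
      (integrable_condPdf_left (τ := τ) hg μ hy)).1 h0
    simpa [h0] using ae_iff.1 this
  · simp [h0]

/-- The mutual information is the difference of the output entropy and the conditional entropy. -/
theorem mutualInfo_jointLaw (hg : IsPolarKernel (harmonicKernel γ σ L w)) (μ : Measure (ℝ × ℝ))
    [IsProbabilityMeasure μ] (hμ : Integrable (fun x => x.1 ^ 2) μ) :
    mutualInfo (jointLaw γ σ L w τ μ)
      = ENNReal.ofReal (∫ y, Real.negMulLog (outDensity γ σ L w τ μ y) ∂polarMeasure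
          - ∫ x, pointEntropy γ σ L w x.1 ∂μ) ∧
    0 ≤ ∫ y, Real.negMulLog (outDensity γ σ L w τ μ y) ∂polarMeasure
          - ∫ x, pointEntropy γ σ L w x.1 ∂μ := by
  have hm := measurable_condPdf (τ := τ) hg
  have hq := measurable_outDensity (τ := τ) hg μ
  have hnn : ∀ᵐ z ∂μ.prod polarMeasure, 0 ≤ z.2.1 :=
    Measure.quasiMeasurePreserving_snd.ae ae_polarMeasure_nonneg
  have hnnl : ∀ᵐ z ∂μ.prod polarMeasure, 0 ≤ condPdf γ σ L w τ z.2 z.1 := by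
    filter_upwards [hnn] with z hz using condPdf_nonneg hg hz _
  have hnnq : ∀ᵐ z ∂μ.prod polarMeasure, 0 ≤ outDensity γ σ L w τ μ z.2 := by
    filter_upwards [hnn] with z hz using outDensity_nonneg hg μ hz
  have hi := (isDominated_condPdf (τ := τ) hg).integrable_prod μ hμ
  have hiq := integrable_outDensity (τ := τ) hg μ hμ
  have hmass : ∫ z, condPdf γ σ L w τ z.2 z.1 ∂μ.prod polarMeasure
      = ∫ z, outDensity γ σ L w τ μ z.2 ∂μ.prod polarMeasure := by
    rw [integral_prod _ hi, integral_fun_snd]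
    simp_rw [integral_condPdf hg]
    rw [integral_outDensity hg μ hμ]
    simp
  have hent := (isDominated_negMulLog_condPdf (τ := τ) hg).integrable_prod μ hμ
  have hlf : Integrable (fun z : (ℝ × ℝ) × (ℝ × ℝ) =>
      condPdf γ σ L w τ z.2 z.1 * Real.log (condPdf γ σ L w τ z.2 z.1)) (μ.prod polarMeasure) := by
    refine hent.neg.congr (ae_of_all _ fun z => ?_)
    simp [Real.negMulLog]
  have hlf_val : ∫ z, condPdf γ σ L w τ z.2 z.1 * Real.log (condPdf γ σ L w τ z.2 z.1)
      ∂μ.prod polarMeasure = - ∫ x, pointEntropy γ σ L w x.1 ∂μ := by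
    have h1 := integral_prod _ hent
    simp_rw [integral_negMulLog_condPdf hg] at h1
    rw [← h1, ← integral_neg]
    simp [Real.negMulLog]
  have hentq := integrable_negMulLog_outDensity (τ := τ) hg μ hμ
  -- Integrating the modulus of the cross term over the input first gives `|q log q|` for the output
  -- density `q`, already known to be integrable.
  have hlg : Integrable (fun z : (ℝ × ℝ) × (ℝ × ℝ) =>
      condPdf γ σ L w τ z.2 z.1 * Real.log (outDensity γ σ L w τ μ z.2)) (μ.prod polarMeasure) := by
    have hpm : Measurable fun z : (ℝ × ℝ) × (ℝ × ℝ) =>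
        condPdf γ σ L w τ z.2 z.1 * Real.log (outDensity γ σ L w τ μ z.2) :=
      hm.mul (Real.measurable_log.comp (hq.comp measurable_snd))
    rw [integrable_prod_iff' hpm.aestronglyMeasurable]
    constructor
    · filter_upwards [ae_polarMeasure_nonneg] with y hy
      exact (integrable_condPdf_left hg μ hy).mul_const _
    · refine hentq.norm.congr ?_
      filter_upwards [ae_polarMeasure_nonneg] with y hy
      simp only [norm_mul]
      rw [integral_mul_const, Real.negMulLog, norm_mul, norm_neg,
        Real.norm_of_nonneg (outDensity_nonneg hg μ hy)]
      congr 1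
      rw [outDensity]
      refine integral_congr_ae (ae_of_all _ fun x => ?_)
      exact (Real.norm_of_nonneg (condPdf_nonneg hg hy x)).symm
  have hlg_val : ∫ z, condPdf γ σ L w τ z.2 z.1 * Real.log (outDensity γ σ L w τ μ z.2)
      ∂μ.prod polarMeasure
      = - ∫ y, Real.negMulLog (outDensity γ σ L w τ μ y) ∂polarMeasure := by
    rw [integral_prod_symm _ hlg, ← integral_neg]
    refine integral_congr_ae (ae_of_all _ fun y => ?_)
    simp only [integral_mul_const, Real.negMulLog]
    rw [← outDensity]
    ring
  have h := klDiv_withDensity hm (hq.comp measurable_snd) hnnl hnnq hi (hiq.comp_snd μ) hmass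
    (ae_outDensity_eq_zero hg μ) hlf hlg
  simp only [Function.comp_apply] at h
  rw [hlf_val, hlg_val, neg_sub_neg] at h
  refine ⟨?_, h.2⟩
  rw [mutualInfo, jointLaw_fst hg, ← outputLaw, outputLaw_eq hg,
    prod_withDensity_right (by fun_prop)]
  exact h.1

end

section

/-! ### The amplitude of the output -/

/-- The density of the output amplitude given the input amplitude. -/
def ampDensity (γ σ L w r s : ℝ) : ℝ :=
  ∫ θ in (0 : ℝ)..2 * Real.pi, harmonicKernel γ σ L w r s θ

/-- The density of the output amplitude for the law `ν` of the input amplitude. -/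
def ampMarginal (γ σ L w : ℝ) (ν : Measure ℝ) (r : ℝ) : ℝ :=
  ∫ s, ampDensity γ σ L w r s ∂ν

variable {γ σ L w τ : ℝ}

lemma integral_Ico_periodic {h : ℝ → ℝ} (hh : Function.Periodic h (2 * Real.pi)) (c : ℝ) :
    ∫ θ in Ico 0 (2 * Real.pi), h (θ - c) = ∫ θ in (0 : ℝ)..2 * Real.pi, h θ := by
  have h2pi : (0 : ℝ) ≤ 2 * Real.pi := by positivity
  rw [integral_Ico_eq_integral_Ioc, ← intervalIntegral.integral_of_le h2pi,
    intervalIntegral.integral_comp_sub_right h c]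
  have := hh.intervalIntegral_add_eq (0 - c) 0
  rwa [zero_add, show 0 - c + 2 * Real.pi = 2 * Real.pi - c by ring] at this

lemma integral_Ico_periodic_sub_left {h : ℝ → ℝ} (hh : Function.Periodic h (2 * Real.pi))
    (c : ℝ) : ∫ θ in Ico 0 (2 * Real.pi), h (c - θ) = ∫ θ in (0 : ℝ)..2 * Real.pi, h θ := by
  have h2pi : (0 : ℝ) ≤ 2 * Real.pi := by positivity
  rw [integral_Ico_eq_integral_Ioc, ← intervalIntegral.integral_of_le h2pi,
    intervalIntegral.integral_comp_sub_left h c]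
  have := hh.intervalIntegral_add_eq (c - 2 * Real.pi) 0
  rwa [zero_add, sub_add_cancel, ← sub_zero c, sub_sub, zero_add] at this

lemma continuous_ampDensity (hg : IsPolarKernel (harmonicKernel γ σ L w)) :
    Continuous fun p : ℝ × ℝ => ampDensity γ σ L w p.1 p.2 :=
  intervalIntegral.continuous_parametric_intervalIntegral_of_continuous'
    (f := fun (p : ℝ × ℝ) θ => harmonicKernel γ σ L w p.1 p.2 θ)
    (hg.cont.comp (f := fun q : (ℝ × ℝ) × ℝ => (q.1.1, q.1.2, q.2)) (by fun_prop)) _ _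

lemma ampDensity_nonneg (hg : IsPolarKernel (harmonicKernel γ σ L w)) {r : ℝ} (hr : 0 ≤ r)
    (s : ℝ) : 0 ≤ ampDensity γ σ L w r s :=
  intervalIntegral.integral_nonneg (by positivity) fun θ _ => hg.nonneg r s θ hr

lemma ampDensity_le (hg : IsPolarKernel (harmonicKernel γ σ L w)) :
    ∃ C : ℝ, 0 < C ∧ ∀ r s : ℝ, 0 ≤ r → ampDensity γ σ L w r s ≤ C * r := by
  obtain ⟨C, κ, hC, hκ, hb⟩ := hg.le_gaussBound
  have hpi := Real.pi_pos
  refine ⟨2 * Real.pi * C, by positivity, fun r s hr => ?_⟩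
  have h := intervalIntegral.integral_mono_on (a := 0) (b := 2 * Real.pi)
    (f := fun θ => harmonicKernel γ σ L w r s θ) (g := fun _ => C * r) (μ := volume)
    (by positivity) ((hg.cont.comp (f := fun θ : ℝ => (r, s, θ)) (by fun_prop)).intervalIntegrable _ _)
    (by simp) fun θ _ => (hb r s θ hr).1
  refine h.trans_eq ?_
  rw [intervalIntegral.integral_const, smul_eq_mul]
  ring

lemma ampMarginal_nonneg (hg : IsPolarKernel (harmonicKernel γ σ L w)) (ν : Measure ℝ) {r : ℝ}
    (hr : 0 ≤ r) : 0 ≤ ampMarginal γ σ L w ν r :=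
  integral_nonneg fun s => ampDensity_nonneg hg hr s

lemma measurable_ampMarginal (hg : IsPolarKernel (harmonicKernel γ σ L w)) (ν : Measure ℝ)
    [IsFiniteMeasure ν] : Measurable (ampMarginal γ σ L w ν) :=
  ((continuous_ampDensity hg).stronglyMeasurable.integral_prod_right').measurable

/-! ### The uniform phase and its optimality -/

instance isProbabilityMeasure_uniformPhase : IsProbabilityMeasure uniformPhase := by
  constructor
  have hpi := Real.pi_pos
  rw [uniformPhase, Measure.smul_apply, Measure.restrict_apply_univ, Real.volume_Ico, sub_zero,
    smul_eq_mul]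
  exact ENNReal.inv_mul_cancel (by simpa using hpi) ENNReal.ofReal_ne_top

lemma integral_uniformPhase (f : ℝ → ℝ) :
    ∫ φ, f φ ∂uniformPhase = 1 / (2 * Real.pi) * ∫ φ in Ico 0 (2 * Real.pi), f φ := by
  have hpi := Real.pi_pos
  rw [uniformPhase, integral_smul_measure, ENNReal.toReal_inv, ENNReal.toReal_ofReal (by positivity),
    smul_eq_mul, one_div]

instance (ν : Measure ℝ) [IsProbabilityMeasure ν] : IsProbabilityMeasure (uniformPhaseInput ν) := by
  unfold uniformPhaseInput; infer_instance

lemma uniformPhaseInput_fst (ν : Measure ℝ) [IsProbabilityMeasure ν] :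
    (uniformPhaseInput ν).fst = ν := by
  rw [uniformPhaseInput, Measure.fst_prod]

lemma integral_comp_fst_eq (μ : Measure (ℝ × ℝ)) {f : ℝ → ℝ} (hf : Continuous f) :
    ∫ x, f x.1 ∂μ = ∫ s, f s ∂μ.fst := by
  rw [Measure.fst, integral_map measurable_fst.aemeasurable hf.aestronglyMeasurable]

lemma integrable_comp_fst_iff (μ : Measure (ℝ × ℝ)) {f : ℝ → ℝ} (hf : Continuous f) :
    Integrable (fun x => f x.1) μ ↔ Integrable f μ.fst := by
  rw [Measure.fst, integrable_map_measure hf.aestronglyMeasurable measurable_fst.aemeasurable]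
  rfl

/-- Integrating out the output phase erases the input phase, so the output amplitude law is
determined by the input amplitude law alone. -/
lemma integral_outDensity_angle (hg : IsPolarKernel (harmonicKernel γ σ L w))
    (μ : Measure (ℝ × ℝ)) [IsFiniteMeasure μ] {r : ℝ} (hr : 0 ≤ r) :
    ∫ θ in Ico 0 (2 * Real.pi), outDensity γ σ L w τ μ (r, θ) = ampMarginal γ σ L w μ.fst r := by
  obtain ⟨C, κ, hC, hκ, hb⟩ := hg.le_gaussBound
  have hi : Integrable (Function.uncurry fun (θ : ℝ) (x : ℝ × ℝ) => condPdf γ σ L w τ (r, θ) x)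
      ((volume.restrict (Ico 0 (2 * Real.pi))).prod μ) := by
    refine (integrable_const (C * r)).mono' ((isDominated_condPdf hg).cont.comp
      (f := fun z : ℝ × (ℝ × ℝ) => (z.2, (r, z.1))) (by fun_prop)).aestronglyMeasurable
      (ae_of_all _ fun z => ?_)
    simp only [Function.uncurry]
    rw [Real.norm_of_nonneg (condPdf_nonneg hg hr _), condPdf_eq]
    exact (hb _ _ _ hr).1
  simp only [outDensity]
  rw [integral_integral_swap hi, ampMarginal, ← integral_comp_fst_eq μ
    (f := fun s => ampDensity γ σ L w r s) ((continuous_ampDensity hg).comp (f := fun s : ℝ => (r, s)) (by fun_prop))]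
  refine integral_congr_ae (ae_of_all _ fun x => ?_)
  simp only [condPdf_eq]
  exact integral_Ico_periodic (hg.periodic r x.1) _

/-- Averaging over a uniform input phase runs the periodic kernel through a full period, whatever
the output phase and the shift `τ s²`; the output phase becomes uniform and independent of the
amplitude. -/
lemma outDensity_uniformPhaseInput (hg : IsPolarKernel (harmonicKernel γ σ L w)) (ν : Measure ℝ)
    [IsProbabilityMeasure ν] {y : ℝ × ℝ} (hy : 0 ≤ y.1) :
    outDensity γ σ L w τ (uniformPhaseInput ν) y
      = 1 / (2 * Real.pi) * ampMarginal γ σ L w ν y.1 := by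
  have hi := integrable_condPdf_left (τ := τ) hg (uniformPhaseInput ν) hy
  rw [outDensity, uniformPhaseInput, integral_prod _ hi, ampMarginal, ← integral_const_mul]
  refine integral_congr_ae (ae_of_all _ fun s => ?_)
  simp only [integral_uniformPhase, condPdf_eq]
  rw [ampDensity, ← integral_Ico_periodic_sub_left (hg.periodic y.1 s) (y.2 - τ * s ^ 2)]
  congr 2
  ext φ
  congr 1
  ring

lemma integrableOn_of_comp_fst {f : ℝ → ℝ}
    (hf : Integrable (fun y : ℝ × ℝ => f y.1) polarMeasure) : IntegrableOn f (Ici 0) := by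
  rw [polarMeasure_eq_prod] at hf
  have h := hf.prod_left_ae
  have hne : (ae (volume.restrict (Ico (0 : ℝ) (2 * Real.pi)))).NeBot := by
    rw [ae_neBot, Ne, Measure.restrict_eq_zero, Real.volume_Ico, sub_zero]
    simp [Real.pi_pos]
  exact h.exists.choose_spec

lemma integrable_uniformPhaseInput {ν : Measure ℝ} [IsProbabilityMeasure ν]
    (hν : Integrable (fun s => s ^ 2) ν) :
    Integrable (fun x : ℝ × ℝ => x.1 ^ 2) (uniformPhaseInput ν) := by
  rw [integrable_comp_fst_iff _ (f := fun s => s ^ 2) (by fun_prop), uniformPhaseInput_fst]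
  exact hν

lemma outDensity_uniformPhaseInput_ae (hg : IsPolarKernel (harmonicKernel γ σ L w))
    (ν : Measure ℝ) [IsProbabilityMeasure ν] :
    outDensity γ σ L w τ (uniformPhaseInput ν) =ᵐ[polarMeasure]
      fun y => 1 / (2 * Real.pi) * ampMarginal γ σ L w ν y.1 := by
  filter_upwards [ae_polarMeasure_nonneg] with y hy using outDensity_uniformPhaseInput hg ν hy

lemma integrableOn_ampMarginal (hg : IsPolarKernel (harmonicKernel γ σ L w)) (ν : Measure ℝ)
    [IsProbabilityMeasure ν] (hν : Integrable (fun s => s ^ 2) ν) :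
    IntegrableOn (ampMarginal γ σ L w ν) (Ici 0) := by
  have hpi := Real.pi_pos
  have h := (integrable_outDensity (τ := 0) hg _ (integrable_uniformPhaseInput hν)).congr
    (outDensity_uniformPhaseInput_ae hg ν)
  refine ((integrableOn_of_comp_fst (f := fun r => 1 / (2 * Real.pi) * ampMarginal γ σ L w ν r)
    h).const_mul (2 * Real.pi)).congr (ae_of_all _ fun r => ?_)
  simp only
  field_simp

lemma integral_ampMarginal (hg : IsPolarKernel (harmonicKernel γ σ L w)) (ν : Measure ℝ)
    [IsProbabilityMeasure ν] (hν : Integrable (fun s => s ^ 2) ν) :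
    ∫ r in Ici (0 : ℝ), ampMarginal γ σ L w ν r = 1 := by
  have hpi := Real.pi_pos
  have h := integral_outDensity (τ := 0) hg _ (integrable_uniformPhaseInput hν)
  rw [integral_congr_ae (outDensity_uniformPhaseInput_ae hg ν),
    integral_comp_fst_polarMeasure (fun r => 1 / (2 * Real.pi) * ampMarginal γ σ L w ν r),
    integral_const_mul] at h
  field_simp at h
  exact h

lemma negMulLog_div_two_pi (t : ℝ) : Real.negMulLog (1 / (2 * Real.pi) * t)
    = 1 / (2 * Real.pi) * (Real.negMulLog t + Real.log (2 * Real.pi) * t) := by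
  rw [Real.negMulLog_mul, Real.negMulLog, one_div, Real.log_inv]
  ring

lemma integrableOn_negMulLog_ampMarginal (hg : IsPolarKernel (harmonicKernel γ σ L w))
    (ν : Measure ℝ) [IsProbabilityMeasure ν] (hν : Integrable (fun s => s ^ 2) ν) :
    IntegrableOn (fun r => Real.negMulLog (ampMarginal γ σ L w ν r)) (Ici 0) := by
  have hpi := Real.pi_pos
  have h := (integrable_negMulLog_outDensity (τ := 0) hg _ (integrable_uniformPhaseInput hν)).congr
    ((outDensity_uniformPhaseInput_ae hg ν).fun_comp Real.negMulLog)
  refine (((integrableOn_of_comp_fst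
    (f := fun r => Real.negMulLog (1 / (2 * Real.pi) * ampMarginal γ σ L w ν r))
    h).const_mul (2 * Real.pi)).sub ((integrableOn_ampMarginal hg ν hν).const_mul
      (Real.log (2 * Real.pi)))).congr (ae_of_all _ fun r => ?_)
  simp only [negMulLog_div_two_pi, Pi.sub_apply]
  field_simp
  ring

lemma mul_log_div_two_pi (t : ℝ) : t * Real.log (1 / (2 * Real.pi) * t)
    = -(Real.negMulLog t + Real.log (2 * Real.pi) * t) := by
  have hpi := Real.pi_pos
  have h := negMulLog_div_two_pi t
  rw [Real.negMulLog] at h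
  field_simp at h
  field_simp
  linarith

/-- For a uniform phase, the output entropy is `h(R) + log (2 π)`. -/
lemma integral_negMulLog_outDensity_uniformPhaseInput
    (hg : IsPolarKernel (harmonicKernel γ σ L w)) (ν : Measure ℝ) [IsProbabilityMeasure ν]
    (hν : Integrable (fun s => s ^ 2) ν) :
    ∫ y, Real.negMulLog (outDensity γ σ L w τ (uniformPhaseInput ν) y) ∂polarMeasure
      = (∫ r in Ici (0 : ℝ), Real.negMulLog (ampMarginal γ σ L w ν r)) + Real.log (2 * Real.pi) := by
  have hpi := Real.pi_pos
  have e : ∫ y, Real.negMulLog (outDensity γ σ L w τ (uniformPhaseInput ν) y) ∂polarMeasure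
      = ∫ y : ℝ × ℝ, Real.negMulLog (1 / (2 * Real.pi) * ampMarginal γ σ L w ν y.1)
        ∂polarMeasure :=
    integral_congr_ae ((outDensity_uniformPhaseInput_ae (τ := τ) hg ν).fun_comp Real.negMulLog)
  rw [e, integral_comp_fst_polarMeasure
    (fun r => Real.negMulLog (1 / (2 * Real.pi) * ampMarginal γ σ L w ν r))]
  simp_rw [negMulLog_div_two_pi]
  rw [integral_const_mul, integral_add (integrableOn_negMulLog_ampMarginal hg ν hν)
    ((integrableOn_ampMarginal hg ν hν).const_mul _), integral_const_mul,
    integral_ampMarginal hg ν hν]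
  field_simp

/-- Among all inputs with a given amplitude law, the uniform phase maximizes the output entropy. -/
lemma integral_negMulLog_outDensity_le (hg : IsPolarKernel (harmonicKernel γ σ L w))
    (μ : Measure (ℝ × ℝ)) [IsProbabilityMeasure μ] (hμ : Integrable (fun x => x.1 ^ 2) μ) :
    ∫ y, Real.negMulLog (outDensity γ σ L w τ μ y) ∂polarMeasure
      ≤ (∫ r in Ici (0 : ℝ), Real.negMulLog (ampMarginal γ σ L w μ.fst r))
        + Real.log (2 * Real.pi) := by
  have hpi := Real.pi_pos
  have hν : Integrable (fun s => s ^ 2) μ.fst :=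
    (integrable_comp_fst_iff μ (f := fun s => s ^ 2) (by fun_prop)).1 hμ
  obtain ⟨C, hC, hb⟩ := outDensity_le (τ := τ) hg
  set P := ampMarginal γ σ L w μ.fst with hPdef
  set q := outDensity γ σ L w τ μ with hqdef
  have hq : Measurable q := measurable_outDensity hg μ
  have hPm : Measurable P := measurable_ampMarginal hg μ.fst
  have hqr : ∀ r, 0 ≤ r → IntegrableOn (fun θ => q (r, θ)) (Ico 0 (2 * Real.pi)) := by
    intro r hr
    refine (integrable_const (C * r)).mono'
      (hq.comp (measurable_const.prodMk measurable_id)).aestronglyMeasurable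
      (ae_of_all _ fun θ => ?_)
    rw [Real.norm_of_nonneg (outDensity_nonneg hg μ hr)]
    exact hb μ _ hr
  have hP0 := integrableOn_ampMarginal hg μ.fst hν
  have hPent := integrableOn_negMulLog_ampMarginal hg μ.fst hν
  have hgi : Integrable (fun y : ℝ × ℝ => 1 / (2 * Real.pi) * P y.1) polarMeasure :=
    (integrable_comp_fst_polarMeasure hP0).const_mul _
  have hmass : ∫ y, q y ∂polarMeasure
      = ∫ y : ℝ × ℝ, 1 / (2 * Real.pi) * P y.1 ∂polarMeasure := by
    rw [integral_outDensity hg μ hμ, integral_const_mul, integral_comp_fst_polarMeasure,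
      integral_ampMarginal hg μ.fst hν]
    field_simp
  -- If the amplitude density vanishes at `r`, then so does `q (r, θ)` for almost every `θ`, since
  -- `q` is nonnegative with angular integral zero.
  have hac : ∀ᵐ y ∂polarMeasure, 1 / (2 * Real.pi) * P y.1 = 0 → q y = 0 := by
    have hs : MeasurableSet {y : ℝ × ℝ | ¬ (1 / (2 * Real.pi) * P y.1 = 0 → q y = 0)} := by
      have : {y : ℝ × ℝ | ¬ (1 / (2 * Real.pi) * P y.1 = 0 → q y = 0)}
          = {y | 1 / (2 * Real.pi) * P y.1 = 0} ∩ {y | q y = 0}ᶜ := by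
        ext z; simp
      rw [this]
      exact (measurableSet_eq_fun ((hPm.comp measurable_fst).const_mul _) measurable_const).inter
        (measurableSet_eq_fun hq measurable_const).compl
    rw [ae_iff, polarMeasure_eq_prod, Measure.measure_prod_null hs]
    filter_upwards [ae_restrict_mem measurableSet_Ici] with r hr
    by_cases h0 : P r = 0
    · have hPr := h0
      rw [hPdef, ← integral_outDensity_angle (τ := τ) hg μ hr] at hPr
      have := (integral_eq_zero_iff_of_nonneg
        (fun θ => outDensity_nonneg hg μ (y := (r, θ)) hr) (hqr r hr)).1 hPr
      simpa [h0, hqdef] using ae_iff.1 this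
    · simp [h0, hpi.ne']
  have hent := integrable_negMulLog_outDensity (τ := τ) hg μ hμ
  have hlf : Integrable (fun y => q y * Real.log (q y)) polarMeasure := by
    refine hent.neg.congr (ae_of_all _ fun y => ?_)
    simp [Real.negMulLog, hqdef]
  have hcross : IntegrableOn (fun r => P r * Real.log (1 / (2 * Real.pi) * P r)) (Ici 0) := by
    refine (hPent.add (hP0.const_mul (Real.log (2 * Real.pi)))).neg.congr
      (ae_of_all _ fun r => ?_)
    exact (mul_log_div_two_pi (P r)).symm
  have hlg : Integrable (fun y => q y * Real.log (1 / (2 * Real.pi) * P y.1)) polarMeasure := by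
    have hpm : Measurable fun y : ℝ × ℝ => q y * Real.log (1 / (2 * Real.pi) * P y.1) :=
      hq.mul (Real.measurable_log.comp ((hPm.comp measurable_fst).const_mul _))
    rw [polarMeasure_eq_prod, integrable_prod_iff hpm.aestronglyMeasurable]
    constructor
    · filter_upwards [ae_restrict_mem measurableSet_Ici] with r hr
      exact (hqr r hr).mul_const _
    · refine hcross.norm.congr ?_
      filter_upwards [ae_restrict_mem measurableSet_Ici] with r hr
      simp only [norm_mul]
      rw [integral_mul_const, Real.norm_of_nonneg (ampMarginal_nonneg hg μ.fst hr)]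
      congr 1
      rw [← integral_outDensity_angle (τ := τ) hg μ hr]
      exact integral_congr_ae (ae_of_all _ fun θ =>
        (Real.norm_of_nonneg (outDensity_nonneg hg μ (y := (r, θ)) hr)).symm)
  -- The logarithm depends on `r` only, so the angular integral turns `q` into `P` and the cross
  -- term is the same as for a uniform phase.
  have hlg_val : ∫ y, q y * Real.log (1 / (2 * Real.pi) * P y.1) ∂polarMeasure
      = ∫ r in Ici (0 : ℝ), P r * Real.log (1 / (2 * Real.pi) * P r) := by
    rw [polarMeasure_eq_prod] at hlg ⊢
    rw [integral_prod _ hlg]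
    refine setIntegral_congr_fun measurableSet_Ici fun r hr => ?_
    simp only [integral_mul_const]
    rw [hqdef, integral_outDensity_angle hg μ hr]
  have h := (klDiv_withDensity hq ((hPm.comp measurable_fst).const_mul _)
    (by filter_upwards [ae_polarMeasure_nonneg] with y hy using outDensity_nonneg hg μ hy)
    (by
      filter_upwards [ae_polarMeasure_nonneg] with y hy
      exact mul_nonneg (by positivity) (ampMarginal_nonneg hg μ.fst hy))
    (integrable_outDensity hg μ hμ) hgi hmass hac hlf hlg).2
  simp only [Function.comp_apply] at h
  rw [hlg_val] at h
  have e1 : ∫ y, q y * Real.log (q y) ∂polarMeasure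
      = - ∫ y, Real.negMulLog (q y) ∂polarMeasure := by
    rw [← integral_neg]
    simp [Real.negMulLog]
  have e2 : ∫ r in Ici (0 : ℝ), P r * Real.log (1 / (2 * Real.pi) * P r)
      = -((∫ r in Ici (0 : ℝ), Real.negMulLog (P r)) + Real.log (2 * Real.pi)) := by
    have hP1 := integral_ampMarginal hg μ.fst hν
    simp_rw [mul_log_div_two_pi]
    rw [integral_neg, integral_add hPent (hP0.const_mul _), integral_const_mul, hP1, mul_one]
  rw [e1, e2] at h
  linarith

/-- The mutual information for a uniform phase. -/
def phaseInfo (γ σ L w : ℝ) (ν : Measure ℝ) : ℝ :=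
  (∫ r in Ici (0 : ℝ), Real.negMulLog (ampMarginal γ σ L w ν r)) + Real.log (2 * Real.pi)
    - ∫ s, pointEntropy γ σ L w s ∂ν

theorem amplitudeInfo_eq (hg : IsPolarKernel (harmonicKernel γ σ L w)) (ν : Measure ℝ)
    [IsProbabilityMeasure ν] (hν : Integrable (fun s => s ^ 2) ν) :
    amplitudeInfo γ σ L w τ ν = ENNReal.ofReal (phaseInfo γ σ L w ν) ∧
      0 ≤ phaseInfo γ σ L w ν := by
  have h := mutualInfo_jointLaw (τ := τ) hg _ (integrable_uniformPhaseInput hν)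
  rw [integral_negMulLog_outDensity_uniformPhaseInput hg ν hν,
    integral_comp_fst_eq _ (continuous_pointEntropy hg), uniformPhaseInput_fst] at h
  exact h

theorem mutualInfo_le_amplitudeInfo (hg : IsPolarKernel (harmonicKernel γ σ L w))
    (μ : Measure (ℝ × ℝ)) [IsProbabilityMeasure μ] (hμ : Integrable (fun s => s ^ 2) μ.fst) :
    mutualInfo (jointLaw γ σ L w τ μ) ≤ amplitudeInfo γ σ L w τ μ.fst := by
  have hμ' : Integrable (fun x : ℝ × ℝ => x.1 ^ 2) μ :=
    (integrable_comp_fst_iff μ (f := fun s => s ^ 2) (by fun_prop)).2 hμ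
  rw [(mutualInfo_jointLaw hg μ hμ').1, (amplitudeInfo_eq hg μ.fst hμ).1,
    integral_comp_fst_eq _ (continuous_pointEntropy hg)]
  exact ENNReal.ofReal_le_ofReal (sub_le_sub_right (integral_negMulLog_outDensity_le hg μ hμ') _)

/-! ### Differential entropies -/

/-- The entropies are defined on the whole space; outside `D` the density is `0` and `negMulLog 0 =
0`, so only the integral over `D` remains. -/
lemma entropy_withDensity {α : Type*} [MeasureSpace α] [SigmaFinite (volume : Measure α)]
    {D : Set α} (hD : MeasurableSet D) {f : α → ℝ} (hf : Measurable f)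
    (hf0 : ∀ᵐ x ∂volume.restrict D, 0 ≤ f x)
    (hi : IntegrableOn (fun x => Real.negMulLog (f x)) D) :
    HasFiniteEntropy ((volume.restrict D).withDensity fun x => ENNReal.ofReal (f x)) ∧
    diffEntropy ((volume.restrict D).withDensity fun x => ENNReal.ofReal (f x))
      = ∫ x in D, Real.negMulLog (f x) := by
  have hP : (volume.restrict D).withDensity (fun x => ENNReal.ofReal (f x))
      = volume.withDensity (D.indicator fun x => ENNReal.ofReal (f x)) :=
    (withDensity_indicator hD _).symm
  have hrn : (fun x => Real.negMulLog (((volume.restrict D).withDensity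
      fun x => ENNReal.ofReal (f x)).rnDeriv volume x).toReal)
      =ᵐ[volume] D.indicator fun x => Real.negMulLog (f x) := by
    have h1 : ((volume.restrict D).withDensity fun x => ENNReal.ofReal (f x)).rnDeriv volume
        =ᵐ[volume] D.indicator fun x => ENNReal.ofReal (f x) := by
      rw [hP]
      exact Measure.rnDeriv_withDensity _ (hf.ennreal_ofReal.indicator hD)
    filter_upwards [h1, (ae_restrict_iff' hD).1 hf0] with x hx h0
    rw [hx]
    by_cases hxD : x ∈ D
    · simp [hxD, h0 hxD]
    · simp [hxD]
  refine ⟨⟨?_, ?_⟩, ?_⟩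
  · rw [hP]
    exact withDensity_absolutelyContinuous _ _
  · rw [integrable_congr hrn, integrable_indicator_iff hD]
    exact hi
  · rw [diffEntropy, integral_congr_ae hrn, integral_indicator hD]

lemma entropy_channelLaw (hg : IsPolarKernel (harmonicKernel γ σ L w)) (x : ℝ × ℝ) :
    HasFiniteEntropy (channelLaw γ σ L w τ x) ∧
      diffEntropy (channelLaw γ σ L w τ x) = pointEntropy γ σ L w x.1 := by
  have h := entropy_withDensity measurableSet_polarDomain
    (f := fun y => condPdf γ σ L w τ y x)
    ((measurable_condPdf hg).comp (measurable_const.prodMk measurable_id))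
    (by
      have := ae_polarMeasure_nonneg
      rw [polarMeasure] at this
      filter_upwards [this] with y hy using condPdf_nonneg hg hy x)
    ((isDominated_negMulLog_condPdf hg).integrable x)
  exact ⟨h.1, h.2.trans (integral_negMulLog_condPdf hg x)⟩

lemma outputLaw_fst (hg : IsPolarKernel (harmonicKernel γ σ L w)) (ν : Measure ℝ)
    [IsProbabilityMeasure ν] : (outputLaw γ σ L w τ (uniformPhaseInput ν)).fst
      = (volume.restrict (Ici 0)).withDensity
        fun r => ENNReal.ofReal (ampMarginal γ σ L w ν r) := by
  have hpi := Real.pi_pos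
  have hm : Measurable fun y : ℝ × ℝ =>
      ENNReal.ofReal (1 / (2 * Real.pi) * ampMarginal γ σ L w ν y.1) :=
    (((measurable_ampMarginal hg ν).comp measurable_fst).const_mul _).ennreal_ofReal
  ext s hs
  have he : (fun y => ENNReal.ofReal (outDensity γ σ L w τ (uniformPhaseInput ν) y))
      =ᵐ[polarMeasure] fun y => ENNReal.ofReal (1 / (2 * Real.pi) * ampMarginal γ σ L w ν y.1) :=
    (outDensity_uniformPhaseInput_ae hg ν).fun_comp ENNReal.ofReal
  rw [outputLaw_eq hg, withDensity_congr_ae he, Measure.fst_apply hs]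
  rw [withDensity_apply _ (measurable_fst hs), withDensity_apply _ hs, polarMeasure_eq_prod,
    ← prod_univ, ← Measure.prod_restrict, lintegral_prod _ hm.aemeasurable]
  refine lintegral_congr fun r => ?_
  simp only [Measure.restrict_univ]
  rw [lintegral_const, Measure.restrict_apply_univ, Real.volume_Ico, sub_zero,
    ← ENNReal.ofReal_mul' (by positivity)]
  congr 1
  field_simp

theorem entropy_formula (hg : IsPolarKernel (harmonicKernel γ σ L w)) (ν : Measure ℝ)
    [IsProbabilityMeasure ν] (hν : Integrable (fun s => s ^ 2) ν) :
    HasFiniteEntropy (outputLaw γ σ L w τ (uniformPhaseInput ν)).fst ∧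
      HasFiniteCondEntropy γ σ L w τ (uniformPhaseInput ν) ∧
      amplitudeInfo γ σ L w τ ν ≠ ∞ ∧
      (amplitudeInfo γ σ L w τ ν).toReal =
        diffEntropy (outputLaw γ σ L w τ (uniformPhaseInput ν)).fst
          + Real.log (2 * Real.pi) - condEntropy γ σ L w τ (uniformPhaseInput ν) := by
  have hout := entropy_withDensity measurableSet_Ici (measurable_ampMarginal hg ν)
    (by
      filter_upwards [ae_restrict_mem measurableSet_Ici] with r hr
      exact ampMarginal_nonneg hg ν hr)
    (integrableOn_negMulLog_ampMarginal hg ν hν)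
  rw [← outputLaw_fst (τ := τ) hg ν] at hout
  have hpe : Integrable (fun s => pointEntropy γ σ L w s) ν := by
    obtain ⟨C, hC, hb⟩ := abs_pointEntropy_le hg
    exact (((integrable_const 1).add hν).const_mul C).mono'
      (continuous_pointEntropy hg).aestronglyMeasurable (ae_of_all _ hb)
  have hinfo := amplitudeInfo_eq (τ := τ) hg ν hν
  refine ⟨hout.1, ⟨ae_of_all _ fun x => (entropy_channelLaw hg x).1, ?_⟩, ?_, ?_⟩
  · simp_rw [(entropy_channelLaw hg _).2]
    rw [integrable_comp_fst_iff _ (continuous_pointEntropy hg), uniformPhaseInput_fst]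
    exact hpe
  · rw [hinfo.1]
    exact ENNReal.ofReal_ne_top
  · rw [hinfo.1, ENNReal.toReal_ofReal hinfo.2, hout.2, condEntropy]
    simp_rw [(entropy_channelLaw hg _).2]
    rw [integral_comp_fst_eq _ (continuous_pointEntropy hg), uniformPhaseInput_fst]
    rfl

end

section

/-! ### Classes of laws with a bounded moment -/

/-- A nonempty class of probability laws that is closed under weak limits of sequences, and on
which a moment of higher order than the second one is bounded. -/
structure IsMomentClass (ℱ : Set (Measure ℝ)) (V : ℝ → ℝ) (A : ℝ) : Prop where
  nonempty : ℱ.Nonempty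
  prob : ∀ ν ∈ ℱ, IsProbabilityMeasure ν
  cont : Continuous V
  nonneg : ∀ s, 0 ≤ V s
  growth : ∀ ε : ℝ, 0 < ε → ∃ K : ℝ, ∀ s, s ^ 2 ≤ K + ε * V s
  bound_nonneg : 0 ≤ A
  moment : ∀ ν ∈ ℱ, ∫⁻ s, ENNReal.ofReal (V s) ∂ν ≤ ENNReal.ofReal A
  closed : ∀ (P : ℕ → ProbabilityMeasure ℝ) (Q : ProbabilityMeasure ℝ), Tendsto P atTop (𝓝 Q) →
    (∀ n, (P n : Measure ℝ) ∈ ℱ) → (Q : Measure ℝ) ∈ ℱ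

lemma eventually_lt_add_of_ofReal_le_liminf {a : ℝ} {u : ℕ → ℝ} (hu : ∀ n, 0 ≤ u n)
    (h : ENNReal.ofReal a ≤ liminf (fun n => ENNReal.ofReal (u n)) atTop) {ε : ℝ} (hε : 0 < ε) :
    ∀ᶠ n in atTop, a < u n + ε := by
  -- `ENNReal.ofReal` truncates negative values; for `a < ε` the claim follows from `u n ≥ 0`, and
  -- otherwise `a - ε` is not truncated.
  rcases lt_or_ge a ε with ha | ha
  · exact Eventually.of_forall fun n => by linarith [hu n]
  · have h1 : ENNReal.ofReal (a - ε) < liminf (fun n => ENNReal.ofReal (u n)) atTop :=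
      ((ENNReal.ofReal_lt_ofReal_iff (hε.trans_le ha)).2 (by linarith)).trans_le h
    filter_upwards [eventually_lt_of_lt_liminf h1] with n hn
    have := (ENNReal.ofReal_lt_ofReal_iff_of_nonneg (by linarith)).1 hn
    linarith

lemma lintegral_le_liminf_of_tendsto {P : ℕ → ProbabilityMeasure ℝ} {Q : ProbabilityMeasure ℝ}
    (hPQ : Tendsto P atTop (𝓝 Q)) {f : ℝ → ℝ} (hf : Continuous f) (hf0 : ∀ s, 0 ≤ f s) :
    ∫⁻ s, ENNReal.ofReal (f s) ∂(Q : Measure ℝ)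
      ≤ liminf (fun n => ∫⁻ s, ENNReal.ofReal (f s) ∂(P n : Measure ℝ)) atTop :=
  lintegral_le_liminf_lintegral_of_forall_isOpen_measure_le_liminf_measure hf hf0
    fun _ hG => ProbabilityMeasure.le_liminf_measure_open_of_tendsto hPQ hG

namespace IsMomentClass

variable {ℱ : Set (Measure ℝ)} {V : ℝ → ℝ} {A : ℝ} {ν : Measure ℝ} {Φ : ℝ → ℝ} {C : ℝ}

lemma integrable_weight (h : IsMomentClass ℱ V A) (hν : ν ∈ ℱ) : Integrable V ν :=
  ⟨h.cont.aestronglyMeasurable, (hasFiniteIntegral_iff_ofReal (ae_of_all _ h.nonneg)).2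
    ((h.moment ν hν).trans_lt ENNReal.ofReal_lt_top)⟩

lemma integral_weight_le (h : IsMomentClass ℱ V A) (hν : ν ∈ ℱ) : ∫ s, V s ∂ν ≤ A := by
  rw [integral_eq_lintegral_of_nonneg_ae (ae_of_all _ h.nonneg) h.cont.aestronglyMeasurable]
  exact ENNReal.toReal_le_of_le_ofReal h.bound_nonneg (h.moment ν hν)

lemma integrable_sq (h : IsMomentClass ℱ V A) (hν : ν ∈ ℱ) :
    Integrable (fun s => s ^ 2) ν := by
  have := h.prob ν hν
  obtain ⟨K, hK⟩ := h.growth 1 one_pos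
  refine ((integrable_const K).add ((h.integrable_weight hν).const_mul 1)).mono'
    (by fun_prop) (ae_of_all _ fun s => ?_)
  rw [Real.norm_of_nonneg (sq_nonneg s)]
  exact hK s

lemma integrable_of_abs_le (h : IsMomentClass ℱ V A) (hν : ν ∈ ℱ) (hΦ : Continuous Φ)
    (hb : ∀ s, |Φ s| ≤ C * (1 + s ^ 2)) : Integrable Φ ν := by
  have := h.prob ν hν
  exact (((integrable_const (1 : ℝ)).add (h.integrable_sq hν)).const_mul C).mono'
    hΦ.aestronglyMeasurable (ae_of_all _ hb)

/-- The function `Φ` is unbounded, so weak convergence does not apply to it directly. Adding a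
constant and a small multiple `δ V` makes it nonnegative, and then its integral is lower
semicontinuous; the moment bound makes the cost of `δ V` at most `ε / 2`. -/
lemma eventually_integral_lt_add (h : IsMomentClass ℱ V A) {P : ℕ → ProbabilityMeasure ℝ}
    {Q : ProbabilityMeasure ℝ} (hPQ : Tendsto P atTop (𝓝 Q)) (hP : ∀ n, (P n : Measure ℝ) ∈ ℱ)
    (hΦ : Continuous Φ) (hC : 0 < C) (hb : ∀ s, |Φ s| ≤ C * (1 + s ^ 2)) {ε : ℝ} (hε : 0 < ε) :
    ∀ᶠ n in atTop, ∫ s, Φ s ∂(Q : Measure ℝ) < ∫ s, Φ s ∂(P n : Measure ℝ) + ε := by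
  have hQ := h.closed P Q hPQ hP
  have hA := h.bound_nonneg
  -- This ensures `δ A ≤ ε / 2`; `A + 1` avoids dividing by zero.
  set δ := ε / (2 * (A + 1)) with hδ
  have hδ0 : 0 < δ := by positivity
  obtain ⟨K, hK⟩ := h.growth (δ / C) (by positivity)
  set g : ℝ → ℝ := fun s => (C + C * K) + (δ * V s + Φ s) with hgdef
  have hg0 : ∀ s, 0 ≤ g s := fun s => by
    have h1 := mul_le_mul_of_nonneg_left (hK s) hC.le
    have h2 : C * (K + δ / C * V s) = C * K + δ * V s := by field_simp
    have h3 := (abs_le.1 (hb s)).1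
    simp only [hgdef]
    linarith
  have hgc : Continuous g := by have := h.cont; fun_prop
  have hint : ∀ μ : ProbabilityMeasure ℝ, (μ : Measure ℝ) ∈ ℱ → Integrable g (μ : Measure ℝ) ∧
      ∫ s, g s ∂(μ : Measure ℝ) = (C + C * K) + (δ * ∫ s, V s ∂(μ : Measure ℝ)
        + ∫ s, Φ s ∂(μ : Measure ℝ)) := fun μ hμ => by
    have i1 := (h.integrable_weight hμ).const_mul δ
    have i2 := h.integrable_of_abs_le hμ hΦ hb
    have i3 : Integrable (fun s => δ * V s + Φ s) (μ : Measure ℝ) := i1.add i2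
    refine ⟨(integrable_const _).add i3, ?_⟩
    simp only [hgdef]
    rw [integral_add (integrable_const _) i3, integral_add i1 i2, integral_const_mul]
    simp
  have hlim := lintegral_le_liminf_of_tendsto hPQ hgc hg0
  have hval : ∀ μ : ProbabilityMeasure ℝ, (μ : Measure ℝ) ∈ ℱ →
      ∫⁻ s, ENNReal.ofReal (g s) ∂(μ : Measure ℝ)
        = ENNReal.ofReal (∫ s, g s ∂(μ : Measure ℝ)) := fun μ hμ =>
    (ofReal_integral_eq_lintegral_ofReal (hint μ hμ).1 (ae_of_all _ hg0)).symm
  rw [hval Q hQ] at hlim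
  simp only [fun n => hval (P n) (hP n)] at hlim
  filter_upwards [eventually_lt_add_of_ofReal_le_liminf (fun n => integral_nonneg hg0) hlim
    (half_pos hε)] with n hn
  rw [(hint Q hQ).2, (hint (P n) (hP n)).2] at hn
  have hVQ : 0 ≤ δ * ∫ s, V s ∂(Q : Measure ℝ) :=
    mul_nonneg hδ0.le (integral_nonneg h.nonneg)
  have hVP : δ * ∫ s, V s ∂(P n : Measure ℝ) ≤ ε / 2 := by
    refine (mul_le_mul_of_nonneg_left (h.integral_weight_le (hP n)) hδ0.le).trans ?_
    rw [hδ, div_mul_eq_mul_div, div_le_div_iff₀ (by positivity) (by positivity)]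
    nlinarith
  linarith

lemma tendsto_integral (h : IsMomentClass ℱ V A) {P : ℕ → ProbabilityMeasure ℝ}
    {Q : ProbabilityMeasure ℝ} (hPQ : Tendsto P atTop (𝓝 Q)) (hP : ∀ n, (P n : Measure ℝ) ∈ ℱ)
    (hΦ : Continuous Φ) (hC : 0 < C) (hb : ∀ s, |Φ s| ≤ C * (1 + s ^ 2)) :
    Tendsto (fun n => ∫ s, Φ s ∂(P n : Measure ℝ)) atTop (𝓝 (∫ s, Φ s ∂(Q : Measure ℝ))) := by
  refine Metric.tendsto_nhds.2 fun ε hε => ?_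
  have h2 := h.eventually_integral_lt_add hPQ hP hΦ.neg hC (by simpa using hb) hε
  filter_upwards [h.eventually_integral_lt_add hPQ hP hΦ hC hb hε, h2] with n h1 h2
  simp only [Pi.neg_apply, integral_neg] at h2
  rw [Real.dist_eq, abs_lt]
  constructor <;> linarith

/-- Chebyshev's inequality with the uniform second moment bound `K + A`. -/
lemma isTightMeasureSet (h : IsMomentClass ℱ V A) : IsTightMeasureSet ℱ := by
  rw [isTightMeasureSet_iff_exists_isCompact_measure_compl_le]
  intro ε hε
  rcases eq_or_ne ε ∞ with rfl | hε'
  · exact ⟨∅, isCompact_empty, fun _ _ => le_top⟩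
  have he : 0 < ε.toReal := ENNReal.toReal_pos hε.ne' hε'
  obtain ⟨K, hK⟩ := h.growth 1 one_pos
  set N : ℝ := max 1 ((K + A) / ε.toReal) with hN
  have hN1 : 1 ≤ N := le_max_left _ _
  refine ⟨Icc (-N) N, isCompact_Icc, fun μ hμ => ?_⟩
  have := h.prob μ hμ
  have hsq : ∫ s, s ^ 2 ∂μ ≤ K + A := by
    have i := h.integrable_weight hμ
    refine (integral_mono (h.integrable_sq hμ) ((integrable_const K).add (i.const_mul 1)) hK).trans ?_
    rw [integral_add' (integrable_const K) (i.const_mul 1), integral_const_mul]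
    simpa using h.integral_weight_le hμ
  have h1 := mul_meas_ge_le_integral_of_nonneg (ae_of_all _ fun s => sq_nonneg s)
    (h.integrable_sq hμ) (N ^ 2)
  have h2 : (Icc (-N) N)ᶜ ⊆ {s : ℝ | N ^ 2 ≤ s ^ 2} := fun s hs => by
    by_contra hlt
    exact hs (abs_le.1 (abs_le_of_sq_le_sq (not_le.1 hlt).le (by linarith)))
  have h3 : μ.real {s : ℝ | N ^ 2 ≤ s ^ 2} ≤ ε.toReal := by
    have h4 : K + A ≤ N * ε.toReal := (div_le_iff₀ he).1 (le_max_right _ _)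
    have h5 : N * ε.toReal ≤ N ^ 2 * ε.toReal := by
      refine mul_le_mul_of_nonneg_right ?_ he.le
      nlinarith
    exact le_of_mul_le_mul_left (h1.trans (hsq.trans (h4.trans h5))) (by positivity)
  refine (measure_mono h2).trans ?_
  rw [← ENNReal.ofReal_toReal hε', ← ENNReal.ofReal_toReal (measure_ne_top μ _)]
  exact ENNReal.ofReal_le_ofReal h3

/-- Prokhorov's theorem; closedness under limits of sequences is enough in the weak topology of laws
on the line. -/
lemma isCompact (h : IsMomentClass ℱ V A) :
    IsCompact {P : ProbabilityMeasure ℝ | (P : Measure ℝ) ∈ ℱ} := by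
  have hc : IsClosed {P : ProbabilityMeasure ℝ | (P : Measure ℝ) ∈ ℱ} :=
    IsSeqClosed.isClosed fun P Q hP hPQ => h.closed P Q hPQ hP
  rw [← hc.closure_eq]
  refine isCompact_closure_of_isTightMeasureSet (h.isTightMeasureSet.subset ?_)
  rintro _ ⟨P, hP, rfl⟩
  exact hP

/-- A functional that is upper semicontinuous along sequences attains its maximum. -/
lemma exists_isMaxOn (h : IsMomentClass ℱ V A) {J : Measure ℝ → ℝ}
    (hJ : ∀ (P : ℕ → ProbabilityMeasure ℝ) (Q : ProbabilityMeasure ℝ), Tendsto P atTop (𝓝 Q) →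
      (∀ n, (P n : Measure ℝ) ∈ ℱ) → ∀ ε > 0, ∀ᶠ n in atTop, J (P n) < J Q + ε) :
    ∃ ν ∈ ℱ, IsMaxOn J ℱ ν := by
  obtain ⟨ν₀, hν₀⟩ := h.nonempty
  set K := {P : ProbabilityMeasure ℝ | (P : Measure ℝ) ∈ ℱ}
  have hcs : CompactSpace K := isCompact_iff_compactSpace.1 h.isCompact
  have hne : (univ : Set K).Nonempty := ⟨⟨⟨ν₀, h.prob ν₀ hν₀⟩, hν₀⟩, mem_univ _⟩
  have husc : UpperSemicontinuousOn (fun P : K => J (P : ProbabilityMeasure ℝ)) univ := by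
    intro Q _ y hy
    rw [nhdsWithin_univ]
    refine eventually_iff_seq_eventually.2 fun P hP => ?_
    filter_upwards [hJ (fun n => (P n : ProbabilityMeasure ℝ)) Q
      ((continuous_subtype_val.tendsto Q).comp hP) (fun n => (P n).2) (y - J Q)
      (sub_pos.2 hy)] with n hn
    linarith
  obtain ⟨Q, -, hQ⟩ := husc.exists_isMaxOn hne isCompact_univ
  exact ⟨Q, Q.2, fun ν hν => hQ (mem_univ (⟨⟨ν, h.prob ν hν⟩, hν⟩ : K))⟩

end IsMomentClass

/-! ### The constraint sets -/

section Constraints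

variable {P : ℕ → ProbabilityMeasure ℝ} {Q : ProbabilityMeasure ℝ} {g c : ℝ → ℝ} {A ρ : ℝ}

lemma isAmplitudeLaw_of_tendsto (hPQ : Tendsto P atTop (𝓝 Q))
    (hP : ∀ n, IsAmplitudeLaw (P n : Measure ℝ)) : IsAmplitudeLaw (Q : Measure ℝ) := by
  refine ⟨inferInstance, ?_⟩
  have h := ProbabilityMeasure.le_liminf_measure_open_of_tendsto hPQ (isOpen_Iio (a := (0 : ℝ)))
  simp only [fun n => (hP n).2, liminf_const] at h
  exact le_antisymm h zero_le

lemma peakSet_of_tendsto (hPQ : Tendsto P atTop (𝓝 Q))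
    (hP : ∀ n, (P n : Measure ℝ) ∈ peakSet ρ) : (Q : Measure ℝ) ∈ peakSet ρ := by
  refine ⟨isAmplitudeLaw_of_tendsto hPQ fun n => (hP n).1, ?_⟩
  have h := ProbabilityMeasure.limsup_measure_closed_le_of_tendsto hPQ
    (isClosed_Icc (a := (0 : ℝ)) (b := ρ))
  simp only [fun n => (hP n).2, limsup_const] at h
  exact le_antisymm prob_le_one h

lemma IsAmplitudeLaw.ae_nonneg {ν : Measure ℝ} (hν : IsAmplitudeLaw ν) : ∀ᵐ s ∂ν, 0 ≤ s := by
  rw [ae_iff]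
  simp only [not_le]
  exact hν.2

lemma IsAmplitudeLaw.lintegral_comp_abs {ν : Measure ℝ} (hν : IsAmplitudeLaw ν) (c : ℝ → ℝ) :
    ∫⁻ s, ENNReal.ofReal (c |s|) ∂ν = ∫⁻ s, ENNReal.ofReal (c s) ∂ν := by
  refine lintegral_congr_ae ?_
  filter_upwards [hν.ae_nonneg] with s hs
  rw [abs_of_nonneg hs]

lemma IsCost.nonneg (hc : IsCost g c) {r : ℝ} (hr : 0 ≤ r) : 0 ≤ c r :=
  hc.zero.symm.trans_le (hc.mono (mem_Ici.2 le_rfl) hr hr)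

/-- The analytic extension makes the cost continuous on `[0, ∞)`; composing with `|s|` gives a
continuous weight on the line that agrees with it almost everywhere under amplitude laws. -/
lemma IsCost.continuous_comp_abs (hc : IsCost g c) : Continuous fun s => c |s| := by
  obtain ⟨δ, hδ, f, hf, hfc⟩ := hc.analytic
  have h : (fun s : ℝ => c |s|) = fun s : ℝ => (f ((|s| : ℝ) : ℂ)).re := by
    ext s
    rw [hfc _ (abs_nonneg s), Complex.ofReal_re]
  rw [h]
  exact Complex.continuous_re.comp (hf.continuousOn.comp_continuous (by fun_prop)
    fun s => by simpa using hδ)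

lemma costSet_of_tendsto (hc : IsCost g c) (hPQ : Tendsto P atTop (𝓝 Q))
    (hP : ∀ n, (P n : Measure ℝ) ∈ costSet c A) : (Q : Measure ℝ) ∈ costSet c A := by
  have hQ := isAmplitudeLaw_of_tendsto hPQ fun n => (hP n).1
  refine ⟨hQ, ?_⟩
  have h := lintegral_le_liminf_of_tendsto hPQ hc.continuous_comp_abs
    fun s => hc.nonneg (abs_nonneg s)
  simp only [fun n => (hP n).1.lintegral_comp_abs c] at h
  rw [← hQ.lintegral_comp_abs c]
  refine h.trans ((liminf_le_liminf (Eventually.of_forall fun n => (hP n).2)).trans ?_)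
  rw [liminf_const]

lemma isAmplitudeLaw_dirac : IsAmplitudeLaw (Measure.dirac 0) :=
  ⟨inferInstance, by simp⟩

lemma dirac_mem_peakSet (hρ : 0 < ρ) : Measure.dirac 0 ∈ peakSet ρ :=
  ⟨isAmplitudeLaw_dirac, by rw [Measure.dirac_apply_of_mem]; exact ⟨le_rfl, hρ.le⟩⟩

lemma dirac_mem_costSet (hc : IsCost g c) : Measure.dirac 0 ∈ costSet c A :=
  ⟨isAmplitudeLaw_dirac, by rw [lintegral_dirac, hc.zero]; simp⟩

/-- On a bounded range any higher moment serves; the fourth is chosen, with `s² ≤ 1 / ε + ε s⁴`.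
This covers the peak and the joint constraint. -/
lemma isMomentClass_of_subset_peakSet {ℱ : Set (Measure ℝ)} (hρ : 0 < ρ) (hne : ℱ.Nonempty)
    (hsub : ℱ ⊆ peakSet ρ) (hcl : ∀ (P : ℕ → ProbabilityMeasure ℝ) (Q : ProbabilityMeasure ℝ),
      Tendsto P atTop (𝓝 Q) → (∀ n, (P n : Measure ℝ) ∈ ℱ) → (Q : Measure ℝ) ∈ ℱ) :
    IsMomentClass ℱ (fun s => s ^ 4) (ρ ^ 4) where
  nonempty := hne
  prob := fun ν hν => (hsub hν).1.1
  cont := by fun_prop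
  nonneg := fun s => by positivity
  growth := fun ε hε => by
    refine ⟨1 / ε, fun s => ?_⟩
    rw [← sub_nonneg]
    have : 1 / ε + ε * s ^ 4 - s ^ 2 = ((ε * s ^ 2 - 1) ^ 2 + ε * s ^ 2) / ε := by
      field_simp
      ring
    rw [this]
    positivity
  bound_nonneg := by positivity
  moment := fun ν hν => by
    have := (hsub hν).1.1
    have h1 : ∀ᵐ s ∂ν, s ∈ Icc 0 ρ := (prob_compl_eq_zero_iff measurableSet_Icc).2 (hsub hν).2
    calc ∫⁻ s, ENNReal.ofReal (s ^ 4) ∂ν ≤ ∫⁻ _, ENNReal.ofReal (ρ ^ 4) ∂ν := by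
          refine lintegral_mono_ae ?_
          filter_upwards [h1] with s hs
          exact ENNReal.ofReal_le_ofReal (pow_le_pow_left₀ hs.1 hs.2 4)
      _ = ENNReal.ofReal (ρ ^ 4) := by simp
  closed := hcl

lemma isMomentClass_costSet (hc : IsCost (fun r => r ^ 2) c) (hA : 0 < A) :
    IsMomentClass (costSet c A) (fun s => c |s|) A where
  nonempty := ⟨_, dirac_mem_costSet hc⟩
  prob := fun ν hν => hν.1.1
  cont := hc.continuous_comp_abs
  nonneg := fun s => hc.nonneg (abs_nonneg s)
  growth := fun ε hε => by
    obtain ⟨N, hN⟩ := (hc.growth.def hε).exists_forall_of_atTop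
    refine ⟨N ^ 2, fun s => ?_⟩
    have h0 : 0 ≤ ε * c |s| := mul_nonneg hε.le (hc.nonneg (abs_nonneg s))
    rcases le_total N |s| with h | h
    · have := hN |s| h
      rw [Real.norm_of_nonneg (sq_nonneg _), Real.norm_of_nonneg (hc.nonneg (abs_nonneg s)),
        sq_abs] at this
      linarith [sq_nonneg N]
    · have := pow_le_pow_left₀ (abs_nonneg s) h 2
      rw [sq_abs] at this
      linarith
  bound_nonneg := hA.le
  moment := fun ν hν => by
    rw [hν.1.lintegral_comp_abs c]
    exact hν.2
  closed := fun _ _ hPQ hP => costSet_of_tendsto hc hPQ hP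

theorem IsConstraintSet.exists_isMomentClass {ℱ : Set (Measure ℝ)} (hℱ : IsConstraintSet ℱ) :
    ∃ V A, IsMomentClass ℱ V A := by
  cases hℱ with
  | peak ρ hρ =>
    exact ⟨_, _, isMomentClass_of_subset_peakSet hρ ⟨_, dirac_mem_peakSet hρ⟩ subset_rfl
      fun _ _ hPQ hP => peakSet_of_tendsto hPQ hP⟩
  | cost c A hc hA => exact ⟨_, _, isMomentClass_costSet hc hA⟩
  | joint ρ c A hρ hc hA =>
    exact ⟨_, _, isMomentClass_of_subset_peakSet hρ
      ⟨_, dirac_mem_peakSet hρ, dirac_mem_costSet hc⟩ inter_subset_left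
      fun _ _ hPQ hP => ⟨peakSet_of_tendsto hPQ fun n => (hP n).1,
        costSet_of_tendsto hc hPQ fun n => (hP n).2⟩⟩

lemma IsConstraintSet.isAmplitudeLaw {ℱ : Set (Measure ℝ)} (hℱ : IsConstraintSet ℱ)
    {ν : Measure ℝ} (hν : ν ∈ ℱ) : IsAmplitudeLaw ν := by
  cases hℱ with
  | peak ρ hρ => exact hν.1
  | cost c A hc hA => exact hν.1
  | joint ρ c A hρ hc hA => exact hν.1.1

end Constraints

end

section

/-! ### The maximizing amplitude law -/

variable {γ σ L w τ : ℝ}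

/-- The mean output amplitude for a deterministic input of amplitude `r₀`. -/
def meanAmplitude (γ σ L w r₀ : ℝ) : ℝ :=
  ∫ r in Ici (0 : ℝ), ∫ θ in (0 : ℝ)..2 * Real.pi, r * harmonicKernel γ σ L w r r₀ θ

lemma integral_fst_mul_condPdf (hg : IsPolarKernel (harmonicKernel γ σ L w)) (x : ℝ × ℝ) :
    ∫ y, y.1 * condPdf γ σ L w τ y x ∂polarMeasure = meanAmplitude γ σ L w x.1 := by
  have hi := (isDominated_fst_mul_condPdf (τ := τ) hg).integrable x
  simp_rw [condPdf_eq] at hi ⊢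
  rw [integral_polarMeasure_of_periodic
    (h := fun r θ => r * harmonicKernel γ σ L w r x.1 θ)
    (fun r θ => by simp only [hg.periodic r x.1 θ]) _ hi]
  rfl

lemma continuous_meanAmplitude (hg : IsPolarKernel (harmonicKernel γ σ L w)) :
    Continuous (meanAmplitude γ σ L w) := by
  have h := (isDominated_fst_mul_condPdf (τ := 0) hg).continuous_integral
  simp_rw [integral_fst_mul_condPdf hg] at h
  exact h.comp (f := fun r : ℝ => (r, (0 : ℝ))) (by fun_prop)

lemma abs_meanAmplitude_le (hg : IsPolarKernel (harmonicKernel γ σ L w)) :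
    ∃ C : ℝ, 0 < C ∧ ∀ r₀, |meanAmplitude γ σ L w r₀| ≤ C * (1 + r₀ ^ 2) := by
  obtain ⟨C, hC, h⟩ := (isDominated_fst_mul_condPdf (τ := 0) hg).abs_integral_le
  simp_rw [integral_fst_mul_condPdf hg] at h
  exact ⟨C, hC, fun r => h (r, 0)⟩

lemma integrableOn_mul_ampMarginal (hg : IsPolarKernel (harmonicKernel γ σ L w)) (ν : Measure ℝ)
    [IsProbabilityMeasure ν] (hν : Integrable (fun s => s ^ 2) ν) :
    IntegrableOn (fun r => r * ampMarginal γ σ L w ν r) (Ici 0) := by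
  have hpi := Real.pi_pos
  have h : Integrable (fun y : ℝ × ℝ => y.1 * (1 / (2 * Real.pi) * ampMarginal γ σ L w ν y.1))
      polarMeasure :=
    (integrable_fst_mul_outDensity (τ := 0) hg _ (integrable_uniformPhaseInput hν)).congr
      ((EventuallyEq.refl _ fun y : ℝ × ℝ => y.1).mul (outDensity_uniformPhaseInput_ae hg ν))
  refine ((integrableOn_of_comp_fst (f := fun r => r * (1 / (2 * Real.pi) *
    ampMarginal γ σ L w ν r)) h).const_mul (2 * Real.pi)).congr (ae_of_all _ fun r => ?_)
  simp only
  field_simp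

lemma integral_mul_ampMarginal (hg : IsPolarKernel (harmonicKernel γ σ L w)) (ν : Measure ℝ)
    [IsProbabilityMeasure ν] (hν : Integrable (fun s => s ^ 2) ν) :
    ∫ r in Ici (0 : ℝ), r * ampMarginal γ σ L w ν r = ∫ s, meanAmplitude γ σ L w s ∂ν := by
  have hpi := Real.pi_pos
  have hi := (isDominated_fst_mul_condPdf (τ := 0) hg).integrable_prod (uniformPhaseInput ν)
    (integrable_uniformPhaseInput hν)
  have h1 := integral_prod_symm _ hi
  have h2 := integral_prod _ hi
  simp_rw [integral_fst_mul_condPdf hg] at h2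
  rw [integral_comp_fst_eq _ (continuous_meanAmplitude hg), uniformPhaseInput_fst, h1] at h2
  rw [← h2]
  simp only [integral_const_mul]
  have e : ∫ y : ℝ × ℝ, y.1 * (∫ x, condPdf γ σ L w 0 y x ∂uniformPhaseInput ν) ∂polarMeasure
      = ∫ y : ℝ × ℝ, y.1 * (1 / (2 * Real.pi) * ampMarginal γ σ L w ν y.1) ∂polarMeasure :=
    integral_congr_ae
      ((EventuallyEq.refl _ fun y : ℝ × ℝ => y.1).mul (outDensity_uniformPhaseInput_ae hg ν))
  rw [e, integral_comp_fst_polarMeasure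
    (fun r => r * (1 / (2 * Real.pi) * ampMarginal γ σ L w ν r)), ← integral_const_mul]
  refine setIntegral_congr_fun measurableSet_Ici fun r _ => ?_
  field_simp

/-- The output densities converge pointwise when the input laws converge weakly. -/
lemma tendsto_ampMarginal (hg : IsPolarKernel (harmonicKernel γ σ L w))
    {P : ℕ → ProbabilityMeasure ℝ} {Q : ProbabilityMeasure ℝ} (hPQ : Tendsto P atTop (𝓝 Q))
    {r : ℝ} (hr : 0 ≤ r) :
    Tendsto (fun n => ampMarginal γ σ L w (P n) r) atTop (𝓝 (ampMarginal γ σ L w Q r)) := by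
  obtain ⟨C, hC, hb⟩ := ampDensity_le hg
  have hcont : Continuous fun s => ampDensity γ σ L w r s :=
    (continuous_ampDensity hg).comp (f := fun s : ℝ => (r, s)) (by fun_prop)
  exact ProbabilityMeasure.tendsto_iff_forall_integral_tendsto.1 hPQ
    (BoundedContinuousFunction.ofNormedAddCommGroup (fun s => ampDensity γ σ L w r s) hcont (C * r)
      fun s => by
        rw [Real.norm_of_nonneg (ampDensity_nonneg hg hr s)]
        exact hb r s hr)

/-- Mean output amplitude and conditional entropy grow at most quadratically in the input amplitude,
so their expectations converge. Upper semicontinuity of `h(R)` is Fatou's lemma after adding the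
mean amplitude to make the integrand nonnegative. -/
lemma eventually_phaseInfo_lt (hg : IsPolarKernel (harmonicKernel γ σ L w))
    {ℱ : Set (Measure ℝ)} {V : ℝ → ℝ} {A : ℝ} (h : IsMomentClass ℱ V A)
    {P : ℕ → ProbabilityMeasure ℝ} {Q : ProbabilityMeasure ℝ} (hPQ : Tendsto P atTop (𝓝 Q))
    (hP : ∀ n, (P n : Measure ℝ) ∈ ℱ) {ε : ℝ} (hε : 0 < ε) :
    ∀ᶠ n in atTop, phaseInfo γ σ L w (P n) < phaseInfo γ σ L w Q + ε := by
  have hQ := h.closed P Q hPQ hP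
  obtain ⟨C₁, hC₁, hb₁⟩ := abs_meanAmplitude_le hg
  obtain ⟨C₂, hC₂, hb₂⟩ := abs_pointEntropy_le hg
  have hmean := h.tendsto_integral hPQ hP (continuous_meanAmplitude hg) hC₁ hb₁
  have hent := h.tendsto_integral hPQ hP (continuous_pointEntropy hg) hC₂ hb₂
  -- By `neg_mul_log_le` with `s = r`, `-p log p ≤ r p + e^{-r}`; the difference is the nonnegative
  -- integrand for Fatou.
  set u : ProbabilityMeasure ℝ → ℝ → ℝ := fun ν r =>
    (r * ampMarginal γ σ L w ν r + Real.exp (-r)) - Real.negMulLog (ampMarginal γ σ L w ν r)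
    with hu
  have hu0 : ∀ ν, ∀ r ∈ Ici (0 : ℝ), 0 ≤ u ν r := fun ν r hr => by
    have := neg_mul_log_le _ (ampMarginal_nonneg hg (ν : Measure ℝ) hr) r
    simp only [hu]
    linarith
  have hu0' : ∀ ν, 0 ≤ᵐ[volume.restrict (Ici 0)] u ν := fun ν =>
    (ae_restrict_mem measurableSet_Ici).mono (hu0 ν)
  have hum : ∀ ν, Measurable (u ν) := fun ν => by
    have := measurable_ampMarginal hg (ν : Measure ℝ)
    exact ((measurable_id.mul this).add (by fun_prop)).sub
      (Real.continuous_negMulLog.measurable.comp this)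
  set D := ∫ r in Ici (0 : ℝ), Real.exp (-r) with hD
  have hui : ∀ ν : ProbabilityMeasure ℝ, (ν : Measure ℝ) ∈ ℱ → IntegrableOn (u ν) (Ici 0) ∧
      ∫ r in Ici (0 : ℝ), u ν r = (∫ s, meanAmplitude γ σ L w s ∂(ν : Measure ℝ)) + D
        - ∫ r in Ici (0 : ℝ), Real.negMulLog (ampMarginal γ σ L w ν r) := fun ν hν => by
    have i0 := h.integrable_sq hν
    have i1 := integrableOn_mul_ampMarginal hg _ i0
    have i2 := integrableOn_negMulLog_ampMarginal hg _ i0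
    have i3 : IntegrableOn (fun r => r * ampMarginal γ σ L w (ν : Measure ℝ) r + Real.exp (-r))
      (Ici 0) := i1.add integrableOn_exp_neg
    refine ⟨i3.sub i2, ?_⟩
    simp only [hu]
    rw [integral_sub i3 i2, integral_add i1 integrableOn_exp_neg,
      integral_mul_ampMarginal hg _ i0]
  have hval : ∀ ν : ProbabilityMeasure ℝ, (ν : Measure ℝ) ∈ ℱ →
      ∫⁻ r in Ici (0 : ℝ), ENNReal.ofReal (u ν r)
        = ENNReal.ofReal (∫ r in Ici (0 : ℝ), u ν r) := fun ν hν =>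
    (ofReal_integral_eq_lintegral_ofReal (hui ν hν).1 (hu0' ν)).symm
  have hfatou : ENNReal.ofReal (∫ r in Ici (0 : ℝ), u Q r)
      ≤ liminf (fun n => ENNReal.ofReal (∫ r in Ici (0 : ℝ), u (P n) r)) atTop := by
    simp only [← hval Q hQ, fun n => (hval (P n) (hP n)).symm]
    refine le_of_eq_of_le ?_ (lintegral_liminf_le fun n => (hum (P n)).ennreal_ofReal)
    refine setLIntegral_congr_fun measurableSet_Ici fun r hr => ?_
    have ht := tendsto_ampMarginal hg hPQ hr
    exact ((ENNReal.continuous_ofReal.tendsto _).comp (((ht.const_mul r).add_const _).sub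
      ((Real.continuous_negMulLog.tendsto _).comp ht))).liminf_eq.symm
  filter_upwards [eventually_lt_add_of_ofReal_le_liminf
      (fun n => setIntegral_nonneg measurableSet_Ici (hu0 (P n))) hfatou
      (show 0 < ε / 3 by positivity),
    hmean.eventually (Metric.ball_mem_nhds _ (show 0 < ε / 3 by positivity)),
    hent.eventually (Metric.ball_mem_nhds _ (show 0 < ε / 3 by positivity))] with n h1 h2 h3
  rw [(hui Q hQ).2, (hui _ (hP n)).2] at h1
  rw [Real.dist_eq, abs_lt] at h2 h3
  simp only [phaseInfo]
  linarith [h2.1, h2.2, h3.1, h3.2]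

lemma uniformPhaseInput_mem_admissible {ℱ : Set (Measure ℝ)} {ν : Measure ℝ}
    (hν : IsAmplitudeLaw ν) (hνℱ : ν ∈ ℱ) : uniformPhaseInput ν ∈ admissible ℱ := by
  have := hν.1
  refine ⟨inferInstance, ?_, by rwa [uniformPhaseInput_fst]⟩
  have hphase : ∀ᵐ φ ∂uniformPhase, φ ∈ Ico 0 (2 * Real.pi) := by
    rw [uniformPhase]
    exact Measure.ae_smul_measure (ae_restrict_mem measurableSet_Ico) _
  rw [← mem_ae_iff]
  have h1 : ∀ᵐ x ∂uniformPhaseInput ν, 0 ≤ x.1 :=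
    Measure.quasiMeasurePreserving_fst.ae hν.ae_nonneg
  have h2 : ∀ᵐ x ∂uniformPhaseInput ν, x.2 ∈ Ico 0 (2 * Real.pi) :=
    Measure.quasiMeasurePreserving_snd.ae hphase
  filter_upwards [h1, h2] with x hx1 hx2 using ⟨hx1, hx2⟩

/-- The capacity is attained by a uniform phase and some amplitude law. -/
theorem isGreatest_capacity (hg : IsPolarKernel (harmonicKernel γ σ L w)) {ℱ : Set (Measure ℝ)}
    (hℱ : IsConstraintSet ℱ) :
    IsGreatest (amplitudeInfo γ σ L w τ '' ℱ) (capacity γ σ L w τ ℱ) := by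
  obtain ⟨V, A, h⟩ := hℱ.exists_isMomentClass
  obtain ⟨ν, hν, hmax⟩ := h.exists_isMaxOn fun P Q hPQ hP ε hε =>
    eventually_phaseInfo_lt hg h hPQ hP hε
  have hle : ∀ μ ∈ ℱ, amplitudeInfo γ σ L w τ μ ≤ capacity γ σ L w τ ℱ := fun μ hμ =>
    le_iSup₂_of_le (uniformPhaseInput μ)
      (uniformPhaseInput_mem_admissible (hℱ.isAmplitudeLaw hμ) hμ) le_rfl
  refine ⟨⟨ν, hν, le_antisymm (hle ν hν) (iSup₂_le fun μ hμ => ?_)⟩, ?_⟩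
  · obtain ⟨hμ1, -, hμ2⟩ := hμ
    have := h.prob ν hν
    refine (mutualInfo_le_amplitudeInfo hg μ (h.integrable_sq hμ2)).trans ?_
    rw [(amplitudeInfo_eq hg _ (h.integrable_sq hμ2)).1,
      (amplitudeInfo_eq hg _ (h.integrable_sq hν)).1]
    exact ENNReal.ofReal_le_ofReal (hmax hμ2)
  · rintro _ ⟨μ, hμ, rfl⟩
    exact hle μ hμ

end

end

end PZD

theorem proposition1 (γ σ L w τ : ℝ) (hγ : 0 < γ) (hσ : 0 < σ) (hL : 0 < L)
    (hw : (w = 1 ∧ τ = γ * L) ∨ (w = 2 ∧ τ = 0))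
    (ℱ : Set (Measure ℝ)) (hℱ : PZD.IsConstraintSet ℱ) :
    IsGreatest (PZD.amplitudeInfo γ σ L w τ '' ℱ) (PZD.capacity γ σ L w τ ℱ) ∧
    ∀ ν ∈ ℱ,
      PZD.HasFiniteEntropy (PZD.outputLaw γ σ L w τ (PZD.uniformPhaseInput ν)).fst ∧
      PZD.HasFiniteCondEntropy γ σ L w τ (PZD.uniformPhaseInput ν) ∧
      PZD.amplitudeInfo γ σ L w τ ν ≠ ∞ ∧
      (PZD.amplitudeInfo γ σ L w τ ν).toReal =
        PZD.diffEntropy (PZD.outputLaw γ σ L w τ (PZD.uniformPhaseInput ν)).fst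
          + Real.log (2 * Real.pi)
          - PZD.condEntropy γ σ L w τ (PZD.uniformPhaseInput ν) := by
  have hg := PZD.isPolarKernel_harmonicKernel hγ hσ hL (hw.imp And.left And.left)
  obtain ⟨V, A, h⟩ := hℱ.exists_isMomentClass
  refine ⟨PZD.isGreatest_capacity hg hℱ, fun ν hν => ?_⟩
  have := h.prob ν hν
  exact PZD.entropy_formula hg ν (h.integrable_sq hν)
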